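/- **Conventions.** Graphs are finite, simple and undirected. A *module* of $G=(V,E)$ is a set $M\subseteq V$ such that every vertex outside $M$ is adjacent to all or to no vertices of $M$; a nonempty module is *strong* if it is comparable with or disjoint from every other module. The strong modules ordered by inclusion form the modular decomposition tree; a vertex $M$ with $|M|\ge 2$ of this tree is *prime* if $G[M]$ and its complement are both connected. The *modular-width* $mw(G)$ is the least $k$ such that every prime vertex has at most $k$ children. A *vertex cover* (VC) meets every edge; a *connected vertex cover* (CVC) is a vertex cover $X$ with $G[X]$ connected (the empty graph counts as connected); a *feedback vertex set* (FVS) is a set $X$ with $G-X$ a forest; an *odd cycle transversal* (OCT) is a set $X$ with $G-X$ bipartite. For each of these four notions, the problem parameterized by $mw$ is the set of pairs $(\langle G,k\rangle, mw(G))$, where $G$ is a graph given by its adjacency matrix, $k$ is an integer, and $G$ has such a set of size at most $k$. A parameterized problem $Q\subseteq\{0,1\}^*\times\mathbb N$ has a *polynomial Turing compression* (PTC) if there are a problem $L\subseteq\{0,1\}^*$, a polynomial $f$ and a polynomial-time algorithm with an oracle for $L$ that decides for every input $(x,p)$ whether $(x,p)\in Q$, all of its oracle queries having length at most $f(p)$.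 For a module $M$ of $G$ and a graph $H$, the graph $G'$ obtained from $G$ by *replacing $G[M]$ with $H$* arises from the disjoint union of $G-M$ and $H$ by joining every vertex of $H$ to every vertex outside $M$ that has a neighbour in $M$. **Lemma.** (a) Vertex Cover($mw$), Connected Vertex Cover($mw$), Feedback Vertex Set($mw$) and Odd Cycle Transversal($mw$) have PTCs. (b) Let $F_v$, $F_{vc}$, $F_{cvc}$, $F_{fvs}$, $F_{oct}$ denote the number of vertices and the minimum sizes of a VC, CVC, FVS and OCT ($F_{cvc}=\infty$ if there is no CVC). Let $M$ be a module of a graph $G$, let $H$ be a graph with $F(G[M])=F(H)$ for $F\in\{F_v,F_{vc},F_{fvs},F_{oct}\}$, and let $G'$ be obtained from $G$ by replacing $G[M]$ with $H$. Then $F(G')\le F(G)$ for $F\in\{F_v,F_{vc},F_{fvs},F_{oct}\}$. If, in addition, $G$ and $H$ are connected, and $F_{cvc}(G[M])=F_{cvc}(H)$ in case $G[M]$ has a CVC, then $F_{cvc}(G')\le F_{cvc}(G)$. -/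

import Mathlib

/-! ## Oracle random access machines with a step count -/

/-- Programs of a random access machine with an oracle. Registers and memory cells hold natural
numbers; the only arithmetic is addition and truncated subtraction, so that unit cost per
instruction is polynomially equivalent to the running time of an (oracle) Turing machine. -/
inductive Prog : Type
  /-- do nothing -/
  | skip
  /-- `r_d := c` -/
  | const (d c : ℕ)
  /-- `r_d := r_a + r_b` -/
  | add (d a b : ℕ)
  /-- `r_d := r_a - r_b` (truncated at `0`) -/
  | sub (d a b : ℕ)
  /-- `r_d := mem[r_a]` -/
  | load (d a : ℕ)
  /-- `mem[r_a] := r_b` -/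
  | store (a b : ℕ)
  /-- append one bit (whether `r_a` is nonzero) to the query string -/
  | emit (a : ℕ)
  /-- submit the query string to the oracle, put the answer into `r_d`, reset the query string -/
  | ask (d : ℕ)
  /-- run `p`, then `q` -/
  | seq (p q : Prog)
  /-- if `r_c` is nonzero run `p`, otherwise run `q` -/
  | ite (c : ℕ) (p q : Prog)
  /-- as long as `r_c` is nonzero run `p` -/
  | loop (c : ℕ) (p : Prog)

/-- A configuration of the machine. -/
structure MachineState : Type where
  /-- the registers -/
  reg : ℕ → ℕ
  /-- the memory -/
  mem : ℕ → ℕ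
  /-- the query string under construction -/
  query : List Bool
  /-- all the queries that were submitted to the oracle so far -/
  asked : List (List Bool)

/-- Assign the value `v` to the register `d`. -/
def MachineState.setReg (s : MachineState) (d v : ℕ) : MachineState :=
  { s with reg := Function.update s.reg d v }

open Classical in
/-- One call of the oracle for the problem `L`. -/
noncomputable def MachineState.callOracle (L : Set (List Bool)) (s : MachineState) (d : ℕ) :
    MachineState where
  reg := Function.update s.reg d (if s.query ∈ L then 1 else 0)
  mem := s.mem
  query := []
  asked := s.query :: s.asked

/-- `Exec L p s t s'`: with an oracle for `L`, the program `p` started in `s` halts in `s'` after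
exactly `t` steps. Every instruction and every test of a condition is one step. -/
inductive Exec (L : Set (List Bool)) : Prog → MachineState → ℕ → MachineState → Prop
  | skip (s) : Exec L .skip s 1 s
  | const (d c s) : Exec L (.const d c) s 1 (s.setReg d c)
  | add (d a b s) : Exec L (.add d a b) s 1 (s.setReg d (s.reg a + s.reg b))
  | sub (d a b s) : Exec L (.sub d a b) s 1 (s.setReg d (s.reg a - s.reg b))
  | load (d a s) : Exec L (.load d a) s 1 (s.setReg d (s.mem (s.reg a)))
  | store (a b s) :
      Exec L (.store a b) s 1 { s with mem := Function.update s.mem (s.reg a) (s.reg b) }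
  | emit (a s) : Exec L (.emit a) s 1 { s with query := s.query ++ [decide (s.reg a ≠ 0)] }
  | ask (d s) : Exec L (.ask d) s 1 (s.callOracle L d)
  | seq {p q s t s' t' s''} :
      Exec L p s t s' → Exec L q s' t' s'' → Exec L (.seq p q) s (t + t') s''
  | ite_true {c p q s t s'} :
      s.reg c ≠ 0 → Exec L p s t s' → Exec L (.ite c p q) s (t + 1) s'
  | ite_false {c p q s t s'} :
      s.reg c = 0 → Exec L q s t s' → Exec L (.ite c p q) s (t + 1) s'
  | loop_stop {c p s} : s.reg c = 0 → Exec L (.loop c p) s 1 s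
  | loop_step {c p s t s' t' s''} :
      s.reg c ≠ 0 → Exec L p s t s' → Exec L (.loop c p) s' t' s'' →
        Exec L (.loop c p) s (t + t' + 1) s''

/-- The initial configuration on input `(x, k)`: register `0` holds the length of `x`,
register `1` holds `k`, memory cell `i` holds the `i`-th bit of `x`; all else is `0`. -/
def initState (x : List Bool) (k : ℕ) : MachineState where
  reg := fun i => if i = 0 then x.length else if i = 1 then k else 0
  mem := fun i => (x.getD i false).toNat
  query := []
  asked := []

/-- A parameterized problem `Q ⊆ {0,1}* × ℕ` has a polynomial Turing compression: for some problem
`L` there is a program with an oracle for `L` that decides every input `(x, k)` in time polynomial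
in `|x| + k` (acceptance: register `0` is nonzero on halting), and all of whose queries on that
input have length at most a polynomial in `k`. -/
def HasPTC (Q : Set (List Bool × ℕ)) : Prop :=
  ∃ (L : Set (List Bool)) (A : Prog) (time size : Polynomial ℕ),
    ∀ (x : List Bool) (k : ℕ), ∃ (t : ℕ) (s : MachineState),
      Exec L A (initState x k) t s ∧
      t ≤ time.eval (x.length + k) ∧
      (s.reg 0 ≠ 0 ↔ (x, k) ∈ Q) ∧
      ∀ q ∈ s.asked, q.length ≤ size.eval k

/-! ## Modules and modular-width -/

section Graphs

variable {V : Type*}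

/-- Every vertex outside `M` is adjacent to no vertex of `M` or to all vertices of `M`. -/
def IsGraphModule (G : SimpleGraph V) (M : Set V) : Prop :=
  ∀ v, v ∉ M → (∀ u ∈ M, ¬ G.Adj v u) ∨ (∀ u ∈ M, G.Adj v u)

/-- Strong modules: nonempty modules that overlap no other module. These are the vertices of the
modular decomposition tree, which is ordered by inclusion. -/
def IsStrongModule (G : SimpleGraph V) (M : Set V) : Prop :=
  M.Nonempty ∧ IsGraphModule G M ∧
    ∀ M', IsGraphModule G M' → M ⊆ M' ∨ M' ⊆ M ∨ Disjoint M M'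

/-- The children of `M` in the modular decomposition tree: the strong modules that are maximal
among those properly contained in `M`. -/
def mdChildren (G : SimpleGraph V) (M : Set V) : Set (Set V) :=
  {C | IsStrongModule G C ∧ C ⊂ M ∧ ∀ D, IsStrongModule G D → C ⊂ D → ¬ D ⊂ M}

/-- Prime vertices of the modular decomposition tree: internal vertices `M` for which `G[M]` and
its complement are both connected. -/
def IsPrimeNode (G : SimpleGraph V) (M : Set V) : Prop :=
  IsStrongModule G M ∧ M.Nontrivial ∧ (G.induce M).Connected ∧ (G.induce M)ᶜ.Connected

/-- The modular-width: the least `k` such that every prime vertex of the modular decomposition tree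
has at most `k` children (so `0` if there is no prime vertex). -/
noncomputable def modularWidth (G : SimpleGraph V) : ℕ :=
  sInf {k | ∀ M, IsPrimeNode G M → (mdChildren G M).ncard ≤ k}

/-! ## The four problems -/

/-- `X` is a vertex cover and `G[X]` is connected (the empty graph counts as connected). -/
def IsConnectedVertexCover (G : SimpleGraph V) (X : Set V) : Prop :=
  G.IsVertexCover X ∧ (G.induce X).Preconnected

/-- `G - X` is a forest. -/
def IsFeedbackVertexSet (G : SimpleGraph V) (X : Set V) : Prop :=
  (G.induce Xᶜ).IsAcyclic

/-- `G - X` is bipartite. -/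
def IsOddCycleTransversal (G : SimpleGraph V) (X : Set V) : Prop :=
  (G.induce Xᶜ).IsBipartite

/-- The least size of a vertex set with property `P`, and `⊤` if there is none. -/
noncomputable def minSize (P : Set V → Prop) : ℕ∞ :=
  ⨅ (X : Set V) (_ : P X), X.encard

/-- The size of a minimum vertex cover. -/
noncomputable def minVC (G : SimpleGraph V) : ℕ∞ := minSize G.IsVertexCover

/-- The size of a minimum connected vertex cover (`⊤` if there is none). -/
noncomputable def minCVC (G : SimpleGraph V) : ℕ∞ := minSize (IsConnectedVertexCover G)

/-- The size of a minimum feedback vertex set. -/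
noncomputable def minFVS (G : SimpleGraph V) : ℕ∞ := minSize (IsFeedbackVertexSet G)

/-- The size of a minimum odd cycle transversal. -/
noncomputable def minOCT (G : SimpleGraph V) : ℕ∞ := minSize (IsOddCycleTransversal G)

/-- The graph obtained from `G` by replacing `G[M]` with `H`: delete `M`, add `H`, and join every
vertex of `H` to every vertex of `N(M)`. -/
def moduleReplace {W : Type*} (G : SimpleGraph V) (M : Set V) (H : SimpleGraph W) :
    SimpleGraph ((Mᶜ : Set V) ⊕ W) where
  Adj
    | .inl u, .inl v => G.Adj u v
    | .inr a, .inr b => H.Adj a b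
    | .inl u, .inr _ => ∃ m ∈ M, G.Adj u m
    | .inr _, .inl v => ∃ m ∈ M, G.Adj v m
  symm := ⟨by
    rintro (u | a) (v | b) h
    · exact G.adj_symm h
    · exact h
    · exact h
    · exact H.adj_symm h⟩
  loopless := ⟨by
    rintro (u | a) h
    · exact G.loopless.irrefl _ h
    · exact H.loopless.irrefl _ h⟩

end Graphs

/-! ## Instances as binary strings -/

/-- Binary code of an integer: a sign bit followed by the binary digits of its absolute value. -/
def encodeInt (k : ℤ) : List Bool := decide (k < 0) :: k.natAbs.bits

open Classical in
/-- Code of a graph with vertex set `{0, …, n-1}` together with an integer: `n` in unary, the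
adjacency matrix row by row, and the integer in binary. -/
noncomputable def encodeInstance {n : ℕ} (G : SimpleGraph (Fin n)) (k : ℤ) : List Bool :=
  List.replicate n true ++ [false] ++
    (List.ofFn fun i : Fin n => List.ofFn fun j : Fin n => decide (G.Adj i j)).flatten ++
    encodeInt k

/-- The problem "given `(G, k)`, is there a vertex set `X` of size at most `k` with property `P`?",
parameterized by modular-width. -/
def paramByModularWidth (P : ∀ {n : ℕ}, SimpleGraph (Fin n) → Set (Fin n) → Prop) :
    Set (List Bool × ℕ) :=
  {y | ∃ (n : ℕ) (G : SimpleGraph (Fin n)) (k : ℤ),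
    y = (encodeInstance G k, modularWidth G) ∧ ∃ X : Set (Fin n), P G X ∧ (X.ncard : ℤ) ≤ k}

/-- Vertex Cover parameterized by modular-width. -/
def VertexCoverMW : Set (List Bool × ℕ) := paramByModularWidth SimpleGraph.IsVertexCover

/-- Connected Vertex Cover parameterized by modular-width. -/
def ConnectedVertexCoverMW : Set (List Bool × ℕ) := paramByModularWidth IsConnectedVertexCover

/-- Feedback Vertex Set parameterized by modular-width. -/
def FeedbackVertexSetMW : Set (List Bool × ℕ) := paramByModularWidth IsFeedbackVertexSet

/-- Odd Cycle Transversal parameterized by modular-width. -/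
def OddCycleTransversalMW : Set (List Bool × ℕ) := paramByModularWidth IsOddCycleTransversal

/-! ## Running programs -/

section Runs

variable {L : Set (List Bool)} {p q : Prog} {s : MachineState} {T T' : ℕ}
  {Q Q' : MachineState → Prop}

/-! Both halves rest on one observation. Pass from a cover or transversal `X` to its complement `Y`,
and let `G` arise from a quotient graph `Q` by substituting blocks for its vertices. What matters
about the part of `Y` inside a block is only its type, one of five, such as "empty", "independent"
or "a forest". Whether `Y` is a solution depends on `Q` and on the types of the parts alone
(`oct_decomp`, `fvs_decomp`, `cvc_decomp`). Vertex covers share the types of odd cycle transversals.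

For part (b), let `M` be one block and every other vertex a block of its own. Replacing `M` by `H`
leaves the quotient unchanged, so the part of `Y` in `M` may be exchanged for any part of `H` that
has the same type and is not smaller (`IsSubstitution.exists_transfer`). The equalities between the
parameters of `G[M]` and `H` provide such a part for each type. As both graphs have the same number
of vertices, a larger complement means a smaller solution (`minSize_compl_le_iff`).

For part (a), modules are contracted from the bottom up. For each surviving vertex the algorithm
keeps, for each of the five types, one more than the maximum size of a partial solution in the class
contracted to it. A round takes a smallest module `M` spanned by two survivors. It contains no
smaller nontrivial module, so if it has at least three vertices it induces a prime graph. The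
modular-width is the largest size of a prime induced subgraph (`modularWidth_le_iff`), so `M` has at
most `max k 2` vertices when `k` is the modular-width. The value is computed on the way
(`primeWidthLE_contract`, `modularWidth_eq`), so that a wrong parameter is detected.

The new optima are determined by the small graph `G[M]` and five weights per vertex
(`TypeSystem.lt_best_iUnion_iff`); the oracle answers questions about such weighted graphs. The
weights are at most `n + 1` for a graph on `n` vertices. If `n < 2 ^ k`, they have few bits and the
whole question fits into `(k + 8) ^ 4` bits. Otherwise the number of type assignments is at most `25
* 5 ^ k ≤ 25 * (n + 1) ^ 3`, so all of them are tried, the oracle judging only whether an assignment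
is admissible (`newDataGT_iff`).

Running time is handled by a small calculus: functions computable from a context are closed under
arithmetic, bounded sums (`Comp.sum`), iteration of bounded tables (`Comp.letIter`) and short
queries (`Comp.ask`). The algorithm is written as an expression of this calculus. -/

@[simp] theorem MachineState.reg_setReg (s : MachineState) (d v r : ℕ) :
    (s.setReg d v).reg r = if r = d then v else s.reg r := by
  simp [MachineState.setReg, Function.update_apply]

@[simp] theorem MachineState.mem_setReg (s : MachineState) (d v : ℕ) :
    (s.setReg d v).mem = s.mem := rfl

@[simp] theorem MachineState.query_setReg (s : MachineState) (d v : ℕ) :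
    (s.setReg d v).query = s.query := rfl

@[simp] theorem MachineState.asked_setReg (s : MachineState) (d v : ℕ) :
    (s.setReg d v).asked = s.asked := rfl

/-- Store `v` at address `i`. -/
def MachineState.setMem (s : MachineState) (i v : ℕ) : MachineState :=
  { s with mem := Function.update s.mem i v }

@[simp] theorem MachineState.mem_setMem (s : MachineState) (i v r : ℕ) :
    (s.setMem i v).mem r = if r = i then v else s.mem r := by
  simp [MachineState.setMem, Function.update_apply]

@[simp] theorem MachineState.reg_setMem (s : MachineState) (d v : ℕ) :
    (s.setMem d v).reg = s.reg := rfl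

@[simp] theorem MachineState.query_setMem (s : MachineState) (d v : ℕ) :
    (s.setMem d v).query = s.query := rfl

@[simp] theorem MachineState.asked_setMem (s : MachineState) (d v : ℕ) :
    (s.setMem d v).asked = s.asked := rfl

/-- Started in `s`, the program `p` halts within `T` steps in a state that satisfies `Q`. -/
def Runs (L : Set (List Bool)) (p : Prog) (s : MachineState) (T : ℕ)
    (Q : MachineState → Prop) : Prop :=
  ∃ t s', Exec L p s t s' ∧ t ≤ T ∧ Q s'

theorem Runs.weaken (h : Runs L p s T Q) (hT : T ≤ T') (hQ : ∀ s', Q s' → Q' s') :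
    Runs L p s T' Q' := by
  obtain ⟨t, s', h1, h2, h3⟩ := h
  exact ⟨t, s', h1, h2.trans hT, hQ _ h3⟩

theorem Runs.seq (h : Runs L p s T (fun s' => Runs L q s' T' Q)) :
    Runs L (p.seq q) s (T + T') Q := by
  obtain ⟨t, s', h1, h2, t', s'', h4, h5, h6⟩ := h
  exact ⟨_, _, .seq h1 h4, by omega, h6⟩

theorem Runs.const {d c : ℕ} (h : Q (s.setReg d c)) : Runs L (.const d c) s 1 Q :=
  ⟨_, _, .const _ _ _, le_rfl, h⟩

theorem Runs.add {d a b : ℕ} (h : Q (s.setReg d (s.reg a + s.reg b))) :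
    Runs L (.add d a b) s 1 Q :=
  ⟨_, _, .add _ _ _ _, le_rfl, h⟩

theorem Runs.sub {d a b : ℕ} (h : Q (s.setReg d (s.reg a - s.reg b))) :
    Runs L (.sub d a b) s 1 Q :=
  ⟨_, _, .sub _ _ _ _, le_rfl, h⟩

theorem Runs.load {d a : ℕ} (h : Q (s.setReg d (s.mem (s.reg a)))) :
    Runs L (.load d a) s 1 Q :=
  ⟨_, _, .load _ _ _, le_rfl, h⟩

theorem Runs.store {a b : ℕ} (h : Q (s.setMem (s.reg a) (s.reg b))) :
    Runs L (.store a b) s 1 Q :=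
  ⟨_, _, .store _ _ _, le_rfl, h⟩

theorem Runs.emit {a : ℕ} (h : Q { s with query := s.query ++ [decide (s.reg a ≠ 0)] }) :
    Runs L (.emit a) s 1 Q :=
  ⟨_, _, .emit _ _, le_rfl, h⟩

theorem Runs.ask {d : ℕ} (h : Q (s.callOracle L d)) : Runs L (.ask d) s 1 Q :=
  ⟨_, _, .ask _ _, le_rfl, h⟩

theorem Runs.ite {c : ℕ} (h₁ : s.reg c ≠ 0 → Runs L p s T Q) (h₂ : s.reg c = 0 → Runs L q s T' Q) :
    Runs L (.ite c p q) s (T + T' + 1) Q := by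
  by_cases h : s.reg c = 0
  · obtain ⟨t, s', h3, h4, h5⟩ := h₂ h
    exact ⟨_, _, .ite_false h h3, by omega, h5⟩
  · obtain ⟨t, s', h3, h4, h5⟩ := h₁ h
    exact ⟨_, _, .ite_true h h3, by omega, h5⟩

/-- A counted loop: register `b` holds the number of rounds still to do, register `b + 1` the
number of rounds done, register `b + 2` is scratch. -/
def forProg (b : ℕ) (body : Prog) : Prog :=
  .loop b (.seq body (.seq (.const (b + 2) 1) (.seq (.sub b b (b + 2)) (.add (b + 1) (b + 1) (b + 2)))))

/-- Induction on the number of remaining rounds. `hI` says that the invariant ignores all registers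
from `b` on, so updating the counters cannot destroy it. A round costs `T` for the body, three
counter instructions and one test; the last test gives the final `1`. -/
theorem Runs.forProg {b n T : ℕ} {body : Prog} (I : ℕ → MachineState → Prop)
    (hI : ∀ j s s', I j s → (∀ r < b, s'.reg r = s.reg r) → s'.mem = s.mem →
      s'.query = s.query → s'.asked = s.asked → I j s')
    (hbody : ∀ j < n, ∀ s, I j s → s.reg (b + 1) = j →
      Runs L body s T (fun s' => I (j + 1) s' ∧ s'.reg b = s.reg b ∧ s'.reg (b + 1) = j))
    (s : MachineState) (h0 : I 0 s) (hc : s.reg b = n) (hj : s.reg (b + 1) = 0) :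
    Runs L (forProg b body) s (n * (T + 4) + 1) (I n) := by
  have key : ∀ m j s, j + m = n → I j s → s.reg b = m → s.reg (b + 1) = j →
      Runs L (_root_.forProg b body) s (m * (T + 4) + 1) (I n) := by
    intro m
    induction m with
    | zero =>
      intro j s hjm hIj hb _
      exact ⟨1, s, Exec.loop_stop hb, by omega, by simpa [← hjm] using hIj⟩
    | succ m ih =>
      intro j s hjm hIj hb hb1
      have h1 : Runs L (.seq body (.seq (.const (b + 2) 1)
          (.seq (.sub b b (b + 2)) (.add (b + 1) (b + 1) (b + 2))))) s (T + (1 + (1 + 1)))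
          (fun s' => I (j + 1) s' ∧ s'.reg b = m ∧ s'.reg (b + 1) = j + 1) := by
        refine Runs.seq ((hbody j (by omega) s hIj hb1).weaken le_rfl ?_)
        rintro s' ⟨h1, h2, h3⟩
        refine Runs.seq (Runs.const (Runs.seq (Runs.sub (Runs.add ⟨hI _ _ _ h1 ?_ rfl rfl rfl, ?_, ?_⟩))))
        · intro r hr
          have e1 : r ≠ b := by omega
          have e2 : r ≠ b + 1 := by omega
          have e3 : r ≠ b + 2 := by omega
          simp [e1, e2, e3]
        · simp [h2, hb]
        · simp [h3]
      obtain ⟨t, s', e1, e2, e3, e4, e5⟩ := h1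
      obtain ⟨t', s'', f1, f2, f3⟩ := ih (j + 1) s' (by omega) e3 e4 e5
      refine ⟨_, _, .loop_step (by omega) e1 f1, ?_, f3⟩
      have : (m + 1) * (T + 4) = m * (T + 4) + (T + 4) := by ring
      omega
  exact key n 0 s (by omega) h0 hc hj

/-- `s'` arises from `s` by a computation that respects the registers below `b` and the memory
below `top`, and whose queries have length at most `S`. -/
structure Frame (b top S : ℕ) (s s' : MachineState) : Prop where
  reg : ∀ r < b, s'.reg r = s.reg r
  mem : ∀ i < top, s'.mem i = s.mem i
  query : s'.query = []
  asked : ∃ qs, s'.asked = qs ++ s.asked ∧ ∀ q ∈ qs, q.length ≤ S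

theorem Frame.refl {b top S : ℕ} {s : MachineState} (h : s.query = []) : Frame b top S s s :=
  ⟨fun _ _ => rfl, fun _ _ => rfl, h, [], rfl, by simp⟩

theorem Frame.trans {b top S b' top' : ℕ} {s s' s'' : MachineState} (h : Frame b top S s s')
    (h' : Frame b' top' S s' s'') (hb : b ≤ b') (ht : top ≤ top') : Frame b top S s s'' := by
  obtain ⟨qs, h1, h2⟩ := h.asked
  obtain ⟨qs', h1', h2'⟩ := h'.asked
  refine ⟨fun r hr => (h'.reg r (by omega)).trans (h.reg r hr),
    fun r hr => (h'.mem r (by omega)).trans (h.mem r hr), h'.query, qs' ++ qs, ?_, ?_⟩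
  · rw [h1', h1, List.append_assoc]
  · intro q hq
    rcases List.mem_append.1 hq with hq | hq
    exacts [h2' q hq, h2 q hq]

theorem Frame.mono {b top S b' top' : ℕ} {s s' : MachineState} (h : Frame b' top' S s s')
    (hb : b ≤ b') (ht : top ≤ top') : Frame b top S s s' :=
  ⟨fun r hr => h.reg r (by omega), fun r hr => h.mem r (by omega), h.query, h.asked⟩

theorem Frame.setReg {b top S d v : ℕ} {s s' : MachineState} (h : Frame b top S s s')
    (hd : b ≤ d) : Frame b top S s (s'.setReg d v) := by
  refine ⟨fun r hr => ?_, h.mem, h.query, h.asked⟩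
  have : r ≠ d := by omega
  simp [this, h.reg r hr]

theorem Frame.setMem {b top S i v : ℕ} {s s' : MachineState} (h : Frame b top S s s')
    (hd : top ≤ i) : Frame b top S s (s'.setMem i v) := by
  refine ⟨h.reg, fun r hr => ?_, h.query, h.asked⟩
  have : r ≠ i := by omega
  simp [this, h.mem r hr]

theorem Frame.congr {b top S : ℕ} {s s' s'' : MachineState} (h : Frame b top S s s')
    (h1 : ∀ r < b, s''.reg r = s'.reg r) (h2 : s''.mem = s'.mem) (h3 : s''.query = s'.query)
    (h4 : s''.asked = s'.asked) : Frame b top S s s'' :=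
  ⟨fun r hr => (h1 r hr).trans (h.reg r hr), fun r hr => by rw [h2, h.mem r hr], h3.trans h.query,
    by rw [h4]; exact h.asked⟩

end Runs

/-! ## Polynomial-time computable functions of a context -/

/-- A context: data of type `α` that is present in the registers below `d` and in the memory
below `top`. -/
structure Ctx (α : Type*) where
  /-- the registers below `d` are in use -/
  d : ℕ
  /-- the size in terms of which polynomial bounds are measured -/
  sz : α → ℕ
  /-- the parameter that bounds the length of oracle queries -/
  par : α → ℕ
  /-- the data that may occur -/
  ok : α → Prop
  /-- the datum `a` is present in the state -/
  Holds : α → ℕ → MachineState → Prop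
  mono : ∀ a top top' s, Holds a top s → top ≤ top' → Holds a top' s
  local' : ∀ a top s s', Holds a top s → (∀ r < d, s'.reg r = s.reg r) →
    (∀ i < top, s'.mem i = s.mem i) → Holds a top s'

theorem Polynomial.eval_nat_mono (P : Polynomial ℕ) : Monotone (fun n => P.eval n) := by
  intro m n h
  simp only [Polynomial.eval_eq_sum, Polynomial.sum_def]
  gcongr

section Comp

variable {α : Type*} {L : Set (List Bool)} {Γ : Ctx α}

/-- `f` is polynomially bounded. -/
def PolyBdd (Γ : Ctx α) (f : α → ℕ) : Prop :=
  ∃ P : Polynomial ℕ, ∀ a, Γ.ok a → f a ≤ P.eval (Γ.sz a)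

theorem PolyBdd.of_le {f g : α → ℕ} (hg : PolyBdd Γ g) (h : ∀ a, Γ.ok a → f a ≤ g a) :
    PolyBdd Γ f :=
  hg.imp fun _ hP a ha => (h a ha).trans (hP a ha)

theorem PolyBdd.const (c : ℕ) : PolyBdd Γ fun _ => c := ⟨.C c, by simp⟩

theorem PolyBdd.sz : PolyBdd Γ Γ.sz := ⟨.X, by simp⟩

theorem PolyBdd.add {f g : α → ℕ} (hf : PolyBdd Γ f) (hg : PolyBdd Γ g) :
    PolyBdd Γ fun a => f a + g a := by
  obtain ⟨P, hP⟩ := hf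
  obtain ⟨R, hR⟩ := hg
  exact ⟨P + R, fun a ha => by rw [Polynomial.eval_add]; exact add_le_add (hP a ha) (hR a ha)⟩

theorem PolyBdd.mul {f g : α → ℕ} (hf : PolyBdd Γ f) (hg : PolyBdd Γ g) :
    PolyBdd Γ fun a => f a * g a := by
  obtain ⟨P, hP⟩ := hf
  obtain ⟨R, hR⟩ := hg
  exact ⟨P * R, fun a ha => by rw [Polynomial.eval_mul]; exact Nat.mul_le_mul (hP a ha) (hR a ha)⟩

/-- `f` can be computed in polynomial time by oracle programs from any state in which the context
is present. -/
def Comp (L : Set (List Bool)) (Γ : Ctx α) (f : α → ℕ) : Prop :=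
  PolyBdd Γ f ∧ ∀ b sp, Γ.d ≤ b → sp < b → ∃ (p : Prog) (T : α → ℕ), PolyBdd Γ T ∧
    ∀ a s, Γ.ok a → Γ.Holds a (s.reg sp) s → s.query = [] →
      Runs L p s (T a) (fun s' => Frame b (s.reg sp) ((Γ.par a + 8) ^ 4) s s' ∧ s'.reg b = f a)

theorem Comp.congr {f g : α → ℕ} (hf : Comp L Γ f) (h : ∀ a, g a = f a) : Comp L Γ g := by
  rwa [show g = f from funext h]

theorem Frame.holds {b S top top' : ℕ} {a : α} {s s' : MachineState} (h : Frame b top S s s')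
    (hΓ : Γ.Holds a top' s) (hb : Γ.d ≤ b) (ht : top' ≤ top) : Γ.Holds a top' s' :=
  Γ.local' _ _ _ _ hΓ (fun r hr => h.reg r (by omega)) (fun i hi => h.mem i (by omega))

theorem Comp.of_reg {f : α → ℕ} {r : ℕ} (hr : r < Γ.d) (hf : PolyBdd Γ f)
    (h : ∀ a top s, Γ.ok a → Γ.Holds a top s → s.reg r = f a) : Comp L Γ f := by
  refine ⟨hf, fun b sp hb hsp => ⟨.seq (.const b 0) (.add b r b), fun _ => 2, .const _,
    fun a s ha hs hq => ?_⟩⟩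
  refine Runs.seq (T := 1) (T' := 1) (Runs.const (Runs.add ⟨?_, ?_⟩))
  · exact ((Frame.refl hq).setReg le_rfl).setReg le_rfl
  · have : r ≠ b := by omega
    simp [this, h a _ s ha hs]

theorem Comp.const (c : ℕ) : Comp L Γ fun _ => c := by
  refine ⟨.const c, fun b sp hb hsp => ⟨.const b c, fun _ => 1, .const _,
    fun a s ha hs hq => Runs.const ⟨(Frame.refl hq).setReg le_rfl, by simp⟩⟩⟩

/-- The second operand is evaluated with target `b + 1`, so the first value, in register `b`,
belongs to the protected registers and survives. -/
theorem Comp.binop {f g : α → ℕ} {op : ℕ → ℕ → ℕ} {instr : ℕ → ℕ → ℕ → Prog}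
    (hop : ∀ x y, op x y ≤ x + y)
    (hinstr : ∀ (d a b : ℕ) (s : MachineState) (Q : MachineState → Prop),
      Q (s.setReg d (op (s.reg a) (s.reg b))) → Runs L (instr d a b) s 1 Q)
    (hf : Comp L Γ f) (hg : Comp L Γ g) : Comp L Γ fun a => op (f a) (g a) := by
  refine ⟨(hf.1.add hg.1).of_le fun a _ => hop _ _, fun b sp hb hsp => ?_⟩
  obtain ⟨p, T, hT, hp⟩ := hf.2 b sp hb hsp
  obtain ⟨q, T', hT', hq⟩ := hg.2 (b + 1) sp (by omega) (by omega)
  refine ⟨.seq p (.seq q (instr b b (b + 1))), _, hT.add (hT'.add (.const 1)),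
    fun a s ha hs hqs => Runs.seq ((hp a s ha hs hqs).weaken le_rfl ?_)⟩
  rintro s' ⟨h1, h2⟩
  have hsp' := h1.reg sp hsp
  refine Runs.seq ((hq a s' ha (by rw [hsp']; exact h1.holds hs hb le_rfl) h1.query).weaken le_rfl ?_)
  rintro s'' ⟨h3, h4⟩
  rw [hsp'] at h3
  refine hinstr _ _ _ _ _ ⟨(h1.trans h3 (by omega) le_rfl).setReg le_rfl, ?_⟩
  simp [h4, h3.reg b (by omega), h2]

theorem Comp.add {f g : α → ℕ} (hf : Comp L Γ f) (hg : Comp L Γ g) :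
    Comp L Γ fun a => f a + g a :=
  Comp.binop (op := (· + ·)) (fun _ _ => le_rfl) (fun _ _ _ _ _ h => Runs.add h) hf hg

theorem Comp.sub {f g : α → ℕ} (hf : Comp L Γ f) (hg : Comp L Γ g) :
    Comp L Γ fun a => f a - g a :=
  Comp.binop (op := (· - ·)) (fun _ _ => by omega) (fun _ _ _ _ _ h => Runs.sub h) hf hg

theorem Comp.ite_ne_zero {c f g : α → ℕ} (hc : Comp L Γ c) (hf : Comp L Γ f) (hg : Comp L Γ g) :
    Comp L Γ fun a => if c a ≠ 0 then f a else g a := by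
  refine ⟨(hf.1.add hg.1).of_le fun a _ => by split_ifs <;> omega, fun b sp hb hsp => ?_⟩
  obtain ⟨r, T, hT, hr⟩ := hc.2 b sp hb hsp
  obtain ⟨p, T₁, hT₁, hp⟩ := hf.2 b sp hb hsp
  obtain ⟨q, T₂, hT₂, hq⟩ := hg.2 b sp hb hsp
  refine ⟨.seq r (.ite b p q), _, hT.add ((hT₁.add hT₂).add (.const 1)),
    fun a s ha hs hqs => Runs.seq ((hr a s ha hs hqs).weaken le_rfl ?_)⟩
  rintro s' ⟨h1, h2⟩
  have hsp' := h1.reg sp hsp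
  have hs' : Γ.Holds a (s'.reg sp) s' := by rw [hsp']; exact h1.holds hs hb le_rfl
  refine Runs.ite (fun h => (hp a s' ha hs' h1.query).weaken le_rfl ?_)
    (fun h => (hq a s' ha hs' h1.query).weaken le_rfl ?_)
  all_goals
    rintro s'' ⟨h3, h4⟩
    rw [hsp'] at h3
    refine ⟨h1.trans h3 le_rfl le_rfl, ?_⟩
    rw [h2] at h
    simp [h, h4]

/-- Extend a context by a number. -/
def Ctx.ext (Γ : Ctx α) (o : ℕ) : Ctx (α × ℕ) where
  d := Γ.d + o + 1
  sz p := Γ.sz p.1 + p.2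
  par p := Γ.par p.1
  ok p := Γ.ok p.1
  Holds p top s := Γ.Holds p.1 top s ∧ s.reg (Γ.d + o) = p.2
  mono _ _ _ _ h ht := ⟨Γ.mono _ _ _ _ h.1 ht, h.2⟩
  local' _ _ _ _ h h1 h2 := ⟨Γ.local' _ _ _ _ h.1 (fun r hr => h1 r (by omega)) h2,
    (h1 _ (by omega)).trans h.2⟩

/-- Extend a context by a table, that is, a function that vanishes beyond `len` and has values at
most `cap`. -/
def Ctx.tab (Γ : Ctx α) (o : ℕ) (len cap : α → ℕ) : Ctx (α × (ℕ → ℕ)) where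
  d := Γ.d + o + 2
  sz p := Γ.sz p.1
  par p := Γ.par p.1
  ok p := Γ.ok p.1 ∧ (∀ j, p.2 j ≤ cap p.1) ∧ ∀ j, len p.1 ≤ j → p.2 j = 0
  Holds p top s := Γ.Holds p.1 top s ∧ s.reg (Γ.d + o + 1) = len p.1 ∧
    s.reg (Γ.d + o) + len p.1 ≤ top ∧ ∀ j < len p.1, s.mem (s.reg (Γ.d + o) + j) = p.2 j
  mono _ _ _ _ h ht := ⟨Γ.mono _ _ _ _ h.1 ht, h.2.1, h.2.2.1.trans ht, h.2.2.2⟩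
  local' _ _ _ _ h h1 h2 := by
    refine ⟨Γ.local' _ _ _ _ h.1 (fun r hr => h1 r (by omega)) h2,
      (h1 _ (by omega)).trans h.2.1, ?_, fun j hj => ?_⟩ <;> rw [h1 _ (by omega)]
    · exact h.2.2.1
    · rw [h2 _ (by have := h.2.2.1; omega)]
      exact h.2.2.2 j hj

/-- Polynomials compose, so a bound in terms of context and index becomes a bound in terms of the
context alone, uniform over all indices up to `f a`. This bounds the cost of a loop body. -/
theorem PolyBdd.bind {o : ℕ} {g : α × ℕ → ℕ} {f : α → ℕ} (hg : PolyBdd (Γ.ext o) g)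
    (hf : PolyBdd Γ f) :
    ∃ G, PolyBdd Γ G ∧ ∀ a j, Γ.ok a → j ≤ f a → g (a, j) ≤ G a := by
  obtain ⟨P, hP⟩ := hg
  obtain ⟨R, hR⟩ := hf
  refine ⟨fun a => P.eval (Γ.sz a + f a), ⟨P.comp (.X + R), fun a ha => ?_⟩, fun a j ha hj => ?_⟩
  · simp only [Polynomial.eval_comp, Polynomial.eval_add, Polynomial.eval_X]
    exact P.eval_nat_mono (by have := hR a ha; omega)
  · exact (hP (a, j) ha).trans (P.eval_nat_mono (by simp only [Ctx.ext]; omega))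

theorem PolyBdd.fst_ext {o : ℕ} {f : α → ℕ} (hf : PolyBdd Γ f) :
    PolyBdd (Γ.ext o) fun p => f p.1 := by
  obtain ⟨P, hP⟩ := hf
  exact ⟨P, fun a ha => (hP _ ha).trans (P.eval_nat_mono (by simp [Ctx.ext]))⟩

theorem PolyBdd.fst_tab {o : ℕ} {len cap f : α → ℕ} (hf : PolyBdd Γ f) :
    PolyBdd (Γ.tab o len cap) fun p => f p.1 := by
  obtain ⟨P, hP⟩ := hf
  exact ⟨P, fun a ha => hP _ ha.1⟩

theorem Comp.fst_ext {o : ℕ} {f : α → ℕ} (hf : Comp L Γ f) :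
    Comp L (Γ.ext o) fun p => f p.1 := by
  refine ⟨hf.1.fst_ext, fun b sp hb hsp => ?_⟩
  obtain ⟨p, T, hT, hp⟩ := hf.2 b sp (by simp only [Ctx.ext] at hb; omega) hsp
  exact ⟨p, _, hT.fst_ext, fun a s ha hs hq => hp a.1 s ha hs.1 hq⟩

theorem Comp.fst_tab {o : ℕ} {len cap f : α → ℕ} (hf : Comp L Γ f) :
    Comp L (Γ.tab o len cap) fun p => f p.1 := by
  refine ⟨hf.1.fst_tab, fun b sp hb hsp => ?_⟩
  obtain ⟨p, T, hT, hp⟩ := hf.2 b sp (by simp only [Ctx.tab] at hb; omega) hsp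
  exact ⟨p, _, hT.fst_tab, fun a s ha hs hq => hp a.1 s ha.1 hs.1 hq⟩

theorem Comp.var {o : ℕ} : Comp L (Γ.ext o) fun p => p.2 :=
  Comp.of_reg (r := Γ.d + o) (by simp [Ctx.ext]) (PolyBdd.sz.of_le fun a _ => by simp [Ctx.ext])
    fun _ _ _ _ h => h.2

/-- The basic loop of the calculus; bounded quantifiers, products, quotients, search and
substitution are all reduced to it. The offset `o` is arbitrary because the register that holds the
summation index depends on where the loop is placed. -/
theorem Comp.sum {f : α → ℕ} {g : α × ℕ → ℕ} (hf : Comp L Γ f)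
    (hg : ∀ o, Comp L (Γ.ext o) g) : Comp L Γ fun a => ∑ j ∈ Finset.range (f a), g (a, j) := by
  constructor
  · obtain ⟨G, hG, h⟩ := (hg 0).1.bind hf.1
    refine (hf.1.mul hG).of_le fun a ha => ?_
    refine (Finset.sum_le_card_nsmul _ _ (G a) fun j hj => ?_).trans (by simp)
    exact h a j ha (Finset.mem_range.1 hj).le
  intro b sp hb hsp
  obtain ⟨p, T, hT, hp⟩ := hf.2 (b + 1) sp (by omega) (by omega)
  -- The offset puts the index variable into register `b + 2`, where the loop with counter `b + 1`
  -- counts its finished rounds; `b` accumulates the sum and `b + 3` receives the summand.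
  have hd : Γ.d + (b + 2 - Γ.d) = b + 2 := by omega
  obtain ⟨q, T', hT', hq⟩ := (hg (b + 2 - Γ.d)).2 (b + 3) sp (by simp only [Ctx.ext]; omega) (by omega)
  obtain ⟨G, hG, hT'G⟩ := hT'.bind hf.1
  refine ⟨.seq p (.seq (.const b 0) (.seq (.const (b + 2) 0)
    (forProg (b + 1) (.seq q (.add b b (b + 3)))))), _,
    hT.add ((PolyBdd.const 1).add ((PolyBdd.const 1).add
      ((hf.1.mul ((hG.add (.const 1)).add (.const 4))).add (.const 1)))),
    fun a s ha hs hqs => Runs.seq ((hp a s ha hs hqs).weaken le_rfl ?_)⟩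
  rintro s' ⟨h1, h2⟩
  refine Runs.seq (Runs.const (Runs.seq (Runs.const ?_)))
  refine (Runs.forProg (n := f a) (fun j s'' => Frame b (s.reg sp) ((Γ.par a + 8) ^ 4) s s'' ∧
    s''.reg b = ∑ i ∈ Finset.range j, g (a, i)) ?_ ?_ _ ⟨?_, ?_⟩ ?_ ?_)
  · rintro j t t' ⟨h3, h4⟩ h5 h6 h7 h8
    exact ⟨h3.congr (fun r hr => h5 r (by omega)) h6 h7 h8, by rw [h5 b (by omega), h4]⟩
  · rintro j hj t ⟨h3, h4⟩ h5
    have hsp' := h3.reg sp hsp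
    refine Runs.seq ((hq (a, j) t ha ⟨?_, ?_⟩ h3.query).weaken (hT'G a j ha hj.le) ?_)
    · rw [hsp']; exact h3.holds hs hb le_rfl
    · rw [hd]; exact h5
    rintro t' ⟨h6, h7⟩
    rw [hsp'] at h6
    refine Runs.add ⟨⟨(h3.trans h6 (by omega) le_rfl).setReg le_rfl, ?_⟩, ?_, ?_⟩
    · rw [Finset.sum_range_succ]
      simp [h6.reg b (by omega), h4, h7]
    · simp [h6.reg (b + 1) (by omega)]
    · simp [h6.reg (b + 2) (by omega), h5, show b + 1 + 1 ≠ b by omega]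
  · exact ((h1.mono (by omega) le_rfl).setReg le_rfl).setReg (by omega)
  · simp
  · simp [h2]
  · simp

/-- The table `t` of length `len` is present in the context. -/
def HasTab (Γ : Ctx α) (len : α → ℕ) (t : α → ℕ → ℕ) : Prop :=
  ∃ rb rl, rb < Γ.d ∧ rl < Γ.d ∧ ∃ C, PolyBdd Γ C ∧ PolyBdd Γ len ∧
    ∀ a, Γ.ok a → (∀ j, t a j ≤ C a) ∧ (∀ j, len a ≤ j → t a j = 0) ∧
      ∀ top s, Γ.Holds a top s → s.reg rl = len a ∧ s.reg rb + len a ≤ top ∧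
        ∀ j < len a, s.mem (s.reg rb + j) = t a j

theorem HasTab.fst_ext {len : α → ℕ} {t : α → ℕ → ℕ} (h : HasTab Γ len t) (o : ℕ) :
    HasTab (Γ.ext o) (fun p => len p.1) fun p => t p.1 := by
  obtain ⟨rb, rl, h1, h2, C, h3, h4, h5⟩ := h
  exact ⟨rb, rl, by simp only [Ctx.ext]; omega, by simp only [Ctx.ext]; omega, _, h3.fst_ext,
    h4.fst_ext, fun a ha => ⟨(h5 a.1 ha).1, (h5 a.1 ha).2.1, fun top s hs =>
      (h5 a.1 ha).2.2 top s hs.1⟩⟩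

theorem HasTab.fst_tab {len len' cap' : α → ℕ} {t : α → ℕ → ℕ} (h : HasTab Γ len t) (o : ℕ) :
    HasTab (Γ.tab o len' cap') (fun p => len p.1) fun p => t p.1 := by
  obtain ⟨rb, rl, h1, h2, C, h3, h4, h5⟩ := h
  exact ⟨rb, rl, by simp only [Ctx.tab]; omega, by simp only [Ctx.tab]; omega, _, h3.fst_tab,
    h4.fst_tab, fun a ha => ⟨(h5 a.1 ha.1).1, (h5 a.1 ha.1).2.1, fun top s hs =>
      (h5 a.1 ha.1).2.2 top s hs.1⟩⟩

theorem HasTab.snd {len cap : α → ℕ} (hlen : PolyBdd Γ len) (hcap : PolyBdd Γ cap) (o : ℕ) :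
    HasTab (Γ.tab o len cap) (fun p => len p.1) fun p => p.2 :=
  ⟨Γ.d + o, Γ.d + o + 1, by simp [Ctx.tab], by simp [Ctx.tab], _, hcap.fst_tab, hlen.fst_tab,
    fun _ ha => ⟨ha.2.1, ha.2.2, fun _ _ hs => hs.2⟩⟩

/-- Outside its length a table is zero by convention, but the memory there may hold anything. The
truncated difference of length and index decides between reading and returning `0`. -/
theorem Comp.lookup {len f : α → ℕ} {t : α → ℕ → ℕ} (ht : HasTab Γ len t) (hf : Comp L Γ f) :
    Comp L Γ fun a => t a (f a) := by
  obtain ⟨rb, rl, hrb, hrl, C, hC, hlen, h⟩ := ht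
  refine ⟨hC.of_le fun a ha => (h a ha).1 _, fun b sp hb hsp => ?_⟩
  obtain ⟨p, T, hT, hp⟩ := hf.2 b sp hb hsp
  refine ⟨.seq p (.seq (.sub (b + 1) rl b) (.ite (b + 1) (.seq (.add (b + 1) rb b)
    (.load b (b + 1))) (.const b 0))), _, hT.add ((PolyBdd.const 1).add
      ((((PolyBdd.const 1).add (.const 1)).add (.const 1)).add (.const 1))),
    fun a s ha hs hqs => Runs.seq ((hp a s ha hs hqs).weaken le_rfl ?_)⟩
  rintro s' ⟨h1, h2⟩
  obtain ⟨-, h0, ht⟩ := h a ha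
  obtain ⟨hl, hle, hmem⟩ := ht _ _ hs
  have e1 : rb ≠ b + 1 := by omega
  have e2 : b ≠ b + 1 := by omega
  have hl' := h1.reg rl (by omega)
  have hb' := h1.reg rb (by omega)
  refine Runs.seq (T := 1) (T' := 1 + 1 + 1 + 1) (Runs.sub (Runs.ite (T := 1 + 1) (T' := 1) ?_ ?_))
  · intro hc
    simp only [MachineState.reg_setReg, if_pos, h2, hl', hl] at hc
    have hlt : f a < len a := by omega
    refine Runs.seq (Runs.add (Runs.load ⟨?_, ?_⟩))
    · exact ((h1.setReg (by omega)).setReg (by omega)).setReg le_rfl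
    · simp [h2, e1, hb', ← hmem _ hlt, h1.mem (s.reg rb + f a) (by omega)]
  · intro hc
    simp only [MachineState.reg_setReg, if_pos, h2, hl', hl] at hc
    refine Runs.const ⟨(h1.setReg (by omega)).setReg le_rfl, ?_⟩
    simp [h0 (f a) (by omega)]

open Classical in
/-- A query whose bits are given by a table. -/
theorem Comp.ask {len : α → ℕ} {t : α → ℕ → ℕ} (ht : HasTab Γ len t)
    (hlen : ∀ a, len a ≤ (Γ.par a + 8) ^ 4) :
    Comp L Γ fun a =>
      if (List.range (len a)).map (fun i => decide (t a i ≠ 0)) ∈ L then 1 else 0 := by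
  obtain ⟨rb, rl, hrb, hrl, C, hC, hlenb, h⟩ := ht
  refine ⟨(PolyBdd.const 1).of_le fun a ha => by split_ifs <;> simp, fun b sp hb hsp => ?_⟩
  refine ⟨.seq (.const b 0) (.seq (.add b rl b) (.seq (.const (b + 1) 0) (.seq (forProg b
    (.seq (.add (b + 2) rb (b + 1)) (.seq (.load (b + 2) (b + 2)) (.emit (b + 2))))) (.ask b)))), _,
    (PolyBdd.const 1).add ((PolyBdd.const 1).add ((PolyBdd.const 1).add
      (((hlenb.mul ((PolyBdd.const 3).add (.const 4))).add (.const 1)).add (.const 1)))),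
    fun a s ha hs hqs => ?_⟩
  obtain ⟨-, h0, ht⟩ := h a ha
  obtain ⟨hl, hle, hmem⟩ := ht _ _ hs
  have e1 : rl ≠ b := by omega
  refine Runs.seq (Runs.const (Runs.seq (Runs.add (Runs.seq (Runs.const (Runs.seq ?_))))))
  refine (Runs.forProg (n := len a) (fun j s' => (∀ r < b, s'.reg r = s.reg r) ∧ s'.mem = s.mem ∧
    s'.asked = s.asked ∧ s'.query = (List.range j).map (fun i => decide (t a i ≠ 0)))
    ?_ ?_ _ ?_ ?_ ?_).weaken le_rfl ?_
  · rintro j u u' ⟨h1, h2, h3, h4⟩ h5 h6 h7 h8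
    exact ⟨fun r hr => (h5 r hr).trans (h1 r hr), h6.trans h2, h8.trans h3, h7.trans h4⟩
  · rintro j hj u ⟨h1, h2, h3, h4⟩ h5
    refine Runs.seq (T := 1) (T' := 2) (Runs.add (Runs.seq (T := 1) (T' := 1)
      (Runs.load (Runs.emit ⟨⟨?_, h2, h3, ?_⟩, ?_, ?_⟩))))
    · intro r hr
      have : r ≠ b + 2 := by omega
      simp [this, h1 r hr]
    · rw [List.range_succ, List.map_append, ← h4]
      simp [h5, h1 rb (by omega), h2, hmem j hj]
    · simp
    · simp [h5]
  · refine ⟨fun r hr => ?_, rfl, rfl, by simpa using hqs⟩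
    have e3 : r ≠ b := by omega
    have e4 : r ≠ b + 1 := by omega
    simp [e3, e4]
  · simp [e1, hl]
  · simp
  · rintro s' ⟨h1, h2, h3, h4⟩
    refine Runs.ask ⟨⟨?_, ?_, rfl, [s'.query], ?_, ?_⟩, ?_⟩
    · intro r hr
      simp [MachineState.callOracle, hr.ne, h1 r hr]
    · intro i _
      simp [MachineState.callOracle, h2]
    · simp [MachineState.callOracle, h3]
    · simp [h4, hlen a]
    · simp only [MachineState.callOracle, Function.update_self, h4]

end Comp


/-! ### Iterating transformations of tables in memory -/

section LetIter

variable {α : Type*} {L : Set (List Bool)} {Γ : Ctx α}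

/-- Fill the block at `base₂` (register `b + 4`) of length `len` (register `b + 1`) with the values
computed by `pe`, cut off at register `b + 2`, then copy it to the block at register `b`. -/
def fillCopy (b : ℕ) (pe : Prog) : Prog :=
  .seq (.const (b + 8) 0) (.seq (.add (b + 8) (b + 1) (b + 8)) (.seq (.const (b + 9) 0) (.seq
    (forProg (b + 8) (.seq pe (.seq (.sub (b + 11) (b + 10) (b + 2))
      (.seq (.sub (b + 10) (b + 10) (b + 11)) (.seq (.add (b + 11) (b + 4) (b + 9))
        (.store (b + 11) (b + 10)))))))
    (.seq (.const (b + 8) 0) (.seq (.add (b + 8) (b + 1) (b + 8)) (.seq (.const (b + 9) 0)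
      (forProg (b + 8) (.seq (.add (b + 10) (b + 4) (b + 9)) (.seq (.load (b + 11) (b + 10))
        (.seq (.add (b + 10) b (b + 9)) (.store (b + 10) (b + 11))))))))))))

/-- The entries of the new table may depend on all entries of the old one. Hence they go to a second
block first and are copied only when all are known; the computation of an entry may use memory from
`base + len + len` on. -/
theorem runs_fillCopy {b base len cap S T : ℕ} {pe : Prog} {v : ℕ → ℕ} {s : MachineState}
    (hq : s.query = []) (h0 : s.reg b = base) (h1 : s.reg (b + 1) = len)
    (h2 : s.reg (b + 2) = cap) (h4 : s.reg (b + 4) = base + len)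
    (hpe : ∀ j < len, ∀ s', Frame (b + 8) (base + len) S s s' → s'.reg (b + 9) = j →
      Runs L pe s' T (fun s'' => Frame (b + 10) (base + len + len) S s' s'' ∧
        s''.reg (b + 10) = v j)) :
    Runs L (fillCopy b pe) s
      (1 + (1 + (1 + ((len * (T + 4 + 4) + 1) + (1 + (1 + (1 + (len * (4 + 4) + 1))))))))
      (fun s' => Frame (b + 8) base S s s' ∧ ∀ i < len, s'.mem (base + i) = min (v i) cap) := by
  refine Runs.seq (Runs.const (Runs.seq (Runs.add (Runs.seq (Runs.const (Runs.seq ?_))))))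
  refine Runs.weaken (Runs.forProg (n := len) (T := T + 4)
    (fun j s' => Frame (b + 8) (base + len) S s s' ∧
      ∀ i < j, s'.mem (base + len + i) = min (v i) cap) ?_ ?_ _ ?_ ?_ ?_) le_rfl ?_
  · rintro j t t' ⟨h5, h6⟩ h7 h8 h9 h10
    exact ⟨h5.congr h7 h8 h9 h10, by rwa [h8]⟩
  · rintro j hj t ⟨h5, h6⟩ h7
    have h7 : t.reg (b + 9) = j := h7
    refine Runs.seq ((hpe j hj t h5 h7).weaken le_rfl ?_)
    rintro t' ⟨h8, h9⟩
    have e1 : t'.reg (b + 4) = base + len := by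
      rw [h8.reg _ (by omega), h5.reg _ (by omega), h4]
    have e2 : t'.reg (b + 9) = j := by rw [h8.reg _ (by omega), h7]
    have e3 : t'.reg (b + 2) = cap := by rw [h8.reg _ (by omega), h5.reg _ (by omega), h2]
    refine Runs.seq (T := 1) (T' := 3) (Runs.sub (Runs.seq (T := 1) (T' := 2) (Runs.sub
      (Runs.seq (T := 1) (T' := 1) (Runs.add (Runs.store ⟨⟨?_, ?_⟩, ?_, ?_⟩))))))
    · refine ((((h5.trans h8 (by omega) (by omega)).setReg (by omega)).setReg (by omega)).setReg
        (by omega)).setMem ?_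
      simp [e1, e2]
    · intro i hi
      rcases Nat.lt_succ_iff_lt_or_eq.1 hi with hi | rfl
      · have : i ≠ j := by omega
        simp [e1, e2, this, h8.mem (base + len + i) (by omega), h6 i hi]
      · simp [e1, e2, e3, h9]
        omega
    · simp [h8.reg (b + 8) (by omega)]
    · simp [e2]
  · refine ⟨(((Frame.refl hq).setReg (by omega)).setReg (by omega)).setReg (by omega), by simp⟩
  · simp [h1]
  · simp
  rintro s1 ⟨h5, h6⟩
  refine Runs.seq (Runs.const (Runs.seq (Runs.add (Runs.seq (Runs.const ?_)))))
  refine Runs.weaken (Runs.forProg (n := len) (T := 4)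
    (fun j s' => Frame (b + 8) base S s s' ∧ (∀ i < len, s'.mem (base + len + i) = min (v i) cap) ∧
      ∀ i < j, s'.mem (base + i) = min (v i) cap) ?_ ?_ _ ?_ ?_ ?_) le_rfl ?_
  · rintro j t t' ⟨h5, h6, h6'⟩ h7 h8 h9 h10
    exact ⟨h5.congr h7 h8 h9 h10, by rwa [h8], by rwa [h8]⟩
  · rintro j hj t ⟨h5, h6, h6'⟩ h7
    have h7 : t.reg (b + 9) = j := h7
    have e1 : t.reg (b + 4) = base + len := by
      rw [h5.reg _ (by omega), h4]
    have e0 : t.reg b = base := by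
      rw [h5.reg _ (by omega), h0]
    refine Runs.seq (T := 1) (T' := 3) (Runs.add (Runs.seq (T := 1) (T' := 2) (Runs.load
      (Runs.seq (T := 1) (T' := 1) (Runs.add (Runs.store ⟨⟨?_, ?_, ?_⟩, ?_, ?_⟩))))))
    · refine (((h5.setReg (by omega)).setReg (by omega)).setReg (by omega)).setMem ?_
      simp [e0]
    · intro i hi
      have : base + len + i ≠ base + j := by omega
      simp [e0, h7, this, h6 i hi]
    · intro i hi
      rcases Nat.lt_succ_iff_lt_or_eq.1 hi with hi | rfl
      · have : i ≠ j := by omega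
        simp [e0, h7, this, h6' i hi]
      · simp [e0, e1, h7, h6 i hj]
    · simp
    · simp [h7]
  · refine ⟨(((h5.mono (by omega) (by omega)).setReg (by omega)).setReg (by omega)).setReg
      (by omega), by simpa using h6, by simp⟩
  · simp [h5.reg (b + 1) (by omega), h1]
  · simp
  · rintro s' ⟨h7, -, h8⟩
    exact ⟨h7, h8⟩

/-- Cut off a table at length `len` and height `cap`. -/
def clipTab (len cap : ℕ) (g : ℕ → ℕ) (j : ℕ) : ℕ := if j < len then min (g j) cap else 0

/-- Iterate a transformation of tables that have length `len` and values at most `cap`. -/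
def iterTab (len cap : ℕ) (init : ℕ → ℕ) (φ : (ℕ → ℕ) → ℕ → ℕ) : ℕ → ℕ → ℕ
  | 0 => clipTab len cap init
  | t + 1 => clipTab len cap (φ (iterTab len cap init φ t))

theorem iterTab_le (len cap : ℕ) (init : ℕ → ℕ) (φ : (ℕ → ℕ) → ℕ → ℕ) (t j : ℕ) :
    iterTab len cap init φ t j ≤ cap := by
  cases t <;> simp only [iterTab, clipTab] <;> split_ifs <;> simp

theorem iterTab_eq_zero (len cap : ℕ) (init : ℕ → ℕ) (φ : (ℕ → ℕ) → ℕ → ℕ) (t j : ℕ)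
    (h : len ≤ j) : iterTab len cap init φ t j = 0 := by
  cases t <;> simp [iterTab, clipTab, h.not_gt]

theorem PolyBdd.of_tab_ext {o o' : ℕ} {len cap f : α → ℕ} {g : (α × (ℕ → ℕ)) × ℕ → ℕ}
    (hg : PolyBdd ((Γ.tab o len cap).ext o') g) (hf : PolyBdd Γ f) :
    ∃ G, PolyBdd Γ G ∧ ∀ a t j, (Γ.tab o len cap).ok (a, t) → j ≤ f a → g ((a, t), j) ≤ G a := by
  obtain ⟨P, hP⟩ := hg
  obtain ⟨R, hR⟩ := hf
  refine ⟨fun a => P.eval (Γ.sz a + f a), ⟨P.comp (.X + R), fun a ha => ?_⟩, fun a t j ha hj => ?_⟩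
  · simp only [Polynomial.eval_comp, Polynomial.eval_add, Polynomial.eval_X]
    exact P.eval_nat_mono (by have := hR a ha; omega)
  · exact (hP ((a, t), j) ha).trans (P.eval_nat_mono (by simp only [Ctx.ext, Ctx.tab]; omega))

theorem PolyBdd.of_tab {o : ℕ} {len cap : α → ℕ} {g : α × (ℕ → ℕ) → ℕ}
    (hg : PolyBdd (Γ.tab o len cap) g) :
    ∃ G, PolyBdd Γ G ∧ ∀ a t, (Γ.tab o len cap).ok (a, t) → g (a, t) ≤ G a := by
  obtain ⟨P, hP⟩ := hg
  exact ⟨fun a => P.eval (Γ.sz a), ⟨P, fun a ha => le_rfl⟩, fun a t ha => hP (a, t) ha⟩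

/-- This is where the calculus allocates memory: the table is placed at the first free address and
the stack pointer is moved beyond it. Clipping at `len` and `cap` after each step makes the table
admissible for the extended context in every round, so a single polynomial bounds the cost of all
rounds. -/
theorem Comp.letIter {m len cap : α → ℕ} {init : α × ℕ → ℕ} {φ : (α × (ℕ → ℕ)) × ℕ → ℕ}
    {h : α × (ℕ → ℕ) → ℕ} (hm : Comp L Γ m) (hlen : Comp L Γ len) (hcap : Comp L Γ cap)
    (hinit : ∀ o, Comp L (Γ.ext o) init) (hφ : ∀ o o', Comp L ((Γ.tab o len cap).ext o') φ)
    (hh : ∀ o, Comp L (Γ.tab o len cap) h) :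
    Comp L Γ fun a => h (a, iterTab (len a) (cap a) (fun j => init (a, j))
      (fun t j => φ ((a, t), j)) (m a)) := by
  have hok : ∀ o a i, Γ.ok a → (Γ.tab o len cap).ok (a, iterTab (len a) (cap a)
      (fun j => init (a, j)) (fun t j => φ ((a, t), j)) i) := fun o a i ha =>
    ⟨ha, iterTab_le _ _ _ _ _, iterTab_eq_zero _ _ _ _ _⟩
  constructor
  · obtain ⟨G, hG, hG'⟩ := (hh 0).1.of_tab
    exact hG.of_le fun a ha => hG' _ _ (hok _ _ _ ha)
  intro b sp hb hsp
  obtain ⟨pl, Tl, hTl, hpl⟩ := hlen.2 (b + 1) sp (by omega) (by omega)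
  obtain ⟨pc, Tc, hTc, hpc⟩ := hcap.2 (b + 2) sp (by omega) (by omega)
  obtain ⟨pm, Tm, hTm, hpm⟩ := hm.2 (b + 3) sp (by omega) (by omega)
  have hd1 : Γ.d + (b + 9 - Γ.d) = b + 9 := by omega
  have hd2 : Γ.d + (b - Γ.d) = b := by omega
  obtain ⟨pi, Ti, hTi, hpi⟩ := (hinit (b + 9 - Γ.d)).2 (b + 10) (b + 5)
    (by simp only [Ctx.ext]; omega) (by omega)
  have hd3 : (Γ.tab (b - Γ.d) len cap).d = b + 2 := by simp [Ctx.tab, hd2]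
  obtain ⟨pp, Tp, hTp, hpp⟩ := (hφ (b - Γ.d) 7).2 (b + 10) (b + 5)
    (by simp only [Ctx.ext, hd3]; omega) (by omega)
  obtain ⟨ph, Th, hTh, hph⟩ := (hh (b - Γ.d)).2 (b + 10) (b + 5) (by omega) (by omega)
  obtain ⟨Gi, hGi, hGi'⟩ := hTi.bind hlen.1
  obtain ⟨Gp, hGp, hGp'⟩ := hTp.of_tab_ext hlen.1
  obtain ⟨Gh, hGh, hGh'⟩ := hTh.of_tab
  have hbound : ∀ {G : α → ℕ}, PolyBdd Γ G → PolyBdd Γ fun a =>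
      (1 + (1 + (1 + ((len a * (G a + 4 + 4) + 1) + (1 + (1 + (1 + (len a * (4 + 4) + 1)))))))) :=
    fun hG => .add (.const 1) (.add (.const 1) (.add (.const 1) (.add (.add (.mul hlen.1 (.add
      (.add hG (.const 4)) (.const 4))) (.const 1)) (.add (.const 1) (.add (.const 1) (.add
      (.const 1) (.add (.mul hlen.1 (.const (4 + 4))) (.const 1))))))))
  -- Register layout: `b` table address, `b + 1` length, `b + 2` cap, `b + 3` number of rounds, `b +
  -- 4` auxiliary block, `b + 5` new stack pointer, `b + 6` and `b + 7` outer counters, `b + 8` and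
  -- `b + 9` inner counters, `b + 10` the computed value.
  refine ⟨.seq pl (.seq pc (.seq pm (.seq (.const (b + 4) 0) (.seq (.add b sp (b + 4))
    (.seq (.add (b + 4) b (b + 1)) (.seq (.add (b + 5) (b + 4) (b + 1))
    (.seq (fillCopy b pi) (.seq (.const (b + 6) 0) (.seq (.add (b + 6) (b + 3) (b + 6))
    (.seq (.const (b + 7) 0) (.seq (forProg (b + 6) (fillCopy b pp)) (.seq ph
    (.seq (.const (b + 11) 0) (.add b (b + 10) (b + 11))))))))))))))), _,
    hTl.add (hTc.add (hTm.add ((PolyBdd.const 1).add ((PolyBdd.const 1).add ((PolyBdd.const 1).add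
    ((PolyBdd.const 1).add ((hbound hGi).add ((PolyBdd.const 1).add ((PolyBdd.const 1).add
    ((PolyBdd.const 1).add (((hm.1.mul ((hbound hGp).add (.const 4))).add (.const 1)).add
    (hGh.add ((PolyBdd.const 1).add (.const 1)))))))))))))),
    fun a s ha hs hqs => Runs.seq ((hpl a s ha hs hqs).weaken le_rfl ?_)⟩
  rintro s1 ⟨f1, v1⟩
  have r1 := f1.reg sp (by omega)
  refine Runs.seq ((hpc a s1 ha (by rw [r1]; exact f1.holds hs (by omega) le_rfl) f1.query).weaken
    le_rfl ?_)
  rintro s2 ⟨f2, v2⟩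
  rw [r1] at f2
  have f2' := f1.trans f2 (by omega) le_rfl
  have r2 := f2'.reg sp (by omega)
  refine Runs.seq ((hpm a s2 ha (by rw [r2]; exact f2'.holds hs (by omega) le_rfl)
    f2.query).weaken le_rfl ?_)
  rintro s3 ⟨f3, v3⟩
  rw [r2] at f3
  have f3' := f2'.trans f3 (by omega) le_rfl
  have r3 := f3'.reg sp (by omega)
  have w1 : s3.reg (b + 1) = len a := by rw [f3.reg _ (by omega), f2.reg _ (by omega), v1]
  have w2 : s3.reg (b + 2) = cap a := by rw [f3.reg _ (by omega), v2]
  refine Runs.seq (Runs.const (Runs.seq (Runs.add (Runs.seq (Runs.add (Runs.seq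
    (Runs.add (Runs.seq ?_))))))))
  set top := s.reg sp with htop
  set S := (Γ.par a + 8) ^ 4 with hS
  generalize hs4 : MachineState.setReg _ (b + 5) _ = s4
  have e1 : sp ≠ b + 4 := by omega
  have e2 : b ≠ b + 4 := by omega
  have g4 : Frame b top S s s4 := by
    rw [← hs4]
    exact ((((f3'.mono (by omega) le_rfl).setReg (by omega)).setReg (by omega)).setReg
      (by omega)).setReg (by omega)
  have x0 : s4.reg b = top := by rw [← hs4]; simp [e1, r3]
  have x1 : s4.reg (b + 1) = len a := by rw [← hs4]; simp [w1]
  have x2 : s4.reg (b + 2) = cap a := by rw [← hs4]; simp [w2]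
  have x3 : s4.reg (b + 3) = m a := by rw [← hs4]; simp [v3]
  have x4 : s4.reg (b + 4) = top + len a := by rw [← hs4]; simp [e1, r3, w1]
  have x5 : s4.reg (b + 5) = top + len a + len a := by rw [← hs4]; simp [e1, r3, w1]
  have hs4' : Γ.Holds a top s4 := g4.holds hs hb le_rfl
  refine (runs_fillCopy (S := S) (T := Gi a) (v := fun j => init (a, j)) g4.query x0 x1 x2 x4
    ?_).weaken le_rfl ?_
  · intro j hj s' hf hj'
    have hr5 : s'.reg (b + 5) = top + len a + len a := by rw [hf.reg _ (by omega), x5]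
    refine (hpi (a, j) s' ha ⟨?_, by rw [hd1, hj']⟩ hf.query).weaken (hGi' a j ha hj.le) ?_
    · exact Γ.mono _ _ _ _ (hf.holds hs4' (by omega) (by omega)) (by rw [hr5]; omega)
    · rintro s'' ⟨h1, h2⟩
      rw [hr5] at h1
      exact ⟨h1, h2⟩
  rintro s5 ⟨g5, c5⟩
  refine Runs.seq (Runs.const (Runs.seq (Runs.add (Runs.seq (Runs.const (Runs.seq ?_))))))
  refine Runs.weaken (Runs.forProg (n := m a)
    (fun t s' => Frame (b + 6) top S s4 s' ∧ ∀ j < len a, s'.mem (top + j) =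
      iterTab (len a) (cap a) (fun j => init (a, j)) (fun t j => φ ((a, t), j)) t j)
      ?_ ?_ _ ?_ ?_ ?_) le_rfl ?_
  · rintro j t t' ⟨h5, h6⟩ h7 h8 h9 h10
    exact ⟨h5.congr h7 h8 h9 h10, by rwa [h8]⟩
  · rintro i hi s6 ⟨g6, c6⟩ hi'
    refine Runs.weaken (runs_fillCopy (b := b) (base := top) (len := len a) (cap := cap a) (S := S)
      (T := Gp a) (v := fun j => φ ((a, iterTab (len a) (cap a) (fun j => init (a, j))
      (fun t j => φ ((a, t), j)) i), j)) g6.query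
      (by rw [g6.reg _ (by omega), x0]) (by rw [g6.reg _ (by omega), x1])
      (by rw [g6.reg _ (by omega), x2]) (by rw [g6.reg _ (by omega), x4]) ?_) le_rfl ?_
    · intro j hj s' hf hj'
      have hr5 : s'.reg (b + 5) = top + len a + len a := by
        rw [hf.reg _ (by omega), g6.reg _ (by omega), x5]
      have hr0 : s'.reg b = top := by rw [hf.reg _ (by omega), g6.reg _ (by omega), x0]
      have hr1 : s'.reg (b + 1) = len a := by rw [hf.reg _ (by omega), g6.reg _ (by omega), x1]
      refine Runs.weaken (hpp ((a, _), j) s' (hok (b - Γ.d) a i ha) ⟨⟨?_, ?_, ?_, ?_⟩, ?_⟩ hf.query)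
        (hGp' a _ j (hok _ a i ha) hj.le) ?_
      · refine Γ.mono _ top _ _ (hf.holds (g6.holds hs4' (by omega) le_rfl) (by omega)
          (by omega)) (by rw [hr5]; omega)
      · rw [hd2, hr1]
      · rw [hd2, hr0, hr5]; simp only; omega
      · intro l hl
        rw [hd2, hr0, hf.mem _ (by simp only at hl; omega), c6 l hl]
      · rw [hd3, hj']
      · rintro s'' ⟨h1, h2⟩
        rw [hr5] at h1
        exact ⟨h1, h2⟩
    · rintro s7 ⟨g7, c7⟩
      refine ⟨⟨g6.trans g7 (by omega) le_rfl, fun j hj => ?_⟩, g7.reg _ (by omega), ?_⟩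
      · rw [c7 j hj, iterTab, clipTab, if_pos hj]
      · rw [g7.reg _ (by omega), hi']
  · refine ⟨(((g5.mono (by omega) le_rfl).setReg (by omega)).setReg (by omega)).setReg
      (by omega), fun j hj => ?_⟩
    simp only [MachineState.mem_setReg]
    rw [c5 j hj, iterTab, clipTab, if_pos hj]
  · simp [g5.reg (b + 3) (by omega), x3]
  · simp
  rintro s6 ⟨g6, c6⟩
  have y0 : s6.reg b = top := by rw [g6.reg _ (by omega), x0]
  have y1 : s6.reg (b + 1) = len a := by rw [g6.reg _ (by omega), x1]
  have y5 : s6.reg (b + 5) = top + len a + len a := by rw [g6.reg _ (by omega), x5]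
  refine Runs.seq (Runs.weaken (hph (a, _) s6 (hok (b - Γ.d) a (m a) ha) ⟨?_, ?_, ?_, ?_⟩ g6.query)
        (hGh' a _ (hok _ a (m a) ha)) ?_)
  · refine Γ.mono _ top _ _ (g6.holds hs4' (by omega) le_rfl) (by rw [y5]; omega)
  · rw [hd2, y1]
  · rw [hd2, y0, y5]; simp only; omega
  · intro l hl
    rw [hd2, y0, c6 l hl]
  rintro s7 ⟨g7, c7⟩
  rw [y5] at g7
  refine Runs.seq (Runs.const (Runs.add ⟨?_, ?_⟩))
  · exact (((g4.trans g6 (by omega) le_rfl).trans g7 (by omega) (by omega)).setReg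
      (by omega)).setReg le_rfl
  · simp [c7]

end LetIter


/-! ### Predicates, arithmetic, substitution and bounded search in the calculus -/

section Lang

open Classical in
/-- The indicator of a proposition. -/
noncomputable def ind (p : Prop) : ℕ := if p then 1 else 0

theorem ind_of {p : Prop} (h : p) : ind p = 1 := by simp [ind, h]

theorem ind_of_not {p : Prop} (h : ¬ p) : ind p = 0 := by simp [ind, h]

@[simp] theorem ind_eq_zero {p : Prop} : ind p = 0 ↔ ¬ p := by simp [ind]

theorem ind_le_one (p : Prop) : ind p ≤ 1 := by unfold ind; split_ifs <;> simp

theorem sum_ind_lt {m n : ℕ} (h : m ≤ n) : ∑ j ∈ Finset.range n, ind (j < m) = m := by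
  classical
  have : ∀ j, ind (j < m) = if j < m then 1 else 0 := fun j => by by_cases h : j < m <;> simp [ind, h]
  simp only [this]
  rw [Finset.sum_boole, show (Finset.range n).filter (· < m) = Finset.range m by ext; simp; omega]
  simp

variable {α : Type*} {L : Set (List Bool)} {Γ : Ctx α}

/-- The predicate `p` can be decided in polynomial time by oracle programs. -/
def CompP (L : Set (List Bool)) (Γ : Ctx α) (p : α → Prop) : Prop := Comp L Γ fun a => ind (p a)

theorem CompP.congr {p q : α → Prop} (hp : CompP L Γ p) (h : ∀ a, q a ↔ p a) : CompP L Γ q := by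
  rwa [show q = p from funext fun a => propext (h a)]

theorem CompP.ind {p : α → Prop} (hp : CompP L Γ p) : Comp L Γ fun a => ind (p a) := hp

theorem Comp.ite {p : α → Prop} [DecidablePred p] {f g : α → ℕ} (hp : CompP L Γ p)
    (hf : Comp L Γ f) (hg : Comp L Γ g) : Comp L Γ fun a => if p a then f a else g a :=
  (Comp.ite_ne_zero hp hf hg).congr fun a => by by_cases h : p a <;> simp [h, _root_.ind]

theorem Comp.ne_zero {f : α → ℕ} (hf : Comp L Γ f) : CompP L Γ fun a => f a ≠ 0 :=
  (Comp.ite_ne_zero hf (.const 1) (.const 0)).congr fun a => by simp [_root_.ind]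

theorem CompP.not {p : α → Prop} (hp : CompP L Γ p) : CompP L Γ fun a => ¬ p a :=
  (Comp.ite_ne_zero hp (.const 0) (.const 1)).congr fun a => by
    by_cases h : p a <;> simp [h, _root_.ind]

theorem CompP.and {p q : α → Prop} (hp : CompP L Γ p) (hq : CompP L Γ q) :
    CompP L Γ fun a => p a ∧ q a :=
  (Comp.ite_ne_zero hp hq (.const 0)).congr fun a => by
    by_cases h : p a <;> by_cases h' : q a <;> simp [h, h', _root_.ind]

theorem CompP.or {p q : α → Prop} (hp : CompP L Γ p) (hq : CompP L Γ q) :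
    CompP L Γ fun a => p a ∨ q a :=
  (Comp.ite_ne_zero hp (.const 1) hq).congr fun a => by
    by_cases h : p a <;> by_cases h' : q a <;> simp [h, h', _root_.ind]

theorem CompP.imp {p q : α → Prop} (hp : CompP L Γ p) (hq : CompP L Γ q) :
    CompP L Γ fun a => p a → q a :=
  (hp.not.or hq).congr fun a => by tauto

theorem Comp.lt {f g : α → ℕ} (hf : Comp L Γ f) (hg : Comp L Γ g) :
    CompP L Γ fun a => f a < g a :=
  (hg.sub hf).ne_zero.congr fun a => by omega

theorem Comp.le {f g : α → ℕ} (hf : Comp L Γ f) (hg : Comp L Γ g) :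
    CompP L Γ fun a => f a ≤ g a :=
  (hg.lt hf).not.congr fun a => by omega

theorem Comp.eq {f g : α → ℕ} (hf : Comp L Γ f) (hg : Comp L Γ g) :
    CompP L Γ fun a => f a = g a :=
  ((hf.le hg).and (hg.le hf)).congr fun a => by omega

theorem Comp.ne {f g : α → ℕ} (hf : Comp L Γ f) (hg : Comp L Γ g) :
    CompP L Γ fun a => f a ≠ g a := (hf.eq hg).not

theorem CompP.exists_lt {f : α → ℕ} {p : α → ℕ → Prop} (hf : Comp L Γ f)
    (hp : ∀ o, CompP L (Γ.ext o) fun q => p q.1 q.2) : CompP L Γ fun a => ∃ j < f a, p a j :=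
  (Comp.sum hf hp).ne_zero.congr fun a => by simp

theorem CompP.forall_lt {f : α → ℕ} {p : α → ℕ → Prop} (hf : Comp L Γ f)
    (hp : ∀ o, CompP L (Γ.ext o) fun q => p q.1 q.2) : CompP L Γ fun a => ∀ j < f a, p a j :=
  (CompP.exists_lt (p := fun a j => ¬ p a j) hf fun o => (hp o).not).not.congr fun a => by simp

theorem Comp.mul {f g : α → ℕ} (hf : Comp L Γ f) (hg : Comp L Γ g) :
    Comp L Γ fun a => f a * g a :=
  (Comp.sum hf fun _ => hg.fst_ext).congr fun a => by simp

/-- The quotient counts the `j` with `(j + 1) * g ≤ f`; there are none beyond `f`. The condition `0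
< g` yields the convention `f / 0 = 0`. -/
theorem Comp.div {f g : α → ℕ} (hf : Comp L Γ f) (hg : Comp L Γ g) :
    Comp L Γ fun a => f a / g a := by
  refine (Comp.sum (g := fun q => ind (0 < g q.1 ∧ (q.2 + 1) * g q.1 ≤ f q.1)) hf fun o => ?_).congr
    fun a => ?_
  · exact (((Comp.const 0).lt hg.fst_ext).and
      (((Comp.var.add (.const 1)).mul hg.fst_ext).le hf.fst_ext)).ind
  · rcases Nat.eq_zero_or_pos (g a) with h | h
    · simp [h, ind_of_not]
    · rw [← sum_ind_lt (Nat.div_le_self (f a) (g a))]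
      refine Finset.sum_congr rfl fun j _ => ?_
      simp only [h, true_and, ← Nat.le_div_iff_mul_le h, Nat.lt_iff_add_one_le]

theorem Comp.mod {f g : α → ℕ} (hf : Comp L Γ f) (hg : Comp L Γ g) :
    Comp L Γ fun a => f a % g a :=
  (hf.sub (hg.mul (hf.div hg))).congr fun a => by
    have := Nat.mod_add_div (f a) (g a)
    omega

/-- Computability is preserved when a context is replaced with a richer one. -/
theorem Comp.reindex {β : Type*} {Δ : Ctx β} {f : α → ℕ} (hf : Comp L Γ f) (h : β → α)
    (hd : Γ.d ≤ Δ.d) (hsz : ∀ b, Γ.sz (h b) ≤ Δ.sz b) (hpar : ∀ b, Γ.par (h b) = Δ.par b)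
    (hok : ∀ b, Δ.ok b → Γ.ok (h b))
    (hH : ∀ b top s, Δ.Holds b top s → Γ.Holds (h b) top s) : Comp L Δ fun b => f (h b) := by
  have hP : ∀ {g : α → ℕ}, PolyBdd Γ g → PolyBdd Δ fun b => g (h b) := fun ⟨P, hP⟩ =>
    ⟨P, fun b hb => (hP _ (hok b hb)).trans (P.eval_nat_mono (hsz b))⟩
  refine ⟨hP hf.1, fun b sp hb hsp => ?_⟩
  obtain ⟨p, T, hT, hp⟩ := hf.2 b sp (by omega) hsp
  refine ⟨p, _, hP hT, fun a s ha hs hq => ?_⟩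
  have := hp (h a) s (hok a ha) (hH _ _ _ hs) hq
  rwa [hpar] at this

/-- Drop the last but one variable. -/
theorem Comp.skip_ext {f : α × ℕ → ℕ} (hf : ∀ o, Comp L (Γ.ext o) f) (o o' : ℕ) :
    Comp L ((Γ.ext o).ext o') fun q => f (q.1.1, q.2) :=
  (hf (o + 1 + o')).reindex (Δ := (Γ.ext o).ext o') (fun q => (q.1.1, q.2)) (by simp only [Ctx.ext]; omega)
    (fun q => by simp only [Ctx.ext]; omega) (fun q => rfl) (fun q hq => hq)
    fun q top s hs => ⟨hs.1.1, by
      have := hs.2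
      simp only [Ctx.ext] at this
      rw [← this]; congr 1; omega⟩

/-- Drop a table before the last variable. -/
theorem Comp.skip_tab {f : α × ℕ → ℕ} (hf : ∀ o, Comp L (Γ.ext o) f) (o o' : ℕ)
    {len cap : α → ℕ} : Comp L ((Γ.tab o len cap).ext o') fun q => f (q.1.1, q.2) :=
  (hf (o + 2 + o')).reindex (Δ := (Γ.tab o len cap).ext o') (fun q => (q.1.1, q.2)) (by simp only [Ctx.ext, Ctx.tab]; omega)
    (fun q => by simp only [Ctx.ext, Ctx.tab]; omega) (fun q => rfl) (fun q hq => hq.1)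
    fun q top s hs => ⟨hs.1.1, by
      have := hs.2
      simp only [Ctx.tab] at this
      rw [← this]; congr 1; omega⟩

/-- Substitution is a sum over `j ≤ g a` in which only the summand with `j = g a` survives. -/
theorem Comp.subst {f : α × ℕ → ℕ} {g : α → ℕ} (hf : ∀ o, Comp L (Γ.ext o) f)
    (hg : Comp L Γ g) : Comp L Γ fun a => f (a, g a) := by
  refine (Comp.sum (g := fun q => if q.2 = g q.1 then f q else 0) (hg.add (.const 1)) fun o =>
    Comp.ite (Comp.var.eq hg.fst_ext) (hf o) (.const 0)).congr fun a => ?_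
  simp

/-- Iterate a function with values cut off at `cap`. -/
theorem Comp.iterate {m cap init : α → ℕ} {φ : α × ℕ → ℕ} (hm : Comp L Γ m) (hcap : Comp L Γ cap)
    (hinit : Comp L Γ init) (hφ : ∀ o, Comp L (Γ.ext o) φ) :
    Comp L Γ fun a => (fun x => Min.min (φ (a, x)) (cap a))^[m a] (Min.min (init a) (cap a)) := by
  refine (Comp.letIter (init := fun q => init q.1) (φ := fun q => φ (q.1.1, q.1.2 0))
    (h := fun q => q.2 0) hm (.const 1) hcap (fun o => hinit.fst_ext) (fun o o' => ?_)
    fun o => ?_).congr fun a => ?_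
  · have h1 : ∀ o'', Comp L (((Γ.tab o (fun _ => 1) cap).ext o').ext o'')
        fun q => φ (q.1.1.1, q.2) := fun o'' => Comp.skip_ext (fun i => Comp.skip_tab hφ o i) o' o''
    exact Comp.subst (f := fun q => φ (q.1.1.1, q.2)) h1
      (Comp.lookup ((HasTab.snd (PolyBdd.const 1) hcap.1 o).fst_ext o') (.const 0))
  · exact Comp.lookup (HasTab.snd (PolyBdd.const 1) hcap.1 o) (.const 0)
  · show _ = iterTab 1 (cap a) (fun _ => init a) (fun t _ => φ (a, t 0)) (m a) 0
    induction m a with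
    | zero => simp [iterTab, clipTab]
    | succ n ih =>
      rw [Function.iterate_succ_apply', ih]
      conv_rhs => rw [iterTab]
      simp [clipTab]

/-- The power `d ^ g a` need not be polynomially bounded, so it is never formed: one divides by `d`
repeatedly, and all intermediate values stay below `f a`. -/
theorem Comp.div_pow {f g : α → ℕ} (d : ℕ) (hf : Comp L Γ f) (hg : Comp L Γ g) :
    Comp L Γ fun a => f a / d ^ g a := by
  refine (Comp.iterate (φ := fun q => q.2 / d) hg hf hf fun o => Comp.var.div (.const d)).congr
    fun a => ?_
  have key : ∀ n, (fun x => Min.min (x / d) (f a))^[n] (f a) = f a / d ^ n := by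
    intro n
    induction n with
    | zero => simp
    | succ n ih =>
      rw [Function.iterate_succ_apply', ih, Nat.div_div_eq_div_mul, ← pow_succ, min_eq_left]
      exact Nat.div_le_self _ _
  simp [key]

/-- Doubling with truncation at `c` after each step; the power itself could be too large for the
calculus. -/
theorem Comp.min_two_pow {c g : α → ℕ} (hc : Comp L Γ c) (hg : Comp L Γ g) :
    Comp L Γ fun a => Min.min (2 ^ g a) (c a) := by
  refine (Comp.iterate (φ := fun q => 2 * q.2) hg hc (.const 1) fun o =>
    (Comp.const 2).mul .var).congr fun a => ?_
  have key : ∀ n, (fun x => Min.min (2 * x) (c a))^[n] (Min.min 1 (c a)) = Min.min (2 ^ n) (c a) := by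
    intro n
    induction n with
    | zero => simp
    | succ n ih =>
      rw [Function.iterate_succ_apply', ih, pow_succ]
      omega
  simp [key]

/-- The least `j < n` with `p j`, or `n` if there is none. -/
noncomputable def bfind (n : ℕ) (p : ℕ → Prop) : ℕ :=
  ∑ j ∈ Finset.range n, ind (∀ i < j + 1, ¬ p i)

theorem bfind_eq {n k : ℕ} {p : ℕ → Prop} (hk : k ≤ n) (hp : ∀ i < k, ¬ p i)
    (h : k < n → p k) : bfind n p = k := by
  rw [← sum_ind_lt hk, bfind]
  refine Finset.sum_congr rfl fun j hj => ?_
  congr 1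
  refine propext ⟨fun hj' => ?_, fun hj' i hi => hp i (by omega)⟩
  by_contra hjk
  exact hj' k (by omega) (h (by have := Finset.mem_range.1 hj; omega))

open Classical in
theorem bfind_spec {n : ℕ} {p : ℕ → Prop} (h : ∃ i < n, p i) :
    bfind n p < n ∧ p (bfind n p) ∧ ∀ i < bfind n p, ¬ p i := by
  have h' : ∃ i, p i := h.imp fun _ h => h.2
  obtain ⟨i, hi, hpi⟩ := h
  have hlt : Nat.find h' < n := (Nat.find_le hpi).trans_lt hi
  rw [bfind_eq hlt.le (fun i hi => Nat.find_min h' hi) fun _ => Nat.find_spec h']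
  exact ⟨hlt, Nat.find_spec h', fun i hi => Nat.find_min h' hi⟩

theorem bfind_of_not {n : ℕ} {p : ℕ → Prop} (h : ∀ i < n, ¬ p i) : bfind n p = n :=
  bfind_eq le_rfl h (by omega)

theorem bfind_lt_iff {n : ℕ} {p : ℕ → Prop} : bfind n p < n ↔ ∃ i < n, p i := by
  refine ⟨fun h => ?_, fun h => (bfind_spec h).1⟩
  by_contra! h'
  rw [bfind_of_not h'] at h
  omega

theorem Comp.bfind {f : α → ℕ} {p : α → ℕ → Prop} (hf : Comp L Γ f)
    (hp : ∀ o, CompP L (Γ.ext o) fun q => p q.1 q.2) : Comp L Γ fun a => bfind (f a) (p a) := by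
  refine Comp.sum (g := fun q => ind (∀ i < q.2 + 1, ¬ p q.1 i)) hf fun o => ?_
  refine CompP.forall_lt (p := fun q i => ¬ p q.1 i) (Comp.var.add (.const 1)) fun o' => ?_
  exact CompP.not (Comp.skip_ext hp o o')

end Lang

/-! ## Decision problems -/

/-- The context of an input: the length of the string, the parameter, the string. -/
def inputCtx : Ctx (List Bool × ℕ) where
  d := 3
  sz y := y.1.length + y.2
  par y := y.2
  ok _ := True
  Holds y top s := s.reg 0 = y.1.length ∧ s.reg 1 = y.2 ∧ s.reg 2 = 0 ∧ y.1.length ≤ top ∧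
    ∀ j < y.1.length, s.mem j = (y.1.getD j false).toNat
  mono _ _ _ _ h ht := ⟨h.1, h.2.1, h.2.2.1, h.2.2.2.1.trans ht, h.2.2.2.2⟩
  local' _ _ _ _ h h1 h2 := ⟨(h1 0 (by simp)).trans h.1, (h1 1 (by simp)).trans h.2.1,
    (h1 2 (by simp)).trans h.2.2.1, h.2.2.2.1,
    fun j hj => (h2 j (hj.trans_le h.2.2.2.1)).trans (h.2.2.2.2 j hj)⟩

theorem comp_length {L : Set (List Bool)} : Comp L inputCtx fun y => y.1.length :=
  Comp.of_reg (r := 0) (by simp [inputCtx]) (PolyBdd.sz.of_le fun a _ => by simp [inputCtx])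
    fun _ _ _ _ h => h.1

theorem comp_param {L : Set (List Bool)} : Comp L inputCtx fun y => y.2 :=
  Comp.of_reg (r := 1) (by simp [inputCtx]) (PolyBdd.sz.of_le fun a _ => by simp [inputCtx])
    fun _ _ _ _ h => h.2.1

theorem hasTab_input : HasTab inputCtx (fun y => y.1.length)
    fun y j => (y.1.getD j false).toNat := by
  refine ⟨2, 0, by simp [inputCtx], by simp [inputCtx], fun _ => 1, .const 1,
    PolyBdd.sz.of_le fun a _ => by simp [inputCtx], fun a _ => ⟨fun j => ?_, fun j hj => ?_,
    fun top s hs => ⟨hs.1, ?_, ?_⟩⟩⟩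
  · exact Bool.toNat_le _
  · show (a.1.getD j false).toNat = 0
    rw [List.getD_eq_default _ _ hj]; rfl
  · rw [hs.2.2.1]; simpa using hs.2.2.2.1
  · rw [hs.2.2.1]; simpa using hs.2.2.2.2

theorem HasPTC.of_compP {Q : Set (List Bool × ℕ)} (L : Set (List Bool))
    (h : CompP L inputCtx (· ∈ Q)) : HasPTC Q := by
  -- Register `0` holds the length of the input and thereby the first free address, so it serves as
  -- stack pointer. The result arrives in register `3`; since register `2` is still `0`, the final
  -- addition copies it to register `0`.
  obtain ⟨p, T, ⟨P, hP⟩, hp⟩ := And.right h 3 0 le_rfl (by omega)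
  refine ⟨L, .seq p (.add 0 3 2), P + 1, (.X + 8) ^ 4, fun x k => ?_⟩
  have h1 : inputCtx.Holds (x, k) ((initState x k).reg 0) (initState x k) := by
    simp [inputCtx, initState]
  obtain ⟨t, s, h2, h3, h4⟩ := Runs.seq (T := T (x, k)) (T' := 1)
    (q := .add 0 3 2) (Q := fun s => (s.reg 0 ≠ 0 ↔ (x, k) ∈ Q) ∧
      ∀ q ∈ s.asked, q.length ≤ (k + 8) ^ 4)
    ((hp (x, k) (initState x k) trivial h1 rfl).weaken le_rfl (by
      rintro s ⟨h2, h3⟩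
      refine Runs.add ⟨?_, ?_⟩
      · have : s.reg 2 = 0 := by rw [h2.reg 2 (by omega)]; rfl
        simp [h3, this]
      · obtain ⟨qs, h4, h5⟩ := h2.asked
        have h5 : ∀ q ∈ qs, q.length ≤ (k + 8) ^ 4 := h5
        simpa [h4, initState] using h5))
  refine ⟨t, s, h2, h3.trans ?_, h4.1, ?_⟩
  · have := hP (x, k) trivial
    simp only [inputCtx] at this
    simpa using this
  · simpa using h4.2


/-! ## Prime induced subgraphs and modular-width -/

section ModularWidth

variable {V : Type*} {G : SimpleGraph V}

/-- `G[X]` is connected (or empty): every cut of `X` is crossed by an edge. -/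
def ConnOn (G : SimpleGraph V) (X : Set V) : Prop :=
  ∀ S ⊆ X, S.Nonempty → (X \ S).Nonempty → ∃ u ∈ S, ∃ v ∈ X \ S, G.Adj u v

/-- A walk that leaves a set contains an edge that leaves it; conversely the vertices reachable from
`u` form a cut that no edge crosses. Working with cuts avoids walks in subtypes later on. -/
theorem preconnected_induce_iff {X : Set V} : (G.induce X).Preconnected ↔ ConnOn G X := by
  constructor
  · rintro h S hS ⟨u, hu⟩ ⟨v, hv, hvS⟩
    obtain ⟨w⟩ := h ⟨u, hS hu⟩ ⟨v, hv⟩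
    obtain ⟨d, -, h1, h2⟩ := w.exists_boundary_dart {x | x.1 ∈ S} hu hvS
    exact ⟨d.fst, h1, d.snd, ⟨d.snd.2, h2⟩, d.adj⟩
  · intro h u v
    by_contra huv
    obtain ⟨x, ⟨hx, hx'⟩, y, ⟨hy, hy'⟩, hxy⟩ := h {x | ∃ hx : x ∈ X, (G.induce X).Reachable u ⟨x, hx⟩}
      (fun x hx => hx.1) ⟨u, u.2, .rfl⟩ ⟨v, v.2, fun hv => huv hv.2⟩
    have hadj : (G.induce X).Adj ⟨x, hx⟩ ⟨y, hy⟩ := hxy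
    exact hy' ⟨hy, hx'.trans hadj.reachable⟩

/-- `M` is a module of `G[A]`. -/
def IsModuleIn (G : SimpleGraph V) (A M : Set V) : Prop :=
  M ⊆ A ∧ ∀ v ∈ A, v ∉ M → (∀ u ∈ M, ¬ G.Adj v u) ∨ ∀ u ∈ M, G.Adj v u

/-- `G[S]` has at least three vertices and only trivial modules. -/
def IsPrimeSet (G : SimpleGraph V) (S : Set V) : Prop :=
  3 ≤ S.ncard ∧ ∀ M, IsModuleIn G S M → M.Subsingleton ∨ M = S

theorem IsGraphModule.adj_iff {M : Set V} (hM : IsGraphModule G M) {v u u' : V} (hv : v ∉ M)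
    (hu : u ∈ M) (hu' : u' ∈ M) : G.Adj v u ↔ G.Adj v u' := by
  rcases hM v hv with h | h
  · simp [h u hu, h u' hu']
  · simp [h u hu, h u' hu']

theorem isGraphModule_iff {M : Set V} : IsGraphModule G M ↔
    ∀ v, v ∉ M → ∀ u ∈ M, ∀ u' ∈ M, G.Adj v u → G.Adj v u' := by
  refine ⟨fun h v hv u hu u' hu' => (h.adj_iff hv hu hu').1, fun h v hv => ?_⟩
  by_cases h' : ∃ u ∈ M, G.Adj v u
  · obtain ⟨u, hu, huv⟩ := h'
    exact .inr fun u' hu' => h v hv u hu u' hu' huv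
  · push Not at h'
    exact .inl h'

theorem isModuleIn_iff {A M : Set V} : IsModuleIn G A M ↔
    M ⊆ A ∧ ∀ v ∈ A, v ∉ M → ∀ u ∈ M, ∀ u' ∈ M, G.Adj v u → G.Adj v u' := by
  refine ⟨fun h => ⟨h.1, fun v hA hv u hu u' hu' huv => ?_⟩, fun h => ⟨h.1, fun v hA hv => ?_⟩⟩
  · rcases h.2 v hA hv with h' | h'
    exacts [absurd huv (h' u hu), h' u' hu']
  · by_cases h' : ∃ u ∈ M, G.Adj v u
    · obtain ⟨u, hu, huv⟩ := h'
      exact .inr fun u' hu' => h.2 v hA hv u hu u' hu' huv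
    · push Not at h'
      exact .inl h'

theorem IsModuleIn.adj_iff {A M : Set V} (hM : IsModuleIn G A M) {v u u' : V} (hA : v ∈ A)
    (hv : v ∉ M) (hu : u ∈ M) (hu' : u' ∈ M) : G.Adj v u ↔ G.Adj v u' :=
  ⟨(isModuleIn_iff.1 hM).2 v hA hv u hu u' hu', (isModuleIn_iff.1 hM).2 v hA hv u' hu' u hu⟩

theorem IsGraphModule.union {M M' : Set V} (hM : IsGraphModule G M) (hM' : IsGraphModule G M')
    (h : (M ∩ M').Nonempty) : IsGraphModule G (M ∪ M') := by
  obtain ⟨x, hx, hx'⟩ := h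
  have key : ∀ v, v ∉ M ∪ M' → ∀ u ∈ M ∪ M', (G.Adj v u ↔ G.Adj v x) := by
    rintro v hv u (hu | hu)
    · exact hM.adj_iff (fun h => hv (.inl h)) hu hx
    · exact hM'.adj_iff (fun h => hv (.inr h)) hu hx'
  exact isGraphModule_iff.2 fun v hv u hu u' hu' h => (key v hv u' hu').2 ((key v hv u hu).1 h)

/-- The delicate case is a vertex `v` of `M ∩ M'`. A vertex `y` of `M' \ M` takes its place: `M'`
being a module, `v` and `y` look alike from `M \ M'`, and `y` sees all of `M` alike. -/
theorem IsGraphModule.sdiff {M M' : Set V} (hM : IsGraphModule G M) (hM' : IsGraphModule G M')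
    (h : (M' \ M).Nonempty) : IsGraphModule G (M \ M') := by
  obtain ⟨y, hy', hy⟩ := h
  refine isGraphModule_iff.2 fun v hv u hu u' hu' huv => ?_
  by_cases hvM : v ∈ M
  · have hvM' : v ∈ M' := by by_contra h; exact hv ⟨hvM, h⟩
    have key : ∀ u ∈ M \ M', (G.Adj v u ↔ G.Adj y u) := fun u hu => by
      rw [G.adj_comm v u, G.adj_comm y u]
      exact hM'.adj_iff hu.2 hvM' hy'
    exact (key u' hu').2 ((hM.adj_iff hy hu.1 hu'.1).1 ((key u hu).1 huv))
  · exact (hM.adj_iff hvM hu.1 hu'.1).1 huv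

theorem IsGraphModule.isModuleIn_inter {M : Set V} (hM : IsGraphModule G M) (S : Set V) :
    IsModuleIn G S (S ∩ M) :=
  isModuleIn_iff.2 ⟨Set.inter_subset_left, fun _ hv hv' _ hu _ hu' h =>
    (hM.adj_iff (fun h => hv' ⟨hv, h⟩) hu.2 hu'.2).1 h⟩

theorem isGraphModule_singleton (v : V) : IsGraphModule G {v} :=
  isGraphModule_iff.2 fun _ _ u hu u' hu' h => by
    rw [Set.mem_singleton_iff] at hu hu'; rwa [hu', ← hu]

theorem IsGraphModule.compl_graph {M : Set V} (hM : IsGraphModule G M) : IsGraphModule Gᶜ M := by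
  refine isGraphModule_iff.2 fun v hv u hu u' hu' h => ?_
  rw [SimpleGraph.compl_adj] at h ⊢
  exact ⟨fun h' => hv (h' ▸ hu'), fun h' => h.2 ((hM.adj_iff hv hu hu').2 h')⟩

theorem IsModuleIn.compl_graph {A M : Set V} (hM : IsModuleIn G A M) : IsModuleIn Gᶜ A M := by
  refine isModuleIn_iff.2 ⟨hM.1, fun v hA hv u hu u' hu' h => ?_⟩
  rw [SimpleGraph.compl_adj] at h ⊢
  exact ⟨fun h' => hv (h' ▸ hu'), fun h' => h.2 ((hM.adj_iff hA hv hu hu').2 h')⟩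

theorem IsPrimeSet.compl_graph {S : Set V} (hS : IsPrimeSet G S) : IsPrimeSet Gᶜ S :=
  ⟨hS.1, fun M hM => hS.2 M (by simpa using hM.compl_graph)⟩

theorem IsPrimeNode.connOn {N : Set V} (hN : IsPrimeNode G N) : ConnOn G N :=
  preconnected_induce_iff.1 hN.2.2.1.preconnected

theorem induce_compl_graph (N : Set V) : (G.induce N)ᶜ = Gᶜ.induce N := by
  ext a b
  simp [SimpleGraph.compl_adj, Subtype.ext_iff]

theorem IsPrimeNode.connOn_compl {N : Set V} (hN : IsPrimeNode G N) : ConnOn Gᶜ N := by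
  have := hN.2.2.2.preconnected
  rw [induce_compl_graph] at this
  exact preconnected_induce_iff.1 this

/-- A prime vertex of the decomposition tree is not the union of two proper modules. -/
theorem IsPrimeNode.union_ne {N A B : Set V} (hN : IsPrimeNode G N) (hA : IsGraphModule G A)
    (hB : IsGraphModule G B) (hAN : A ⊂ N) (hBN : B ⊂ N) : A ∪ B ≠ N := by
  intro hAB
  obtain ⟨x, hxN, hxA⟩ := Set.exists_of_ssubset hAN
  obtain ⟨a, haN, haB⟩ := Set.exists_of_ssubset hBN
  have hsub : ∀ y ∈ N, y ∉ A → y ∈ B := fun y hy hyA => by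
    rw [← hAB] at hy
    exact hy.resolve_left hyA
  have haA : a ∈ A := by
    rw [← hAB] at haN
    exact haN.resolve_right haB
  -- All pairs between `A` and `N \ A` have the same adjacency, so this cut has no edges in `G` or
  -- none in the complement, although both are connected on `N`.
  have key : ∀ y ∈ N, y ∉ A → ∀ b ∈ A, (G.Adj b y ↔ G.Adj a x) := by
    intro y hy hyA b hb
    rw [G.adj_comm b y, hA.adj_iff hyA hb haA, G.adj_comm y a]
    exact hB.adj_iff haB (hsub y hy hyA) (hsub x hxN hxA)
  obtain ⟨u, hu, v, hv, huv⟩ := hN.connOn A hAN.subset ⟨a, haA⟩ ⟨x, hxN, hxA⟩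
  obtain ⟨u', hu', v', hv', huv'⟩ := hN.connOn_compl A hAN.subset ⟨a, haA⟩ ⟨x, hxN, hxA⟩
  rw [SimpleGraph.compl_adj] at huv'
  exact huv'.2 ((key v' hv'.1 hv'.2 u' hu').2 ((key v hv.1 hv.2 u hu).1 huv))

/-- The maximal proper submodules of `N`. -/
def IsMaxSubmodule (G : SimpleGraph V) (N C : Set V) : Prop :=
  Maximal (fun D => IsGraphModule G D ∧ D ⊂ N) C

/-- If they met, their union would be a module, still proper by `IsPrimeNode.union_ne`, and
maximality would identify both with it. -/
theorem IsMaxSubmodule.disjoint {N C D : Set V} (hN : IsPrimeNode G N)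
    (hC : IsMaxSubmodule G N C) (hD : IsMaxSubmodule G N D) (hCD : C ≠ D) : Disjoint C D := by
  by_contra h
  rw [Set.not_disjoint_iff_nonempty_inter] at h
  have hU := hC.prop.1.union hD.prop.1 h
  have hUN : C ∪ D ⊂ N :=
    (Set.union_subset hC.prop.2.subset hD.prop.2.subset).ssubset_of_ne
      (hN.union_ne hC.prop.1 hD.prop.1 hC.prop.2 hD.prop.2)
  have h1 := hC.eq_of_subset ⟨hU, hUN⟩ Set.subset_union_left
  have h2 := hD.eq_of_subset ⟨hU, hUN⟩ Set.subset_union_right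
  exact hCD (h1.trans h2.symm)

theorem exists_isMaxSubmodule [Finite V] {N D : Set V} (hD : IsGraphModule G D) (hDN : D ⊂ N) :
    ∃ C, D ⊆ C ∧ IsMaxSubmodule G N C :=
  (Set.toFinite {D | IsGraphModule G D ∧ D ⊂ N}).exists_le_maximal ⟨hD, hDN⟩

/-- Since `N` is strong, only a module properly inside `N` could overlap `C`. It lies in a maximal
one, which equals `C` or is disjoint from it. -/
theorem IsMaxSubmodule.isStrongModule [Finite V] {N C : Set V} (hN : IsPrimeNode G N)
    (hC : IsMaxSubmodule G N C) (hne : C.Nonempty) : IsStrongModule G C := by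
  refine ⟨hne, hC.prop.1, fun M hM => ?_⟩
  rcases hN.1.2.2 M hM with h | h | h
  · exact .inl (hC.prop.2.subset.trans h)
  · rcases h.eq_or_ssubset with rfl | h
    · exact .inl hC.prop.2.subset
    · obtain ⟨D, hMD, hD⟩ := exists_isMaxSubmodule hM h
      by_cases hCD : C = D
      · exact .inr (.inl (hCD ▸ hMD))
      · exact .inr (.inr ((hC.disjoint hN hD hCD).mono_right hMD))
  · exact .inr (.inr (h.mono_left hC.prop.2.subset))

theorem mem_mdChildren_iff [Finite V] {N C : Set V} (hN : IsPrimeNode G N) :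
    C ∈ mdChildren G N ↔ IsMaxSubmodule G N C ∧ C.Nonempty := by
  constructor
  · rintro ⟨h1, h2, h3⟩
    obtain ⟨D, hCD, hD⟩ := exists_isMaxSubmodule h1.2.1 h2
    rcases hCD.eq_or_ssubset with rfl | h
    · exact ⟨hD, h1.1⟩
    · exact absurd hD.prop.2 (h3 D (hD.isStrongModule hN (h1.1.mono hCD)) h)
  · rintro ⟨h1, h2⟩
    refine ⟨h1.isStrongModule hN h2, h1.prop.2, fun D hD hCD hDN => ?_⟩
    exact hCD.ne (h1.eq_of_subset ⟨hD.2.1, hDN⟩ hCD.subset)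

theorem exists_mem_mdChildren [Finite V] {N : Set V} (hN : IsPrimeNode G N) {v : V} (hv : v ∈ N) :
    ∃ C ∈ mdChildren G N, v ∈ C := by
  have : {v} ⊂ N := by
    refine (Set.singleton_subset_iff.2 hv).ssubset_of_ne fun h => ?_
    exact Set.not_subsingleton_iff.2 hN.2.1 (h ▸ Set.subsingleton_singleton)
  obtain ⟨C, hvC, hC⟩ := exists_isMaxSubmodule (isGraphModule_singleton v) this
  exact ⟨C, (mem_mdChildren_iff hN).2 ⟨hC, v, hvC rfl⟩, hvC rfl⟩

/-- The children of a prime vertex give rise to a prime induced subgraph. -/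
theorem exists_isPrimeSet_of_isPrimeNode [Finite V] {N : Set V} (hN : IsPrimeNode G N) :
    ∃ S, IsPrimeSet G S ∧ S.ncard = (mdChildren G N).ncard := by
  have hch : ∀ C ∈ mdChildren G N, IsMaxSubmodule G N C ∧ C.Nonempty := fun C hC =>
    (mem_mdChildren_iff hN).1 hC
  have : Nonempty V := hN.1.1.nonempty
  choose! r hr using fun C hC => (hch C hC).2
  have hdisj : ∀ C ∈ mdChildren G N, ∀ D ∈ mdChildren G N, ∀ v, v ∈ C → v ∈ D → C = D := by
    intro C hC D hD v hvC hvD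
    by_contra hCD
    exact Set.disjoint_left.1 ((hch C hC).1.disjoint hN (hch D hD).1 hCD) hvC hvD
  have hinj : Set.InjOn r (mdChildren G N) := fun C hC D hD h =>
    hdisj C hC D hD (r C) (hr C hC) (h ▸ hr D hD)
  refine ⟨r '' mdChildren G N, ⟨?_, fun A hA => ?_⟩, hinj.ncard_image⟩
  · rw [hinj.ncard_image]
    by_contra hlt
    obtain ⟨v, hv⟩ := hN.1.1
    obtain ⟨C, hC, hvC⟩ := exists_mem_mdChildren hN hv
    obtain ⟨w, hw, hwC⟩ := Set.exists_of_ssubset (hch C hC).1.prop.2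
    obtain ⟨D, hD, hwD⟩ := exists_mem_mdChildren hN hw
    have hCD : C ≠ D := fun h => hwC (h ▸ hwD)
    -- With fewer than three children, `N` would be the union of two proper modules.
    have hpair : ({C, D} : Set (Set V)) = mdChildren G N :=
      Set.eq_of_subset_of_ncard_le (Set.insert_subset hC (Set.singleton_subset_iff.2 hD))
        (by rw [Set.ncard_pair hCD]; omega)
    refine hN.union_ne (hch C hC).1.prop.1 (hch D hD).1.prop.1 (hch C hC).1.prop.2
      (hch D hD).1.prop.2 (Set.Subset.antisymm (Set.union_subset (hch C hC).1.prop.2.subset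
        (hch D hD).1.prop.2.subset) fun x hx => ?_)
    obtain ⟨E, hE, hxE⟩ := exists_mem_mdChildren hN hx
    rw [← hpair] at hE
    rcases hE with rfl | rfl
    exacts [.inl hxE, .inr hxE]
  · by_contra! h
    obtain ⟨h1, h2⟩ := h
    obtain ⟨a, ha, b, hb, hab⟩ := h1
    obtain ⟨s, hs, hsA⟩ := Set.exists_of_ssubset (hA.1.ssubset_of_ne h2)
    obtain ⟨C₁, hC₁, rfl⟩ := hA.1 ha
    obtain ⟨C₂, hC₂, rfl⟩ := hA.1 hb
    obtain ⟨D, hD, rfl⟩ := hs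
    -- The union of the children represented in `A`. It is a module of `G`, it is proper because it
    -- misses `r D`, and it contains `C₂` besides `C₁`, against the maximality of `C₁`.
    set U : Set V := {v | ∃ C ∈ mdChildren G N, r C ∈ A ∧ v ∈ C} with hU
    have hUm : IsGraphModule G U := by
      refine isGraphModule_iff.2 ?_
      rintro v hv u ⟨C, hC, hCA, huC⟩ u' ⟨C', hC', hCA', huC'⟩ huv
      by_cases hvN : v ∈ N
      · obtain ⟨E, hE, hvE⟩ := exists_mem_mdChildren hN hvN
        have hEA : r E ∉ A := fun h => hv ⟨E, hE, h, hvE⟩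
        have key : ∀ F ∈ mdChildren G N, r F ∈ A → ∀ w ∈ F, (G.Adj v w ↔ G.Adj (r E) (r F)) := by
          intro F hF hFA w hw
          have hEF : E ≠ F := fun h => hEA (h ▸ hFA)
          rw [(hch F hF).1.prop.1.adj_iff (fun h => hEF (hdisj E hE F hF v hvE h)) hw (hr F hF),
            G.adj_comm v, G.adj_comm (r E)]
          exact (hch E hE).1.prop.1.adj_iff
            (fun h => hEF (hdisj E hE F hF (r F) h (hr F hF))) hvE (hr E hE)
        rw [key C hC hCA u huC] at huv
        rw [key C' hC' hCA' u' huC']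
        exact (hA.adj_iff ⟨E, hE, rfl⟩ hEA hCA hCA').1 huv
      · exact (hN.1.2.1.adj_iff hvN ((hch C hC).1.prop.2.subset huC)
          ((hch C' hC').1.prop.2.subset huC')).1 huv
    have hUN : U ⊂ N := by
      refine Set.ssubset_iff_subset_ne.2 ⟨?_, fun h => ?_⟩
      · rintro v ⟨C, hC, -, hvC⟩
        exact (hch C hC).1.prop.2.subset hvC
      · have : r D ∈ U := h ▸ (hch D hD).1.prop.2.subset (hr D hD)
        obtain ⟨E, hE, hEA, hDE⟩ := this
        exact hsA (hdisj D hD E hE _ (hr D hD) hDE ▸ hEA)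
    have := (hch C₁ hC₁).1.eq_of_subset ⟨hUm, hUN⟩ fun v hv => ⟨C₁, hC₁, ha, hv⟩
    have h3 : r C₂ ∈ C₁ := this ▸ ⟨C₂, hC₂, hb, hr C₂ hC₂⟩
    exact hab (by rw [hdisj C₁ hC₁ C₂ hC₂ _ h3 (hr C₂ hC₂)])

theorem IsPrimeSet.not_two_subsingleton [Finite V] {S : Set V} (hS : IsPrimeSet G S) {X Y : Set V}
    (hX : X.Subsingleton) (hY : Y.Subsingleton) (h : S ⊆ X ∪ Y) : False := by
  have h1 := Set.ncard_le_ncard h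
  have h2 := Set.ncard_union_le X Y
  have h3 := Set.ncard_le_one_iff_subsingleton.2 hX
  have h4 := Set.ncard_le_one_iff_subsingleton.2 hY
  have := hS.1
  omega

/-- If no edge crosses a cut of `N`, both sides are modules of `G`. Their traces on `S` are trivial
and cannot both be small, so one side contains `S`, contradicting that `N` is least. The same
argument in the complement gives its connectedness. -/
theorem IsPrimeSet.connOn_of_least [Finite V] {S N : Set V} (hS : IsPrimeSet G S)
    (hN : IsGraphModule G N) (hSN : S ⊆ N) (hleast : ∀ M, IsGraphModule G M → S ⊆ M → N ⊆ M) :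
    ConnOn G N := by
  intro X hXN hX hX'
  by_contra! h
  have hmod : ∀ Y ⊆ N, (∀ u ∈ Y, ∀ v ∈ N \ Y, ¬ G.Adj v u) → IsGraphModule G Y := by
    intro Y hYN hY v hv
    by_cases hvN : v ∈ N
    · exact .inl fun u hu => hY u hu v ⟨hvN, hv⟩
    · exact (hN v hvN).imp (fun h u hu => h u (hYN hu)) (fun h u hu => h u (hYN hu))
  have m1 := hmod X hXN fun u hu v hv huv => h u hu v hv huv.symm
  have m2 := hmod (N \ X) Set.sdiff_subset fun u hu v hv huv => h v (by
    by_contra hvX; exact hv.2 ⟨hv.1, hvX⟩) u hu huv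
  rcases hS.2 _ (m1.isModuleIn_inter S) with h1 | h1
  · rcases hS.2 _ (m2.isModuleIn_inter S) with h2 | h2
    · refine hS.not_two_subsingleton h1 h2 fun s hs => ?_
      by_cases hsX : s ∈ X
      exacts [.inl ⟨hs, hsX⟩, .inr ⟨hs, hSN hs, hsX⟩]
    · obtain ⟨x, hx⟩ := hX
      exact (hleast _ m2 (Set.inter_eq_left.1 h2) (hXN hx)).2 hx
  · obtain ⟨x, hx, hx'⟩ := hX'
    exact hx' (hleast _ m1 (Set.inter_eq_left.1 h1) hx)

/-- Every prime induced subgraph lives in a prime vertex of the decomposition tree. -/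
theorem exists_isPrimeNode_of_isPrimeSet [Finite V] {S : Set V} (hS : IsPrimeSet G S) :
    ∃ N, IsPrimeNode G N ∧ S.ncard ≤ (mdChildren G N).ncard := by
  -- The required vertex of the tree is the least module that contains `S`.
  set N : Set V := ⋂₀ {M | IsGraphModule G M ∧ S ⊆ M} with hNdef
  have hSN : S ⊆ N := Set.subset_sInter fun M hM => hM.2
  have hleast : ∀ M, IsGraphModule G M → S ⊆ M → N ⊆ M := fun M h1 h2 =>
    Set.sInter_subset_of_mem ⟨h1, h2⟩
  have hNm : IsGraphModule G N := by
    intro v hv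
    simp only [hNdef, Set.mem_sInter, not_forall] at hv
    obtain ⟨M, hM, hvM⟩ := hv
    exact (hM.1 v hvM).imp (fun h u hu => h u (hleast M hM.1 hM.2 hu))
      (fun h u hu => h u (hleast M hM.1 hM.2 hu))
  have hnt : S.Nontrivial := by
    rw [← Set.not_subsingleton_iff, ← Set.ncard_le_one_iff_subsingleton]
    have := hS.1
    omega
  have hne : N.Nonempty := hnt.nonempty.mono hSN
  have hstrong : IsStrongModule G N := by
    refine ⟨hne, hNm, fun M hM => ?_⟩
    by_contra! h
    obtain ⟨h1, h2, h3⟩ := h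
    -- If `M` overlapped `N`, the modules `M` and `N \ M` would cover `S`; one of them would contain
    -- `S`, and hence `N`.
    have m2 := hNm.sdiff hM (Set.sdiff_nonempty.2 h2)
    rcases hS.2 _ (hM.isModuleIn_inter S) with h4 | h4
    · rcases hS.2 _ (m2.isModuleIn_inter S) with h5 | h5
      · refine hS.not_two_subsingleton h4 h5 fun s hs => ?_
        by_cases hsX : s ∈ M
        exacts [.inl ⟨hs, hsX⟩, .inr ⟨hs, hSN hs, hsX⟩]
      · exact h3 (Set.disjoint_left.2 fun x hx => (hleast _ m2 (Set.inter_eq_left.1 h5) hx).2)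
    · exact h1 (hleast _ hM (Set.inter_eq_left.1 h4))
  have hN : IsPrimeNode G N := by
    refine ⟨hstrong, hnt.mono hSN, ?_, ?_⟩
    · have := hne.to_subtype
      exact ⟨preconnected_induce_iff.2 (hS.connOn_of_least hNm hSN hleast)⟩
    · have := hne.to_subtype
      rw [induce_compl_graph]
      exact ⟨preconnected_induce_iff.2 (hS.compl_graph.connOn_of_least hNm.compl_graph hSN
        fun M hM hSM => hleast M (by simpa using hM.compl_graph) hSM)⟩
  refine ⟨N, hN, ?_⟩
  -- Different vertices of `S` lie in different children: a child sharing two vertices with `S`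
  -- would contain `S`, hence all of `N`.
  choose! c hc hvc using fun s (hs : s ∈ S) => exists_mem_mdChildren hN (hSN hs)
  refine Set.ncard_le_ncard_of_injOn c hc fun s hs s' hs' h => ?_
  have hC := ((mem_mdChildren_iff hN).1 (hc s hs)).1.prop
  rcases hS.2 _ (hC.1.isModuleIn_inter S) with h4 | h4
  · exact h4 ⟨hs, hvc s hs⟩ ⟨hs', h ▸ hvc s' hs'⟩
  · exact absurd (hleast _ hC.1 (Set.inter_eq_left.1 h4)) hC.2.not_subset

/-- The prime induced subgraphs of `G[A]` have at most `k` vertices. -/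
def PrimeWidthLE (G : SimpleGraph V) (A : Set V) (k : ℕ) : Prop :=
  ∀ S ⊆ A, IsPrimeSet G S → S.ncard ≤ k

/-- Prime vertices of the tree and prime induced subgraphs bound each other, so modular-width can be
read off from induced subgraphs, without the decomposition tree. -/
theorem modularWidth_le_iff [Finite V] {k : ℕ} :
    modularWidth G ≤ k ↔ PrimeWidthLE G Set.univ k := by
  have key : ∀ k, (∀ M, IsPrimeNode G M → (mdChildren G M).ncard ≤ k) ↔
      PrimeWidthLE G Set.univ k := by
    refine fun k => ⟨fun h S _ hS => ?_, fun h M hM => ?_⟩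
    · obtain ⟨N, hN, hle⟩ := exists_isPrimeNode_of_isPrimeSet hS
      exact hle.trans (h N hN)
    · obtain ⟨S, hS, hle⟩ := exists_isPrimeSet_of_isPrimeNode hM
      exact hle ▸ h S (Set.subset_univ S) hS
  have hne : {k | ∀ M, IsPrimeNode G M → (mdChildren G M).ncard ≤ k}.Nonempty :=
    ⟨(Set.univ : Set V).ncard, (key _).2 fun S hS _ => Set.ncard_le_ncard hS⟩
  refine ⟨fun h => (key k).1 fun M hM => (Nat.sInf_mem hne M hM).trans h, fun h => ?_⟩
  exact Nat.sInf_le ((key k).2 h)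

/-- Contraction of an inclusion-minimal nontrivial module `M` of `G[A]` to one of its vertices. -/
theorem primeWidthLE_contract [Finite V] {A M : Set V} {r : V} (hM : IsModuleIn G A M)
    (hmin : ∀ M', IsModuleIn G A M' → M' ⊆ M → M'.Nontrivial → M' = M) (hr : r ∈ M) (k : ℕ) :
    PrimeWidthLE G A k ↔ PrimeWidthLE G ((A \ M) ∪ {r}) k ∧ (3 ≤ M.ncard → M.ncard ≤ k) := by
  have htrans : ∀ M', IsModuleIn G M M' → IsModuleIn G A M' := fun M' h => by
    refine isModuleIn_iff.2 ⟨h.1.trans hM.1, fun v hv hvM' u hu u' hu' => ?_⟩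
    by_cases hvM : v ∈ M
    · exact (h.adj_iff hvM hvM' hu hu').1
    · exact (hM.adj_iff hv hvM (h.1 hu) (h.1 hu')).1
  constructor
  · intro h
    refine ⟨fun S hS => h S (hS.trans (Set.union_subset Set.sdiff_subset
      (Set.singleton_subset_iff.2 (hM.1 hr)))), fun h3 => h M hM.1 ⟨h3, fun M' hM' => ?_⟩⟩
    by_cases hs : M'.Subsingleton
    · exact .inl hs
    · exact .inr (hmin M' (htrans M' hM') hM'.1 (Set.not_subsingleton_iff.1 hs))
  · rintro ⟨h1, h2⟩ S hSA hS
    have hSM : IsModuleIn G S (S ∩ M) := isModuleIn_iff.2 ⟨Set.inter_subset_left,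
      fun v hv hv' u hu u' hu' => (hM.adj_iff (hSA hv) (fun h => hv' ⟨hv, h⟩) hu.2 hu'.2).1⟩
    rcases hS.2 _ hSM with h3 | h3
    · by_cases hne : (S ∩ M).Nonempty
      · obtain ⟨s, hs, hsM⟩ := hne
        classical
        -- Here `S` meets `M` in the single vertex `s`. Exchanging `s` for `r` gives an isomorphic
        -- induced subgraph, as both are seen alike from outside `M`.
        set f : V → V := fun x => if x = s then r else x with hf
        have hfs : f s = r := by simp [hf]
        have hfne : ∀ x, x ≠ s → f x = x := fun x hx => by simp [hf, hx]
        have hnM : ∀ x ∈ S, x ≠ s → x ∉ M := fun x hx hxs hxM =>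
          hxs (h3 ⟨hx, hxM⟩ ⟨hs, hsM⟩)
        have hinj : Set.InjOn f S := by
          intro x hx y hy hxy
          by_cases hxs : x = s <;> by_cases hys : y = s
          · rw [hxs, hys]
          · rw [hxs, hfs, hfne y hys] at hxy
            exact absurd (hxy ▸ hr) (hnM y hy hys)
          · rw [hys, hfs, hfne x hxs] at hxy
            exact absurd (hxy ▸ hr) (hnM x hx hxs)
          · rwa [hfne x hxs, hfne y hys] at hxy
        have hadj : ∀ x ∈ S, ∀ y ∈ S, (G.Adj (f x) (f y) ↔ G.Adj x y) := by
          intro x hx y hy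
          by_cases hxs : x = s <;> by_cases hys : y = s
          · rw [hxs, hys]; simp
          · rw [hxs, hfs, hfne y hys, G.adj_comm, G.adj_comm s]
            exact hM.adj_iff (hSA hy) (hnM y hy hys) hr hsM
          · rw [hys, hfs, hfne x hxs]
            exact hM.adj_iff (hSA hx) (hnM x hx hxs) hr hsM
          · rw [hfne x hxs, hfne y hys]
        have hcard : (f '' S).ncard = S.ncard := hinj.ncard_image
        rw [← hcard]
        refine h1 (f '' S) ?_ ⟨hcard ▸ hS.1, fun M' hM' => ?_⟩
        · rintro _ ⟨x, hx, rfl⟩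
          by_cases hxs : x = s
          · exact .inr (by simp [hxs, hfs])
          · rw [hfne x hxs]
            exact .inl ⟨hSA hx, hnM x hx hxs⟩
        · have hpre : IsModuleIn G S (S ∩ f ⁻¹' M') := by
            refine isModuleIn_iff.2 ⟨Set.inter_subset_left, fun v hv hv' u hu u' hu' => ?_⟩
            rw [← hadj v hv u hu.1, ← hadj v hv u' hu'.1]
            exact (hM'.adj_iff ⟨v, hv, rfl⟩ (fun h => hv' ⟨hv, h⟩) hu.2 hu'.2).1
          have himg : f '' (S ∩ f ⁻¹' M') = M' := by
            rw [Set.image_inter_preimage]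
            exact Set.inter_eq_right.2 hM'.1
          rcases hS.2 _ hpre with h4 | h4
          · exact .inl (himg ▸ h4.image f)
          · exact .inr (by rw [← himg, h4])
      · rw [Set.not_nonempty_iff_eq_empty, ← Set.disjoint_iff_inter_eq_empty] at hne
        exact h1 S (fun x hx => .inl ⟨hSA hx, Set.disjoint_left.1 hne hx⟩) hS
    · have hSM' : S ⊆ M := Set.inter_eq_left.1 h3
      have := Set.ncard_le_ncard hSM'
      have := hS.1
      have := h2 (by omega)
      omega

end ModularWidth


/-! ## Substitutions and types of partial solutions -/

section Types

variable {V ι : Type*} {G : SimpleGraph V} {Q : SimpleGraph ι} {B : ι → Set V} {Y : Set V}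

/-- `G` restricted to the disjoint sets `B i` arises from `Q` by substituting `G[B i]` for `i`. -/
structure IsSubstitution (G : SimpleGraph V) (Q : SimpleGraph ι) (B : ι → Set V) : Prop where
  disj : ∀ {i j v}, v ∈ B i → v ∈ B j → i = j
  adj : ∀ {i j}, i ≠ j → ∀ {u v}, u ∈ B i → v ∈ B j → (G.Adj u v ↔ Q.Adj i j)

/-- `Y` is independent. -/
def IndepOn (G : SimpleGraph V) (Y : Set V) : Prop := ∀ u ∈ Y, ∀ v ∈ Y, ¬ G.Adj u v

/-- `G[Y]` is bipartite. -/
def BipOn (G : SimpleGraph V) (Y : Set V) : Prop :=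
  ∃ c : V → Bool, ∀ u ∈ Y, ∀ v ∈ Y, G.Adj u v → c u ≠ c v

/-- `G[Y]` is a forest: each of its nonempty induced subgraphs has a vertex of degree at most `1`. -/
def ForestOn (G : SimpleGraph V) (Y : Set V) : Prop :=
  ∀ S ⊆ Y, S.Nonempty → ∃ v ∈ S, ∀ x ∈ S, ∀ y ∈ S, G.Adj v x → G.Adj v y → x = y

theorem IndepOn.mono {X : Set V} (h : IndepOn G Y) (hX : X ⊆ Y) : IndepOn G X :=
  fun u hu v hv => h u (hX hu) v (hX hv)

theorem indepOn_empty : IndepOn G ∅ := fun _ h => h.elim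

theorem connOn_empty : ConnOn G ∅ := fun _ _ _ h => h.mono (by simp) |>.ne_empty rfl |>.elim

namespace IsSubstitution

theorem indepOn_iff (h : IsSubstitution G Q B) (hY : Y ⊆ ⋃ i, B i) :
    IndepOn G Y ↔ (∀ i, IndepOn G (Y ∩ B i)) ∧
      ∀ i j, Q.Adj i j → Y ∩ B i = ∅ ∨ Y ∩ B j = ∅ := by
  constructor
  · refine fun hI => ⟨fun i => hI.mono Set.inter_subset_left, fun i j hij => ?_⟩
    by_contra! hne
    obtain ⟨⟨u, hu, hui⟩, v, hv, hvj⟩ := hne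
    exact hI u hu v hv ((h.adj hij.ne hui hvj).2 hij)
  · rintro ⟨h1, h2⟩ u hu v hv huv
    obtain ⟨i, hi⟩ := Set.mem_iUnion.1 (hY hu)
    obtain ⟨j, hj⟩ := Set.mem_iUnion.1 (hY hv)
    rcases eq_or_ne i j with rfl | hij
    · exact h1 i u ⟨hu, hi⟩ v ⟨hv, hj⟩ huv
    · rcases h2 i j ((h.adj hij hi hj).1 huv) with h3 | h3
      · exact h3.subset ⟨hu, hi⟩
      · exact h3.subset ⟨hv, hj⟩

/-- Stated for an abstract family `p` because independent sets carry different numbers `t` among the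
types of `octP` and of `fvsP`. -/
theorem indepOn_iff_exists (h : IsSubstitution G Q B) (hY : Y ⊆ ⋃ i, B i)
    {p : ι → Fin 5 → Prop} {t : Fin 5} (h0 : ∀ i, p i 0 ↔ Y ∩ B i = ∅)
    (h1 : ∀ i, p i t ↔ IndepOn G (Y ∩ B i)) :
    IndepOn G Y ↔ ∃ τ : ι → Fin 5, ((∀ i, τ i = 0 ∨ τ i = t) ∧
      ∀ i j, Q.Adj i j → τ i = 0 ∨ τ j = 0) ∧ ∀ i, p i (τ i) := by
  classical
  rw [h.indepOn_iff hY]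
  constructor
  · rintro ⟨h2, h3⟩
    refine ⟨fun i => if Y ∩ B i = ∅ then 0 else t, ⟨fun i => ?_, fun i j hij => ?_⟩, fun i => ?_⟩
    · by_cases hi : Y ∩ B i = ∅ <;> simp [hi]
    · rcases h3 i j hij with h4 | h4 <;> simp [h4]
    · by_cases hi : Y ∩ B i = ∅
      · simp [hi, h0]
      · simp [hi, h1, h2 i]
  · rintro ⟨τ, ⟨h2, h3⟩, h4⟩
    refine ⟨fun i => ?_, fun i j hij => ?_⟩
    · rcases h2 i with hi | hi
      · have := h4 i
        rw [hi, h0] at this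
        rw [this]
        exact indepOn_empty
      · have := h4 i
        rwa [hi, h1] at this
    · refine (h3 i j hij).imp (fun hi => ?_) (fun hi => ?_)
      · have := h4 i
        rwa [hi, h0] at this
      · have := h4 j
        rwa [hi, h0] at this

theorem eq_empty_iff (hY : Y ⊆ ⋃ i, B i) {p : ι → Fin 5 → Prop}
    (h0 : ∀ i, p i 0 ↔ Y ∩ B i = ∅) :
    Y = ∅ ↔ ∃ τ : ι → Fin 5, (∀ i, τ i = 0) ∧ ∀ i, p i (τ i) := by
  constructor
  · rintro rfl
    exact ⟨fun _ => 0, fun _ => rfl, fun i => by simp [h0]⟩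
  · rintro ⟨τ, h1, h2⟩
    refine Set.eq_empty_of_forall_notMem fun v hv => ?_
    obtain ⟨i, hi⟩ := Set.mem_iUnion.1 (hY hv)
    have := h2 i
    rw [h1, h0] at this
    exact this.subset ⟨hv, hi⟩

theorem ncard_eq_sum [Finite V] [Fintype ι] (h : IsSubstitution G Q B) (hY : Y ⊆ ⋃ i, B i) :
    Y.ncard = ∑ i, (Y ∩ B i).ncard := by
  classical
  have : Fintype V := Fintype.ofFinite V
  have h1 : Y.toFinset = Finset.univ.biUnion fun i => (Y ∩ B i).toFinset := by
    ext v
    simp only [Set.mem_toFinset, Finset.mem_biUnion, Finset.mem_univ, true_and, Set.mem_inter_iff]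
    refine ⟨fun hv => ?_, fun ⟨i, hi⟩ => hi.1⟩
    obtain ⟨i, hi⟩ := Set.mem_iUnion.1 (hY hv)
    exact ⟨i, hv, hi⟩
  rw [Set.ncard_eq_toFinset_card', h1, Finset.card_biUnion]
  · simp only [Set.ncard_eq_toFinset_card']
  · intro i _ j _ hij
    rw [Function.onFun, Finset.disjoint_left]
    intro v hv hv'
    simp only [Set.mem_toFinset] at hv hv'
    exact hij (h.disj hv.2 hv'.2)

end IsSubstitution

/-! ### Odd cycle transversals and vertex covers -/

/-- The types of the complement of an odd cycle transversal in a block. -/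
def octP (G : SimpleGraph V) (_B Y : Set V) : Fin 5 → Prop
  | 0 => Y = ∅
  | 1 => IndepOn G Y
  | 2 => IndepOn G Y
  | 3 => BipOn G Y
  | 4 => False

/-- The type of a union in terms of the types of its parts. -/
def octR (Q : SimpleGraph ι) (τ : ι → Fin 5) : Fin 5 → Prop
  | 0 => ∀ i, τ i = 0
  | 1 => (∀ i, τ i = 0 ∨ τ i = 1) ∧ ∀ i j, Q.Adj i j → τ i = 0 ∨ τ j = 0
  | 2 => (∀ i, τ i = 0 ∨ τ i = 1) ∧ ∀ i j, Q.Adj i j → τ i = 0 ∨ τ j = 0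
  | 3 => ∀ i j, Q.Adj i j → τ i = 0 ∨ τ j = 0 ∨ (τ i = 1 ∧ τ j = 2) ∨ (τ i = 2 ∧ τ j = 1)
  | 4 => False

/-- Types `1` and `2` impose the same condition on a block; they record which of the two colours the
block receives. Two adjacent nonempty blocks must be monochromatic with opposite colours, whereas a
block of type `3` has only empty neighbours and keeps a colouring of its own. Type `4` is never
attained and only pads the list to five. -/
theorem oct_decomp (h : IsSubstitution G Q B) (hY : Y ⊆ ⋃ i, B i) (j : Fin 5) :
    octP G (⋃ i, B i) Y j ↔ ∃ τ, octR Q τ j ∧ ∀ i, octP G (B i) (Y ∩ B i) (τ i) := by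
  classical
  match j with
  | 0 => exact IsSubstitution.eq_empty_iff hY fun i => Iff.rfl
  | 1 => exact h.indepOn_iff_exists hY (fun i => Iff.rfl) fun i => Iff.rfl
  | 2 => exact h.indepOn_iff_exists hY (fun i => Iff.rfl) fun i => Iff.rfl
  | 4 => simp [octP, octR]
  | 3 =>
    constructor
    · rintro ⟨c, hc⟩
      have hmono : ∀ i b, (∀ v ∈ Y ∩ B i, c v = b) → IndepOn G (Y ∩ B i) :=
        fun i b hb u hu v hv huv => hc u hu.1 v hv.1 huv ((hb u hu).trans (hb v hv).symm)
      refine ⟨fun i => if Y ∩ B i = ∅ then 0 else if ∀ v ∈ Y ∩ B i, c v = true then 1 else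
        if ∀ v ∈ Y ∩ B i, c v = false then 2 else 3, fun i j hij => ?_, fun i => ?_⟩
      · by_cases hi : Y ∩ B i = ∅
        · simp only [hi, if_true, true_or]
        by_cases hj : Y ∩ B j = ∅
        · simp only [hj, if_true, true_or, or_true]
        obtain ⟨u₀, hu₀⟩ := Set.nonempty_iff_ne_empty.2 hi
        obtain ⟨v₀, hv₀⟩ := Set.nonempty_iff_ne_empty.2 hj
        have hne : ∀ u ∈ Y ∩ B i, ∀ v ∈ Y ∩ B j, c u ≠ c v := fun u hu v hv =>
          hc u hu.1 v hv.1 ((h.adj hij.ne hu.2 hv.2).2 hij)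
        cases hb : c u₀
        · have hj1 : ∀ v ∈ Y ∩ B j, c v = true := fun v hv => by
            have := hne u₀ hu₀ v hv
            rw [hb] at this
            cases hv' : c v <;> simp_all
          have hi1 : ∀ u ∈ Y ∩ B i, c u = false := fun u hu => by
            have := hne u hu v₀ hv₀
            rw [hj1 v₀ hv₀] at this
            cases hv' : c u <;> simp_all
          have hi2 : ¬ ∀ u ∈ Y ∩ B i, c u = true := fun h' =>
            Bool.noConfusion ((hi1 u₀ hu₀).symm.trans (h' u₀ hu₀))
          right; right; right
          exact ⟨by beta_reduce; rw [if_neg hi, if_neg hi2, if_pos hi1], by beta_reduce; rw [if_neg hj, if_pos hj1]⟩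
        · have hj1 : ∀ v ∈ Y ∩ B j, c v = false := fun v hv => by
            have := hne u₀ hu₀ v hv
            rw [hb] at this
            cases hv' : c v <;> simp_all
          have hi1 : ∀ u ∈ Y ∩ B i, c u = true := fun u hu => by
            have := hne u hu v₀ hv₀
            rw [hj1 v₀ hv₀] at this
            cases hv' : c u <;> simp_all
          have hj2 : ¬ ∀ u ∈ Y ∩ B j, c u = true := fun h' =>
            Bool.noConfusion ((hj1 v₀ hv₀).symm.trans (h' v₀ hv₀))
          right; right; left
          exact ⟨by beta_reduce; rw [if_neg hi, if_pos hi1], by beta_reduce; rw [if_neg hj, if_neg hj2, if_pos hj1]⟩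
      · beta_reduce; split_ifs with h1 h2 h3
        · exact h1
        · exact hmono i _ h2
        · exact hmono i _ h3
        · exact ⟨c, fun u hu v hv => hc u hu.1 v hv.1⟩
    · rintro ⟨τ, hτ, hp⟩
      have hex : ∀ i, ∃ c : V → Bool, τ i = 3 → ∀ u ∈ Y ∩ B i, ∀ v ∈ Y ∩ B i,
          G.Adj u v → c u ≠ c v := fun i => by
        by_cases hi : τ i = 3
        · have := hp i
          rw [hi] at this
          obtain ⟨c, hc⟩ := this
          exact ⟨c, fun _ => hc⟩
        · exact ⟨fun _ => true, fun h => absurd h hi⟩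
      choose c hc using hex
      have hval : ∀ i v, v ∈ B i → ((∃ j, v ∈ B j ∧ (τ j = 1 ∨ (τ j = 3 ∧ c j v = true))) ↔
          (τ i = 1 ∨ (τ i = 3 ∧ c i v = true))) := fun i v hv => by
        refine ⟨fun ⟨j, hj, hj'⟩ => ?_, fun h' => ⟨i, hv, h'⟩⟩
        rwa [h.disj hv hj]
      -- The blocks of type `1` become `true`, those of type `2` become `false`, and those of type
      -- `3` use their own colouring.
      refine ⟨fun v => decide (∃ j, v ∈ B j ∧ (τ j = 1 ∨ (τ j = 3 ∧ c j v = true))), ?_⟩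
      intro u hu v hv huv
      obtain ⟨i, hi⟩ := Set.mem_iUnion.1 (hY hu)
      obtain ⟨j, hj⟩ := Set.mem_iUnion.1 (hY hv)
      rw [ne_eq, decide_eq_decide, hval i u hi, hval j v hj]
      rcases eq_or_ne i j with rfl | hij
      · have hpi := hp i
        generalize ht : τ i = t at hpi
        match t with
        | 0 => exact (hpi.subset ⟨hu, hi⟩).elim
        | 1 => exact (hpi u ⟨hu, hi⟩ v ⟨hv, hj⟩ huv).elim
        | 2 => exact (hpi u ⟨hu, hi⟩ v ⟨hv, hj⟩ huv).elim
        | 3 =>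
          have := hc i ht u ⟨hu, hi⟩ v ⟨hv, hj⟩ huv
          have h31 : ¬ ((3 : Fin 5) = 1) := by decide
          cases h1 : c i u <;> cases h2 : c i v <;> simp_all
        | 4 => exact hpi.elim
      · rcases hτ i j ((h.adj hij hi hj).1 huv) with h1 | h1 | ⟨h1, h2⟩ | ⟨h1, h2⟩
        · have := hp i
          rw [h1] at this
          exact (this.subset ⟨hu, hi⟩).elim
        · have := hp j
          rw [h1] at this
          exact (this.subset ⟨hv, hj⟩).elim
        · simp [h1, h2]
        · simp [h1, h2]

/-! ### Feedback vertex sets -/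

/-- The types of the complement of a feedback vertex set in a block. -/
def fvsP (G : SimpleGraph V) (_B Y : Set V) : Fin 5 → Prop
  | 0 => Y = ∅
  | 1 => Y.Subsingleton
  | 2 => IndepOn G Y
  | 3 => ForestOn G Y
  | 4 => False

/-- The type of a union in terms of the types of its parts. -/
def fvsR (Q : SimpleGraph ι) (τ : ι → Fin 5) : Fin 5 → Prop
  | 0 => ∀ i, τ i = 0
  | 1 => (∀ i, τ i = 0 ∨ τ i = 1) ∧ ∀ i j, τ i = 1 → τ j = 1 → i = j
  | 2 => (∀ i, τ i = 0 ∨ τ i = 2) ∧ ∀ i j, Q.Adj i j → τ i = 0 ∨ τ j = 0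
  | 3 => (∀ i j, Q.Adj i j → τ i ≠ 0 → τ j ≠ 0 → τ i ≠ 3 ∧ (τ i = 2 → τ j = 1)) ∧
      (∀ i j k, τ i = 2 → Q.Adj i j → Q.Adj i k → τ j ≠ 0 → τ k ≠ 0 → j = k) ∧
      ForestOn Q {i | τ i ≠ 0}
  | 4 => False

theorem ForestOn.not_triangle (h : ForestOn G Y) {a b c : V} (ha : a ∈ Y) (hb : b ∈ Y) (hc : c ∈ Y)
    (hab : G.Adj a b) (hac : G.Adj a c) (hbc : G.Adj b c) : False := by
  obtain ⟨v, hv, hv'⟩ := h {a, b, c} (by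
    rintro x (rfl | rfl | rfl) <;> assumption) ⟨a, by simp⟩
  rcases hv with rfl | rfl | rfl
  · exact hbc.ne (hv' b (by simp) c (by simp) hab hac)
  · exact hac.ne (hv' a (by simp) c (by simp) hab.symm hbc)
  · exact hab.ne (hv' a (by simp) b (by simp) hac.symm hbc.symm)

theorem ForestOn.not_square (h : ForestOn G Y) {a b c d : V} (ha : a ∈ Y) (hb : b ∈ Y)
    (hc : c ∈ Y) (hd : d ∈ Y) (hab : a ≠ b) (hcd : c ≠ d) (hac : G.Adj a c) (had : G.Adj a d)
    (hbc : G.Adj b c) (hbd : G.Adj b d) : False := by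
  obtain ⟨v, hv, hv'⟩ := h {a, b, c, d} (by
    rintro x (rfl | rfl | rfl | rfl) <;> assumption) ⟨a, by simp⟩
  rcases hv with rfl | rfl | rfl | rfl
  · exact hcd (hv' c (by simp) d (by simp) hac had)
  · exact hcd (hv' c (by simp) d (by simp) hbc hbd)
  · exact hab (hv' a (by simp) b (by simp) hac.symm hbc.symm)
  · exact hab (hv' a (by simp) b (by simp) had.symm hbd.symm)

/-- In a forest, an edge inside a block with a nonempty neighbour gives a triangle, and two vertices
in a block that see two further vertices outside give a square; excluding both yields the local
conditions on the types. Conversely a vertex of degree at most one is found in any nonempty `S`: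
inside a block of type `3`, which has no neighbours outside; otherwise in a block of type `2`, which
sees at most one vertex; otherwise `S` has at most one vertex per block and the forest `Q` provides
it. -/
theorem fvs_decomp (h : IsSubstitution G Q B) (hY : Y ⊆ ⋃ i, B i) (j : Fin 5) :
    fvsP G (⋃ i, B i) Y j ↔ ∃ τ, fvsR Q τ j ∧ ∀ i, fvsP G (B i) (Y ∩ B i) (τ i) := by
  classical
  match j with
  | 0 => exact IsSubstitution.eq_empty_iff hY fun i => Iff.rfl
  | 2 => exact h.indepOn_iff_exists hY (fun i => Iff.rfl) fun i => Iff.rfl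
  | 4 => simp [fvsP, fvsR]
  | 1 =>
    constructor
    · intro hs
      refine ⟨fun i => if Y ∩ B i = ∅ then 0 else 1, ⟨fun i => ?_, fun i j hi hj => ?_⟩, fun i => ?_⟩
      · beta_reduce; split_ifs <;> simp
      · have hi' : Y ∩ B i ≠ ∅ := fun h => by simp [h] at hi
        have hj' : Y ∩ B j ≠ ∅ := fun h => by simp [h] at hj
        obtain ⟨u, hu⟩ := Set.nonempty_iff_ne_empty.2 hi'
        obtain ⟨v, hv⟩ := Set.nonempty_iff_ne_empty.2 hj'
        exact h.disj hu.2 (hs hu.1 hv.1 ▸ hv.2)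
      · beta_reduce; split_ifs with h1
        · exact h1
        · exact hs.anti Set.inter_subset_left
    · rintro ⟨τ, ⟨h1, h2⟩, h3⟩ u hu v hv
      obtain ⟨i, hi⟩ := Set.mem_iUnion.1 (hY hu)
      obtain ⟨j, hj⟩ := Set.mem_iUnion.1 (hY hv)
      have key : ∀ i w, w ∈ Y → w ∈ B i → τ i = 1 := fun i w hw hi => by
        refine (h1 i).resolve_left fun h0 => ?_
        have := h3 i
        rw [h0] at this
        exact this.subset ⟨hw, hi⟩
      have hij := h2 i j (key i u hu hi) (key j v hv hj)
      subst hij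
      have := h3 i
      rw [key i u hu hi] at this
      exact this ⟨hu, hi⟩ ⟨hv, hj⟩
  | 3 =>
    constructor
    · intro hF
      have hF : ForestOn G Y := hF
      set τ : ι → Fin 5 := fun i => if Y ∩ B i = ∅ then 0 else if (Y ∩ B i).Subsingleton then 1 else
        if IndepOn G (Y ∩ B i) then 2 else 3 with hτ
      have t0 : ∀ i, τ i ≠ 0 → (Y ∩ B i).Nonempty := fun i hi => by
        by_contra h0
        rw [Set.not_nonempty_iff_eq_empty] at h0
        simp [hτ, h0] at hi
      have t1 : ∀ i, τ i ≠ 0 → τ i ≠ 1 → (Y ∩ B i).Nontrivial := fun i hi hi' => by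
        by_contra h0
        rw [Set.not_nontrivial_iff] at h0
        have := (t0 i hi).ne_empty
        simp [hτ, h0, this] at hi'
      have t3 : ∀ i, τ i = 3 → ¬ IndepOn G (Y ∩ B i) := fun i hi h0 => by
        simp only [hτ, h0, if_true] at hi
        split_ifs at hi <;> exact absurd hi (by decide)
      refine ⟨τ, ⟨fun i j hij hi hj => ⟨fun hi3 => ?_, fun hi2 => ?_⟩, fun i j k hi hij hik hj hk => ?_,
        fun S hS hSne => ?_⟩, fun i => ?_⟩
      · have := t3 i hi3
        simp only [IndepOn, not_forall, not_not] at this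
        obtain ⟨u, hu, v, hv, huv⟩ := this
        obtain ⟨w, hw⟩ := t0 j hj
        exact hF.not_triangle hu.1 hv.1 hw.1 huv ((h.adj hij.ne hu.2 hw.2).2 hij)
          ((h.adj hij.ne hv.2 hw.2).2 hij)
      · by_contra hj1
        obtain ⟨c, hc, d, hd, hcd⟩ := t1 j hj hj1
        obtain ⟨a, ha, b, hb, hab⟩ := t1 i hi (by rw [hi2]; decide)
        exact hF.not_square ha.1 hb.1 hc.1 hd.1 hab hcd ((h.adj hij.ne ha.2 hc.2).2 hij)
          ((h.adj hij.ne ha.2 hd.2).2 hij) ((h.adj hij.ne hb.2 hc.2).2 hij)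
          ((h.adj hij.ne hb.2 hd.2).2 hij)
      · by_contra hjk
        obtain ⟨a, ha, b, hb, hab⟩ := t1 i (by rw [hi]; decide) (by rw [hi]; decide)
        obtain ⟨c, hc⟩ := t0 j hj
        obtain ⟨d, hd⟩ := t0 k hk
        have hcd : c ≠ d := fun h' => hjk (h.disj hc.2 (h' ▸ hd.2))
        exact hF.not_square ha.1 hb.1 hc.1 hd.1 hab hcd ((h.adj hij.ne ha.2 hc.2).2 hij)
          ((h.adj hik.ne ha.2 hd.2).2 hik) ((h.adj hij.ne hb.2 hc.2).2 hij)
          ((h.adj hik.ne hb.2 hd.2).2 hik)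
      -- One representative from each nonempty block induces a copy of the corresponding part of
      -- `Q`.
      · choose r hr using fun i : {i // τ i ≠ 0} => t0 i.1 i.2
        obtain ⟨i₀, hi₀⟩ := hSne
        obtain ⟨v, ⟨i, hi, rfl⟩, hv⟩ := hF (r '' {i | i.1 ∈ S})
          (by rintro _ ⟨i, -, rfl⟩; exact (hr i).1) ⟨_, ⟨i₀, hS hi₀⟩, hi₀, rfl⟩
        refine ⟨i.1, hi, fun j hj k hk hij hik => ?_⟩
        have := hv (r ⟨j, hS hj⟩) ⟨_, hj, rfl⟩ (r ⟨k, hS hk⟩) ⟨_, hk, rfl⟩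
          ((h.adj hij.ne (hr _).2 (hr ⟨j, hS hj⟩).2).2 hij)
          ((h.adj hik.ne (hr _).2 (hr ⟨k, hS hk⟩).2).2 hik)
        exact h.disj (hr ⟨j, hS hj⟩).2 (this ▸ (hr ⟨k, hS hk⟩).2)
      · simp only [hτ]
        split_ifs with h1 h2 h3
        · exact h1
        · exact h2
        · exact h3
        · exact fun S hS => hF S (hS.trans Set.inter_subset_left)
    · rintro ⟨τ, ⟨h1, h2, h3⟩, h4⟩ S hS hSne
      have t0 : ∀ i v, v ∈ S → v ∈ B i → τ i ≠ 0 := fun i v hv hi h0 => by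
        have := h4 i
        rw [h0] at this
        exact this.subset ⟨hS hv, hi⟩
      by_cases c3 : ∃ i v, v ∈ S ∧ v ∈ B i ∧ τ i = 3
      · obtain ⟨i, v, hv, hi, ht⟩ := c3
        have hF := h4 i
        rw [ht] at hF
        obtain ⟨w, hw, hw'⟩ := hF (S ∩ B i) (Set.inter_subset_inter_left _ hS) ⟨v, hv, hi⟩
        have key : ∀ x ∈ S, G.Adj w x → x ∈ B i := fun x hx hwx => by
          obtain ⟨j, hj⟩ := Set.mem_iUnion.1 (hY (hS hx))
          rcases eq_or_ne i j with rfl | hij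
          · exact hj
          · exact absurd ht (h1 i j ((h.adj hij hw.2 hj).1 hwx) (t0 i w hw.1 hw.2)
              (t0 j x hx hj)).1
        exact ⟨w, hw.1, fun x hx y hy hwx hwy => hw' x ⟨hx, key x hx hwx⟩ y ⟨hy, key y hy hwy⟩
          hwx hwy⟩
      have sub1 : ∀ j, τ j = 1 → ∀ x ∈ S, ∀ y ∈ S, x ∈ B j → y ∈ B j → x = y :=
        fun j hj x hx y hy hxj hyj => by
          have := h4 j
          rw [hj] at this
          exact this ⟨hS hx, hxj⟩ ⟨hS hy, hyj⟩
      by_cases c2 : ∃ i v, v ∈ S ∧ v ∈ B i ∧ τ i = 2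
      · obtain ⟨i, v, hv, hi, ht⟩ := c2
        have hI := h4 i
        rw [ht] at hI
        have key : ∀ x ∈ S, G.Adj v x → ∃ j, x ∈ B j ∧ Q.Adj i j := fun x hx hvx => by
          obtain ⟨j, hj⟩ := Set.mem_iUnion.1 (hY (hS hx))
          rcases eq_or_ne i j with rfl | hij
          · exact (hI v ⟨hS hv, hi⟩ x ⟨hS hx, hj⟩ hvx).elim
          · exact ⟨j, hj, (h.adj hij hi hj).1 hvx⟩
        refine ⟨v, hv, fun x hx y hy hvx hvy => ?_⟩
        obtain ⟨j, hj, hij⟩ := key x hx hvx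
        obtain ⟨k, hk, hik⟩ := key y hy hvy
        have hjk := h2 i j k ht hij hik (t0 j x hx hj) (t0 k y hy hk)
        subst hjk
        exact sub1 j ((h1 i j hij (t0 i v hv hi) (t0 j x hx hj)).2 ht) x hx y hy hj hk
      · have all1 : ∀ i v, v ∈ S → v ∈ B i → τ i = 1 := fun i v hv hi => by
          have a0 := t0 i v hv hi
          have a2 : τ i ≠ 2 := fun h => c2 ⟨i, v, hv, hi, h⟩
          have a3 : τ i ≠ 3 := fun h => c3 ⟨i, v, hv, hi, h⟩
          have a4 : τ i ≠ 4 := fun h => by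
            have := h4 i
            rw [h] at this
            exact this
          generalize τ i = t at a0 a2 a3 a4
          revert a0 a2 a3 a4
          revert t
          decide
        obtain ⟨v₀, hv₀⟩ := hSne
        obtain ⟨i₀, hi₀⟩ := Set.mem_iUnion.1 (hY (hS hv₀))
        obtain ⟨i, ⟨v, hv, hi⟩, hi'⟩ := h3 {i | ∃ v ∈ S, v ∈ B i}
          (fun i ⟨v, hv, hi⟩ => t0 i v hv hi) ⟨i₀, v₀, hv₀, hi₀⟩
        have key : ∀ x ∈ S, G.Adj v x → ∃ j, x ∈ B j ∧ Q.Adj i j := fun x hx hvx => by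
          obtain ⟨j, hj⟩ := Set.mem_iUnion.1 (hY (hS hx))
          rcases eq_or_ne i j with rfl | hij
          · exact (hvx.ne (sub1 i (all1 i v hv hi) v hv x hx hi hj)).elim
          · exact ⟨j, hj, (h.adj hij hi hj).1 hvx⟩
        refine ⟨v, hv, fun x hx y hy hvx hvy => ?_⟩
        obtain ⟨j, hj, hij⟩ := key x hx hvx
        obtain ⟨k, hk, hik⟩ := key y hy hvy
        have hjk := hi' j ⟨x, hx, hj⟩ k ⟨y, hy, hk⟩ hij hik
        subst hjk
        exact sub1 j (all1 j x hx hj) x hx y hy hj hk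

/-! ### Connected vertex covers -/

/-- With two nonempty parts, the edges inside a part are irrelevant: a cut that splits a part is
crossed via any vertex of an adjacent nonempty part, and a cut that splits none is a cut of `Q`. -/
theorem IsSubstitution.connOn_iff (h : IsSubstitution G Q B) {X : ι → Set V} (hX : ∀ i, X i ⊆ B i)
    {i₀ i₁ : ι} (h01 : i₀ ≠ i₁) (h0 : (X i₀).Nonempty) (h1 : (X i₁).Nonempty) :
    ConnOn G (⋃ i, X i) ↔ ConnOn Q {i | (X i).Nonempty} := by
  constructor
  · rintro hG S hS ⟨a, ha⟩ ⟨b, hb, hbS⟩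
    obtain ⟨u, hu⟩ := hS ha
    obtain ⟨v, hv⟩ := hb
    obtain ⟨x, hx, y, hy, hxy⟩ := hG (⋃ i ∈ S, X i)
      (Set.iUnion₂_subset fun i _ => Set.subset_iUnion X i) ⟨u, Set.mem_biUnion ha hu⟩
      ⟨v, Set.mem_iUnion.2 ⟨b, hv⟩, fun hv' => by
        obtain ⟨c, hc, hvc⟩ := Set.mem_iUnion₂.1 hv'
        exact hbS (h.disj (hX _ hvc) (hX _ hv) ▸ hc)⟩
    obtain ⟨i, hi, hxi⟩ := Set.mem_iUnion₂.1 hx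
    obtain ⟨j, hyj⟩ := Set.mem_iUnion.1 hy.1
    have hj : j ∉ S := fun hj => hy.2 (Set.mem_biUnion hj hyj)
    have hij : i ≠ j := fun hij => hj (hij ▸ hi)
    exact ⟨i, hi, j, ⟨⟨y, hyj⟩, hj⟩, (h.adj hij (hX _ hxi) (hX _ hyj)).1 hxy⟩
  · rintro hQ S hS ⟨a, ha⟩ ⟨b, hb, hbS⟩
    by_cases hsplit : ∃ i, (X i ∩ S).Nonempty ∧ (X i \ S).Nonempty
    · obtain ⟨i, ⟨u, hu, huS⟩, v, hv, hvS⟩ := hsplit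
      have : ∃ j ∈ {i | (X i).Nonempty} \ {i}, Q.Adj i j := by
        obtain ⟨i', hi', j, hj, hij⟩ := hQ {i} (by rintro _ rfl; exact ⟨u, hu⟩) ⟨i, rfl⟩ (by
          rcases eq_or_ne i i₀ with rfl | hi
          · exact ⟨i₁, h1, h01.symm⟩
          · exact ⟨i₀, h0, hi.symm⟩)
        rw [Set.mem_singleton_iff] at hi'
        exact ⟨j, hj, hi' ▸ hij⟩
      obtain ⟨j, ⟨⟨w, hw⟩, -⟩, hij⟩ := this
      have huw := (h.adj hij.ne (hX _ hu) (hX _ hw)).2 hij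
      have hvw := (h.adj hij.ne (hX _ hv) (hX _ hw)).2 hij
      by_cases hwS : w ∈ S
      · exact ⟨w, hwS, v, ⟨Set.mem_iUnion.2 ⟨i, hv⟩, hvS⟩, hvw.symm⟩
      · exact ⟨u, huS, w, ⟨Set.mem_iUnion.2 ⟨j, hw⟩, hwS⟩, huw⟩
    · push Not at hsplit
      obtain ⟨i, hi⟩ := Set.mem_iUnion.1 (hS ha)
      obtain ⟨j, hj⟩ := Set.mem_iUnion.1 hb
      obtain ⟨k, ⟨u, hu, huS⟩, l, ⟨⟨v, hv⟩, hl⟩, hkl⟩ := hQ {i | (X i ∩ S).Nonempty}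
        (fun i hi => hi.mono Set.inter_subset_left) ⟨i, a, hi, ha⟩
        ⟨j, ⟨b, hj⟩, fun hj' => (hsplit j hj').subset ⟨hj, hbS⟩⟩
      exact ⟨u, huS, v, ⟨Set.mem_iUnion.2 ⟨l, hv⟩, fun hvS => hl ⟨v, hv, hvS⟩⟩,
        (h.adj hkl.ne (hX _ hu) (hX _ hv)).2 hkl⟩

/-- The types of the complement of a connected vertex cover in a block. -/
def cvcP (G : SimpleGraph V) (B Y : Set V) : Fin 5 → Prop
  | 0 => Y = ∅
  | 1 => IndepOn G Y ∧ Y ≠ B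
  | 2 => IndepOn G Y ∧ Y = B
  | 3 => Y = ∅ ∧ ConnOn G B
  | 4 => IndepOn G Y ∧ ConnOn G (B \ Y)

/-- The type of a union in terms of the types of its parts. -/
def cvcR (Q : SimpleGraph ι) (τ : ι → Fin 5) : Fin 5 → Prop
  | 0 => ∀ i, τ i = 0
  | 1 => (∀ i, τ i = 0 ∨ τ i = 1 ∨ τ i = 2) ∧ (∀ i j, Q.Adj i j → τ i = 0 ∨ τ j = 0) ∧
      ∃ i, τ i ≠ 2
  | 2 => (∀ i, τ i = 2) ∧ ∀ i j, ¬ Q.Adj i j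
  | 3 => (∀ i, τ i = 0) ∧ ConnOn Q Set.univ
  | 4 => ((∀ i, τ i = 0 ∨ τ i = 1 ∨ τ i = 2) ∧ (∀ i j, Q.Adj i j → τ i = 0 ∨ τ j = 0) ∧
        (∃ i j, i ≠ j ∧ τ i ≠ 2 ∧ τ j ≠ 2) ∧ ConnOn Q {i | τ i ≠ 2}) ∨
      ∃ i, (∀ j, j ≠ i → τ j = 2) ∧ (∀ j k, j ≠ i → k ≠ i → ¬ Q.Adj j k) ∧
        (τ i = 3 ∨ (τ i = 4 ∧ ∀ j, ¬ Q.Adj i j))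

/-- The types `0`, `1`, `2` of the parts of an independent set. -/
theorem IsSubstitution.exists_type (h : IsSubstitution G Q B) (hne : ∀ i, (B i).Nonempty)
    (hY : Y ⊆ ⋃ i, B i) (hI : IndepOn G Y) :
    ∃ τ : ι → Fin 5, (∀ i, τ i = 0 ∨ τ i = 1 ∨ τ i = 2) ∧
      (∀ i j, Q.Adj i j → τ i = 0 ∨ τ j = 0) ∧ (∀ i, cvcP G (B i) (Y ∩ B i) (τ i)) ∧
      ∀ i, τ i = 2 ↔ Y ∩ B i = B i := by
  classical
  obtain ⟨h1, h2⟩ := (h.indepOn_iff hY).1 hI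
  refine ⟨fun i => if Y ∩ B i = ∅ then 0 else if Y ∩ B i = B i then 2 else 1, fun i => ?_,
    fun i j hij => ?_, fun i => ?_, fun i => ?_⟩
  · beta_reduce; split_ifs <;> simp
  · rcases h2 i j hij with h | h <;> simp [h]
  · beta_reduce; split_ifs with h3 h4
    · exact h3
    · exact ⟨h1 i, h4⟩
    · exact ⟨h1 i, h4⟩
  · beta_reduce; split_ifs with h3 h4
    · simp [h3, (hne i).ne_empty.symm]
    · simp [h4]
    · simp [h4]

theorem IsSubstitution.indepOn_of_type (h : IsSubstitution G Q B) (hY : Y ⊆ ⋃ i, B i)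
    {τ : ι → Fin 5} (h1 : ∀ i, τ i = 0 ∨ τ i = 1 ∨ τ i = 2)
    (h2 : ∀ i j, Q.Adj i j → τ i = 0 ∨ τ j = 0) (h3 : ∀ i, cvcP G (B i) (Y ∩ B i) (τ i)) :
    IndepOn G Y := by
  have h0 : ∀ i, τ i = 0 → Y ∩ B i = ∅ := fun i hi => by
    have := h3 i
    rwa [hi] at this
  refine (h.indepOn_iff hY).2 ⟨fun i => ?_, fun i j hij => (h2 i j hij).imp (h0 i) (h0 j)⟩
  rcases h1 i with hi | hi | hi
  · rw [h0 i hi]; exact indepOn_empty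
  · have := h3 i
    rw [hi] at this
    exact this.1
  · have := h3 i
    rw [hi] at this
    exact this.1

theorem type_eq_two_iff {G : SimpleGraph V} {C Z : Set V} (hne : C.Nonempty) {t : Fin 5}
    (ht : t = 0 ∨ t = 1 ∨ t = 2) (hp : cvcP G C Z t) : t = 2 ↔ Z = C := by
  rcases ht with rfl | rfl | rfl
  · have : Z = ∅ := hp
    simp [this, hne.ne_empty.symm]
  · simp [hp.2]
  · simp [hp.2]

theorem IsSubstitution.iUnion_diff (Y : Set V) : (⋃ i, B i) \ Y = ⋃ i, (B i \ (Y ∩ B i)) := by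
  ext v
  simp only [Set.mem_sdiff, Set.mem_iUnion, Set.mem_inter_iff]
  constructor
  · rintro ⟨⟨i, hi⟩, hv⟩
    exact ⟨i, hi, fun h => hv h.1⟩
  · rintro ⟨i, hi, hv⟩
    exact ⟨⟨i, hi⟩, fun h => hv ⟨h, hi⟩⟩

theorem nonempty_diff_iff {C Z : Set V} (h : Z ⊆ C) : (C \ Z).Nonempty ↔ Z ≠ C := by
  rw [Set.sdiff_nonempty]
  exact ⟨fun h1 h2 => h1 h2.ge, fun h1 h2 => h1 (h.antisymm h2)⟩

/-- If the cover `B \ Y` meets two blocks, its connectedness is decided in `Q`. Otherwise it lies in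
one block `i`, the others being contained in `Y`. If `i` has a neighbour in `Q`, independence forces
`Y` to avoid `B i`, so the whole block must be connected (type `3`); if not, the part in `B i` must
itself be a solution (type `4`). -/
theorem cvc_decomp_four [Nonempty ι] (h : IsSubstitution G Q B) (hne : ∀ i, (B i).Nonempty)
    (hY : Y ⊆ ⋃ i, B i) :
    cvcP G (⋃ i, B i) Y 4 ↔ ∃ τ, cvcR Q τ 4 ∧ ∀ i, cvcP G (B i) (Y ∩ B i) (τ i) := by
  classical
  have hsub : ∀ i, B i \ (Y ∩ B i) ⊆ B i := fun i => Set.sdiff_subset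
  constructor
  · rintro ⟨hI, hC⟩
    obtain ⟨τ, t1, t2, t3, t4⟩ := h.exists_type hne hY hI
    obtain ⟨hi1, hi2⟩ := (h.indepOn_iff hY).1 hI
    by_cases h2 : ∃ i j, i ≠ j ∧ τ i ≠ 2 ∧ τ j ≠ 2
    · obtain ⟨i, j, hij, hi, hj⟩ := h2
      refine ⟨τ, .inl ⟨t1, t2, ⟨i, j, hij, hi, hj⟩, ?_⟩, t3⟩
      rw [ne_eq, t4] at hi hj
      rw [IsSubstitution.iUnion_diff, h.connOn_iff hsub hij
        ((nonempty_diff_iff Set.inter_subset_right).2 hi)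
        ((nonempty_diff_iff Set.inter_subset_right).2 hj)] at hC
      simpa only [nonempty_diff_iff Set.inter_subset_right, ne_eq, t4] using hC
    · push Not at h2
      obtain ⟨i, hi⟩ : ∃ i, ∀ j, j ≠ i → τ j = 2 := by
        by_cases h3 : ∃ i, τ i ≠ 2
        · obtain ⟨i, hi⟩ := h3
          exact ⟨i, fun j hj => h2 i j hj.symm hi⟩
        · push Not at h3
          exact ⟨Classical.arbitrary ι, fun j _ => h3 j⟩
      have hfull : ∀ j, j ≠ i → (Y ∩ B j).Nonempty := fun j hj => by
        rw [(t4 j).1 (hi j hj)]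
        exact hne j
      have hadj : ∀ j k, j ≠ i → k ≠ i → ¬ Q.Adj j k := fun j k hj hk hjk => by
        rcases hi2 j k hjk with h3 | h3
        · exact (hfull j hj).ne_empty h3
        · exact (hfull k hk).ne_empty h3
      have hCi : ConnOn G (B i \ (Y ∩ B i)) := by
        have : (⋃ i, B i) \ Y = B i \ (Y ∩ B i) := by
          rw [IsSubstitution.iUnion_diff]
          refine Set.Subset.antisymm (Set.iUnion_subset fun j => ?_)
            (Set.subset_iUnion (fun i => B i \ (Y ∩ B i)) i)
          rcases eq_or_ne j i with rfl | hj
          · exact subset_rfl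
          · rw [(t4 j).1 (hi j hj)]; simp
        rwa [this] at hC
      -- The types of `exists_type` do not record connectedness, so the type of the single block
      -- that the cover may meet is upgraded to `3` or `4`.
      refine ⟨Function.update τ i (if ∃ j, Q.Adj i j then 3 else 4), .inr ⟨i, fun j hj => ?_, hadj, ?_⟩,
        fun j => ?_⟩
      · rw [Function.update_of_ne hj, hi j hj]
      · by_cases h3 : ∃ j, Q.Adj i j
        · simp [h3]
        · simp only [h3, if_false, Function.update_self]
          push Not at h3
          exact .inr ⟨trivial, h3⟩
      · rcases eq_or_ne j i with rfl | hj
        · rw [Function.update_self]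
          split_ifs with h3
          · obtain ⟨k, hk⟩ := h3
            have : Y ∩ B j = ∅ := (hi2 j k hk).resolve_right (hfull k hk.ne.symm).ne_empty
            refine ⟨this, ?_⟩
            simpa [this] using hCi
          · exact ⟨hi1 j, hCi⟩
        · rw [Function.update_of_ne hj]
          exact t3 j
  · rintro ⟨τ, ⟨t1, t2, ⟨i, j, hij, hi, hj⟩, t4⟩ | ⟨i, h1, h2, h3⟩, t3⟩
    · refine ⟨h.indepOn_of_type hY t1 t2 t3, ?_⟩
      have t5 : ∀ i, τ i = 2 ↔ Y ∩ B i = B i := fun i => type_eq_two_iff (hne i) (t1 i) (t3 i)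
      rw [ne_eq, t5] at hi hj
      rw [IsSubstitution.iUnion_diff, h.connOn_iff hsub hij
        ((nonempty_diff_iff Set.inter_subset_right).2 hi)
        ((nonempty_diff_iff Set.inter_subset_right).2 hj)]
      simpa only [nonempty_diff_iff Set.inter_subset_right, ne_eq, t5] using t4
    · have hfull : ∀ j, j ≠ i → IndepOn G (Y ∩ B j) ∧ Y ∩ B j = B j := fun j hj => by
        have := t3 j
        rwa [h1 j hj] at this
      have hCi : ConnOn G (B i \ (Y ∩ B i)) ∧ IndepOn G (Y ∩ B i) := by
        have := t3 i
        rcases h3 with h3 | ⟨h3, -⟩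
        · rw [h3] at this
          obtain ⟨h4, h5⟩ := this
          rw [h4]
          exact ⟨by simpa using h5, indepOn_empty⟩
        · rw [h3] at this
          exact ⟨this.2, this.1⟩
      have hiempty : ∀ j, Q.Adj i j → Y ∩ B i = ∅ := fun j hj => by
        have := t3 i
        rcases h3 with h3 | ⟨h3, h4⟩
        · rw [h3] at this
          exact this.1
        · exact absurd hj (h4 j)
      refine ⟨(h.indepOn_iff hY).2 ⟨fun j => ?_, fun j k hjk => ?_⟩, ?_⟩
      · rcases eq_or_ne j i with rfl | hj
        exacts [hCi.2, (hfull j hj).1]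
      · rcases eq_or_ne j i with rfl | hj
        · exact .inl (hiempty k hjk)
        · rcases eq_or_ne k i with rfl | hk
          · exact .inr (hiempty j hjk.symm)
          · exact absurd hjk (h2 j k hj hk)
      · have : (⋃ i, B i) \ Y = B i \ (Y ∩ B i) := by
          rw [IsSubstitution.iUnion_diff]
          refine Set.Subset.antisymm (Set.iUnion_subset fun j => ?_)
            (Set.subset_iUnion (fun i => B i \ (Y ∩ B i)) i)
          rcases eq_or_ne j i with rfl | hj
          · exact subset_rfl
          · rw [(hfull j hj).2]; simp
        rw [this]
        exact hCi.1

/-- At least two blocks are needed for type `3`, where connectedness of the union has to be decided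
by `Q` alone. -/
theorem cvc_decomp [Nontrivial ι] (h : IsSubstitution G Q B) (hne : ∀ i, (B i).Nonempty)
    (hY : Y ⊆ ⋃ i, B i) (j : Fin 5) :
    cvcP G (⋃ i, B i) Y j ↔ ∃ τ, cvcR Q τ j ∧ ∀ i, cvcP G (B i) (Y ∩ B i) (τ i) := by
  classical
  have hfull : (∀ i, Y ∩ B i = B i) ↔ Y = ⋃ i, B i := by
    refine ⟨fun h1 => hY.antisymm (Set.iUnion_subset fun i => Set.inter_eq_right.1 (h1 i)), ?_⟩
    rintro h1 i
    rw [Set.inter_eq_right, h1]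
    exact Set.subset_iUnion B i
  match j with
  | 0 => exact IsSubstitution.eq_empty_iff hY fun i => Iff.rfl
  | 1 =>
    constructor
    · rintro ⟨hI, hB⟩
      obtain ⟨τ, t1, t2, t3, t4⟩ := h.exists_type hne hY hI
      refine ⟨τ, ⟨t1, t2, ?_⟩, t3⟩
      by_contra! h'
      exact hB (hfull.1 fun i => (t4 i).1 (h' i))
    · rintro ⟨τ, ⟨t1, t2, i, hi⟩, t3⟩
      refine ⟨h.indepOn_of_type hY t1 t2 t3, fun hB => hi ?_⟩
      exact (type_eq_two_iff (hne i) (t1 i) (t3 i)).2 (hfull.2 hB i)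
  | 2 =>
    constructor
    · rintro ⟨hI, hB⟩
      obtain ⟨h1, h2⟩ := (h.indepOn_iff hY).1 hI
      refine ⟨fun _ => 2, ⟨fun _ => rfl, fun i j hij => ?_⟩, fun i => ⟨h1 i, hfull.2 hB i⟩⟩
      have := h2 i j hij
      rw [hfull.2 hB, hfull.2 hB] at this
      exact this.elim (hne i).ne_empty (hne j).ne_empty
    · rintro ⟨τ, ⟨h1, h2⟩, h3⟩
      refine ⟨h.indepOn_of_type hY (fun i => .inr (.inr (h1 i)))
        (fun i j hij => absurd hij (h2 i j)) h3, hfull.1 fun i => ?_⟩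
      have := h3 i
      rw [h1 i] at this
      exact this.2
  | 3 =>
    obtain ⟨i, j, hij⟩ := exists_pair_ne ι
    have key := h.connOn_iff (fun i => subset_rfl) hij (hne i) (hne j)
    have huniv : {i | (B i).Nonempty} = Set.univ := Set.eq_univ_of_forall hne
    rw [huniv] at key
    constructor
    · rintro ⟨rfl, hC⟩
      exact ⟨fun _ => 0, ⟨fun _ => rfl, key.1 hC⟩, fun i => Set.empty_inter _⟩
    · rintro ⟨τ, ⟨h1, h2⟩, h3⟩
      exact ⟨(IsSubstitution.eq_empty_iff (p := fun i => cvcP G (B i) (Y ∩ B i)) hY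
        fun i => Iff.rfl).2 ⟨τ, h1, h3⟩, key.2 h2⟩
  | 4 => exact cvc_decomp_four h hne hY

end Types


/-! ## Replacing modules -/

section Replace

variable {V V' : Type*} {G : SimpleGraph V} {G' : SimpleGraph V'}

theorem isVertexCover_iff {X : Set V} : G.IsVertexCover X ↔ IndepOn G Xᶜ := by
  constructor
  · intro h u hu v hv huv
    exact (h huv).elim hu hv
  · intro h u v huv
    by_contra! h'
    exact h u h'.1 v h'.2 huv

theorem isOddCycleTransversal_iff {X : Set V} : IsOddCycleTransversal G X ↔ BipOn G Xᶜ := by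
  classical
  constructor
  · rintro ⟨c⟩
    refine ⟨fun v => if h : v ∈ Xᶜ then decide (c ⟨v, h⟩ = 0) else false, fun u hu v hv huv h => ?_⟩
    beta_reduce at h
    rw [dif_pos hu, dif_pos hv, decide_eq_decide] at h
    have hadj : (G.induce Xᶜ).Adj ⟨u, hu⟩ ⟨v, hv⟩ := huv
    have := c.valid hadj
    omega
  · rintro ⟨c, hc⟩
    refine ⟨SimpleGraph.Coloring.mk (fun v => if c v then (0 : Fin 2) else 1) fun {u v} huv => ?_⟩
    have := hc u u.2 v v.2 huv
    cases h1 : c u <;> cases h2 : c v <;> simp_all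

theorem SimpleGraph.IsAcyclic.exists_adj_subsingleton [Finite V] [Nonempty V] (h : G.IsAcyclic) :
    ∃ v, ∀ x y, G.Adj v x → G.Adj v y → x = y := by
  classical
  have : Fintype V := Fintype.ofFinite V
  obtain ⟨u⟩ := ‹Nonempty V›
  set c := G.connectedComponentMk u
  have ht := h.isTree_connectedComponent c
  have hmem : ∀ v x, v ∈ c → G.Adj v x → x ∈ c := fun v x hv hx => by
    change G.connectedComponentMk v = c at hv
    show G.connectedComponentMk x = c
    rw [← hv]
    exact (SimpleGraph.ConnectedComponent.eq.2 hx.reachable).symm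
  by_cases hn : Nontrivial c
  · obtain ⟨v, hv⟩ := ht.exists_vert_degree_one_of_nontrivial
    refine ⟨v, fun x y hx hy => ?_⟩
    rw [SimpleGraph.degree_eq_one_iff_existsUnique_adj] at hv
    have hx' := hmem v x v.2 hx
    have hy' := hmem v y v.2 hy
    have := hv.unique (y₁ := ⟨x, hx'⟩) (y₂ := ⟨y, hy'⟩) hx hy
    exact congrArg Subtype.val this
  · rw [not_nontrivial_iff_subsingleton] at hn
    refine ⟨u, fun x y hx hy => ?_⟩
    have hu : u ∈ c := rfl
    have := congrArg Subtype.val (Subsingleton.elim (⟨u, hu⟩ : c) ⟨x, hmem u x hu hx⟩)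
    exact absurd this hx.ne

/-- A finite nonempty forest has a vertex of degree at most one, and on a cycle every vertex has two
distinct neighbours, its successor and its predecessor. -/
theorem isAcyclic_induce_iff [Finite V] {Y : Set V} : (G.induce Y).IsAcyclic ↔ ForestOn G Y := by
  constructor
  · intro h S hS hne
    have := hne.to_subtype
    obtain ⟨v, hv⟩ := (h.embedding (G.induceHomOfLE hS)).exists_adj_subsingleton
    exact ⟨v, v.2, fun x hx y hy hvx hvy => congrArg Subtype.val (hv ⟨x, hx⟩ ⟨y, hy⟩ hvx hvy)⟩
  · intro h u c hc
    classical
    obtain ⟨v, ⟨w, hw, rfl⟩, hv⟩ := h (Subtype.val '' {w | w ∈ c.support})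
      (by rintro _ ⟨w, -, rfl⟩; exact w.2) ⟨u, u, c.start_mem_support, rfl⟩
    have hc' := hc.rotate hw
    have h1 := (c.rotate w hw).adj_snd hc'.not_nil
    have h2 := (c.rotate w hw).adj_penultimate hc'.not_nil
    refine hc'.snd_ne_penultimate (Subtype.ext (hv _ ⟨_, ?_, rfl⟩ _ ⟨_, ?_, rfl⟩ h1 h2.symm))
    · exact (c.mem_support_rotate_iff w hw).1 ((c.rotate w hw).getVert_mem_support 1)
    · exact (c.mem_support_rotate_iff w hw).1 ((c.rotate w hw).getVert_mem_support _)

theorem isFeedbackVertexSet_iff [Finite V] {X : Set V} :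
    IsFeedbackVertexSet G X ↔ ForestOn G Xᶜ := isAcyclic_induce_iff

theorem isConnectedVertexCover_iff {X : Set V} :
    IsConnectedVertexCover G X ↔ cvcP G Set.univ Xᶜ 4 := by
  rw [IsConnectedVertexCover, isVertexCover_iff, preconnected_induce_iff]
  simp [cvcP]

theorem minSize_le_minSize_iff [Finite V] {P : Set V → Prop} {P' : Set V' → Prop} :
    minSize P' ≤ minSize P ↔ ∀ X, P X → ∃ X', P' X' ∧ X'.encard ≤ X.encard := by
  constructor
  · intro h X hX
    have h1 : minSize P' ≤ X.encard := h.trans (iInf₂_le X hX)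
    by_contra! h2
    -- Sizes are integers, so if every `X'` is larger than `X`, the infimum exceeds the finite size
    -- of `X` by at least one; this also covers the case that no `X'` exists.
    have h3 : X.encard + 1 ≤ minSize P' := le_iInf₂ fun X' hX' => Order.add_one_le_of_lt (h2 X' hX')
    have h4 : X.encard ≠ ⊤ := X.toFinite.encard_lt_top.ne
    exact absurd (h3.trans h1) (not_le.2 ((ENat.lt_add_one_iff h4).2 le_rfl))
  · intro h
    refine le_iInf₂ fun X hX => ?_
    obtain ⟨X', hX', hle⟩ := h X hX
    exact (iInf₂_le X' hX').trans hle

/-- With equally many vertices in both graphs, comparing minimum solutions amounts to finding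
complements that are at least as large. It is used in both directions: to extract parts of `H` from
the hypotheses and to derive the conclusions. -/
theorem minSize_compl_le_iff [Finite V] [Finite V'] (hcard : Nat.card V = Nat.card V')
    {P : Set V → Prop} {P' : Set V' → Prop} :
    minSize (fun X => P' Xᶜ) ≤ minSize (fun X => P Xᶜ) ↔
      ∀ Y, P Y → ∃ Y', P' Y' ∧ Y.ncard ≤ Y'.ncard := by
  have key : ∀ (Y : Set V) (Y' : Set V'), Y'ᶜ.encard ≤ Yᶜ.encard ↔ Y.ncard ≤ Y'.ncard := by
    intro Y Y'
    rw [← Set.Finite.cast_ncard_eq (Set.toFinite Y'ᶜ), ← Set.Finite.cast_ncard_eq (Set.toFinite Yᶜ),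
      Nat.cast_le]
    have h1 := Set.ncard_add_ncard_compl Y
    have h2 := Set.ncard_add_ncard_compl Y'
    omega
  rw [minSize_le_minSize_iff]
  constructor
  · intro h Y hY
    obtain ⟨X', hX', hle⟩ := h Yᶜ (by simpa using hY)
    refine ⟨X'ᶜ, hX', (key _ _).1 (by simpa using hle)⟩
  · intro h X hX
    obtain ⟨Y', hY', hle⟩ := h Xᶜ hX
    refine ⟨Y'ᶜ, by simpa using hY', ?_⟩
    have := (key Xᶜ Y').2 hle
    simpa using this

/-! ### Invariance under embeddings -/

section Embedding

variable (f : G ↪g G') {B Y : Set V}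

theorem indepOn_image : IndepOn G' (f '' Y) ↔ IndepOn G Y := by
  simp [IndepOn]

theorem bipOn_image : BipOn G' (f '' Y) ↔ BipOn G Y := by
  constructor
  · rintro ⟨c, hc⟩
    exact ⟨c ∘ f, fun u hu v hv huv => hc _ ⟨u, hu, rfl⟩ _ ⟨v, hv, rfl⟩ (f.map_adj_iff.2 huv)⟩
  · rintro ⟨c, hc⟩
    refine ⟨Function.extend f c fun _ => false, ?_⟩
    rintro _ ⟨u, hu, rfl⟩ _ ⟨v, hv, rfl⟩ huv
    rw [f.injective.extend_apply, f.injective.extend_apply]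
    exact hc u hu v hv (f.map_adj_iff.1 huv)

theorem forestOn_image : ForestOn G' (f '' Y) ↔ ForestOn G Y := by
  constructor
  · intro h S hS hne
    obtain ⟨_, ⟨v, hv, rfl⟩, h'⟩ := h (f '' S) (Set.image_mono hS) (hne.image f)
    exact ⟨v, hv, fun x hx y hy hvx hvy => f.injective (h' _ ⟨x, hx, rfl⟩ _ ⟨y, hy, rfl⟩
      (f.map_adj_iff.2 hvx) (f.map_adj_iff.2 hvy))⟩
  · intro h S hS hne
    obtain ⟨S, rfl⟩ : ∃ S', f '' S' = S :=
      ⟨f ⁻¹' S, Set.image_preimage_eq_of_subset (hS.trans (Set.image_subset_range f Y))⟩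
    obtain ⟨v, hv, h'⟩ := h S ((Set.image_subset_image_iff f.injective).1 hS) hne.of_image
    refine ⟨f v, ⟨v, hv, rfl⟩, ?_⟩
    rintro _ ⟨x, hx, rfl⟩ _ ⟨y, hy, rfl⟩ hvx hvy
    rw [h' x hx y hy (f.map_adj_iff.1 hvx) (f.map_adj_iff.1 hvy)]

theorem connOn_image : ConnOn G' (f '' Y) ↔ ConnOn G Y := by
  constructor
  · intro h S hS hne hne'
    obtain ⟨_, ⟨u, hu, rfl⟩, _, ⟨⟨v, hv, rfl⟩, hv'⟩, huv⟩ := h (f '' S) (Set.image_mono hS)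
      (hne.image f) (by rw [← Set.image_sdiff f.injective]; exact hne'.image f)
    exact ⟨u, hu, v, ⟨hv, fun h => hv' ⟨v, h, rfl⟩⟩, f.map_adj_iff.1 huv⟩
  · intro h S hS hne hne'
    obtain ⟨S, rfl⟩ : ∃ S', f '' S' = S :=
      ⟨f ⁻¹' S, Set.image_preimage_eq_of_subset (hS.trans (Set.image_subset_range f Y))⟩
    rw [← Set.image_sdiff f.injective] at hne' ⊢
    obtain ⟨u, hu, v, hv, huv⟩ := h S ((Set.image_subset_image_iff f.injective).1 hS) hne.of_image
      hne'.of_image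
    exact ⟨f u, ⟨u, hu, rfl⟩, f v, ⟨v, hv, rfl⟩, f.map_adj_iff.2 huv⟩

theorem octP_image (t : Fin 5) : octP G' (f '' B) (f '' Y) t ↔ octP G B Y t := by
  match t with
  | 0 => exact Set.image_eq_empty
  | 1 => exact indepOn_image f
  | 2 => exact indepOn_image f
  | 3 => exact bipOn_image f
  | 4 => exact Iff.rfl

theorem fvsP_image (t : Fin 5) : fvsP G' (f '' B) (f '' Y) t ↔ fvsP G B Y t := by
  match t with
  | 0 => exact Set.image_eq_empty
  | 1 => exact ⟨fun h => Set.subsingleton_of_image f.injective _ h, fun h => h.image f⟩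
  | 2 => exact indepOn_image f
  | 3 => exact forestOn_image f
  | 4 => exact Iff.rfl

theorem cvcP_image (t : Fin 5) : cvcP G' (f '' B) (f '' Y) t ↔ cvcP G B Y t := by
  match t with
  | 0 => exact Set.image_eq_empty
  | 1 => exact (indepOn_image f).and f.injective.image_injective.ne_iff
  | 2 => exact (indepOn_image f).and f.injective.image_injective.eq_iff
  | 3 => exact Set.image_eq_empty.and (connOn_image f)
  | 4 =>
    refine (indepOn_image f).and ?_
    rw [← Set.image_sdiff f.injective, connOn_image f]

end Embedding

/-! ### Blocks with one vertex -/

section Single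

variable (v : V)

theorem indepOn_singleton : IndepOn G {v} := by simp [IndepOn]

theorem connOn_singleton : ConnOn G {v} := by
  rintro S hS ⟨u, hu⟩ ⟨w, hw, hwS⟩
  have h1 : u = v := hS hu
  have h2 : w = v := hw
  exact absurd (h2 ▸ h1 ▸ hu) hwS

theorem octP_singleton_empty (t : Fin 5) : octP G {v} ∅ t ↔ t ≠ 4 := by
  match t with
  | 0 => simp [octP]
  | 1 => simp [octP, indepOn_empty]
  | 2 => simp [octP, indepOn_empty]
  | 3 => simp [octP, BipOn]
  | 4 => simp [octP]

theorem octP_singleton (t : Fin 5) : octP G {v} {v} t ↔ t ≠ 0 ∧ t ≠ 4 := by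
  match t with
  | 0 => simp [octP]
  | 1 => simp [octP, indepOn_singleton]
  | 2 => simp [octP, indepOn_singleton]
  | 3 => simp [octP, BipOn]
  | 4 => simp [octP]

theorem fvsP_singleton_empty (t : Fin 5) : fvsP G {v} ∅ t ↔ t ≠ 4 := by
  match t with
  | 0 => simp [fvsP]
  | 1 => simp [fvsP]
  | 2 => simp [fvsP, indepOn_empty]
  | 3 => simp [fvsP, ForestOn]
  | 4 => simp [fvsP]

theorem fvsP_singleton (t : Fin 5) : fvsP G {v} {v} t ↔ t ≠ 0 ∧ t ≠ 4 := by
  match t with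
  | 0 => simp [fvsP]
  | 1 => simp [fvsP]
  | 2 => simp [fvsP, indepOn_singleton]
  | 3 =>
    simp only [fvsP, ne_eq, Fin.reduceEq, not_false_eq_true, and_self, iff_true]
    rintro S hS ⟨u, hu⟩
    exact ⟨u, hu, fun x hx y hy _ _ => (hS hx : x = v).trans (hS hy : y = v).symm⟩
  | 4 => simp [fvsP]

theorem cvcP_singleton_empty (t : Fin 5) : cvcP G {v} ∅ t ↔ t ≠ 2 := by
  match t with
  | 0 => simp [cvcP]
  | 1 => simp [cvcP, indepOn_empty]
  | 2 => simp [cvcP, indepOn_empty]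
  | 3 => simp [cvcP, connOn_singleton]
  | 4 => simp [cvcP, connOn_singleton, indepOn_empty]

theorem cvcP_singleton (t : Fin 5) : cvcP G {v} {v} t ↔ t = 2 ∨ t = 4 := by
  match t with
  | 0 => simp [cvcP]
  | 1 => simp [cvcP]
  | 2 => simp [cvcP, indepOn_singleton]
  | 3 => simp [cvcP]
  | 4 => simp [cvcP, connOn_empty, indepOn_singleton]

end Single

/-! ### The exchange argument -/

/-- Split `Y` into its parts, replace each by a part of the same type that is not smaller, and take
the union. The quotient enters only through `R`, which is common to both sides. -/
theorem IsSubstitution.exists_transfer {ι : Type*} [Finite ι] [Finite V] [Finite V']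
    {Q : SimpleGraph ι} {B : ι → Set V} {B' : ι → Set V'} (h : IsSubstitution G Q B)
    (h' : IsSubstitution G' Q B') {P : Set V → Set V → Fin 5 → Prop}
    {P' : Set V' → Set V' → Fin 5 → Prop} {R : (ι → Fin 5) → Prop} {p : Set V → Prop}
    {p' : Set V' → Prop}
    (hdec : ∀ Y ⊆ ⋃ i, B i, p Y → ∃ τ, R τ ∧ ∀ i, P (B i) (Y ∩ B i) (τ i))
    (hdec' : ∀ Y ⊆ ⋃ i, B' i, (∃ τ, R τ ∧ ∀ i, P' (B' i) (Y ∩ B' i) (τ i)) → p' Y)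
    (htr : ∀ i t, ∀ Y ⊆ B i, P (B i) Y t → ∃ Y' ⊆ B' i, P' (B' i) Y' t ∧ Y.ncard ≤ Y'.ncard)
    {Y : Set V} (hY : Y ⊆ ⋃ i, B i) (hp : p Y) : ∃ Y', p' Y' ∧ Y.ncard ≤ Y'.ncard := by
  have : Fintype ι := Fintype.ofFinite ι
  obtain ⟨τ, hτ, hP⟩ := hdec Y hY hp
  choose Z hZ hZP hle using fun i => htr i (τ i) (Y ∩ B i) Set.inter_subset_right (hP i)
  have hsub : (⋃ i, Z i) ⊆ ⋃ i, B' i := Set.iUnion_mono hZ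
  have hint : ∀ i, (⋃ i, Z i) ∩ B' i = Z i := fun i => by
    refine Set.Subset.antisymm ?_ fun v hv => ⟨Set.mem_iUnion.2 ⟨i, hv⟩, hZ i hv⟩
    rintro v ⟨hv, hvi⟩
    obtain ⟨j, hj⟩ := Set.mem_iUnion.1 hv
    rwa [h'.disj hvi (hZ j hj)]
  refine ⟨⋃ i, Z i, hdec' _ hsub ⟨τ, hτ, fun i => ?_⟩, ?_⟩
  · rw [hint]
    exact hZP i
  · rw [h.ncard_eq_sum hY, h'.ncard_eq_sum hsub]
    refine Finset.sum_le_sum fun i _ => ?_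
    rw [hint]
    exact hle i

/-! ### Replacing a module by a graph -/

section

variable {W : Type*} {H : SimpleGraph W} {M : Set V}

/-- The blocks of `G` when the module `M` is contracted. -/
def blocksOf (M : Set V) : (Mᶜ : Set V) ⊕ Unit → Set V
  | .inl v => {v.1}
  | .inr _ => M

/-- The blocks of the graph in which `M` is replaced. -/
def blocksOfReplace (M : Set V) (W : Type*) : (Mᶜ : Set V) ⊕ Unit → Set ((Mᶜ : Set V) ⊕ W)
  | .inl v => {.inl v}
  | .inr _ => Set.range Sum.inr

theorem iUnion_blocksOf : ⋃ i, blocksOf M i = Set.univ := by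
  refine Set.eq_univ_of_forall fun v => Set.mem_iUnion.2 ?_
  by_cases hv : v ∈ M
  exacts [⟨.inr (), hv⟩, ⟨.inl ⟨v, hv⟩, rfl⟩]

theorem iUnion_blocksOfReplace : ⋃ i, blocksOfReplace M W i = Set.univ := by
  refine Set.eq_univ_of_forall fun v => Set.mem_iUnion.2 ?_
  rcases v with v | w
  exacts [⟨.inl v, rfl⟩, ⟨.inr (), w, rfl⟩]

/-- The quotient that contracts `M` is itself a replacement, namely of `M` by a single vertex. By
`isSubstitution_blocksOfReplace` the new graph has the same quotient. -/
theorem isSubstitution_blocksOf (hM : IsGraphModule G M) :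
    IsSubstitution G (moduleReplace G M (⊥ : SimpleGraph Unit)) (blocksOf M) where
  disj := by
    rintro (i | i) (j | j) v hi hj
    · rw [show i = j from Subtype.ext (Eq.trans (Eq.symm hi) hj)]
    · exact absurd (show i.1 ∈ M from (show v = i.1 from hi) ▸ hj) i.2
    · exact absurd (show j.1 ∈ M from (show v = j.1 from hj) ▸ hi) j.2
    · rfl
  adj := by
    have key : ∀ v : (Mᶜ : Set V), ∀ m ∈ M, (G.Adj v m ↔ ∃ m ∈ M, G.Adj v m) := fun v m hm =>
      ⟨fun h => ⟨m, hm, h⟩, fun ⟨m', hm', h⟩ => (hM.adj_iff v.2 hm' hm).1 h⟩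
    rintro (i | i) (j | j) hij u v hu hv
    · rw [show u = i from hu, show v = j from hv]; exact Iff.rfl
    · rw [show u = i from hu]; exact key i v hv
    · rw [show v = j from hv, G.adj_comm]; exact key j u hu
    · exact absurd rfl hij

theorem isSubstitution_blocksOfReplace :
    IsSubstitution (moduleReplace G M H) (moduleReplace G M (⊥ : SimpleGraph Unit))
      (blocksOfReplace M W) where
  disj := by
    rintro (i | i) (j | j) v hi hj
    · rw [Sum.inl.inj (Eq.trans (Eq.symm (show v = .inl i from hi)) hj)]
    · obtain ⟨w, rfl⟩ := hj
      cases (show Sum.inr w = Sum.inl i from hi)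
    · obtain ⟨w, rfl⟩ := hi
      cases (show Sum.inr w = Sum.inl j from hj)
    · rfl
  adj := by
    rintro (i | i) (j | j) hij u v hu hv
    · rw [show u = .inl i from hu, show v = .inl j from hv]; exact Iff.rfl
    · obtain ⟨w, rfl⟩ := hv
      rw [show u = .inl i from hu]; exact Iff.rfl
    · obtain ⟨w, rfl⟩ := hu
      rw [show v = .inl j from hv]; exact Iff.rfl
    · exact absurd rfl hij

/-- The replacing graph sits in the new graph as an induced subgraph. -/
def replaceEmbedding (G : SimpleGraph V) (M : Set V) (H : SimpleGraph W) :
    H ↪g moduleReplace G M H where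
  toFun := Sum.inr
  inj' := Sum.inr_injective
  map_rel_iff' := Iff.rfl

/-- Partial solutions in a block can be transferred if this is so for the module. -/
theorem exists_transfer_block {P : Set V → Set V → Fin 5 → Prop}
    {P₁ : Set M → Fin 5 → Prop} {P₂ : Set W → Fin 5 → Prop}
    {P' : Set ((Mᶜ : Set V) ⊕ W) → Set ((Mᶜ : Set V) ⊕ W) → Fin 5 → Prop}
    (h1 : ∀ v : (Mᶜ : Set V), ∀ t, P {v.1} ∅ t → P' {.inl v} ∅ t)
    (h2 : ∀ v : (Mᶜ : Set V), ∀ t, P {v.1} {v.1} t → P' {.inl v} {.inl v} t)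
    (h3 : ∀ Y t, P M (Subtype.val '' Y) t → P₁ Y t)
    (h4 : ∀ Y t, P₂ Y t → P' (Set.range .inr) (Sum.inr '' Y) t)
    (h5 : ∀ Y t, P₁ Y t → ∃ Z, P₂ Z t ∧ Y.ncard ≤ Z.ncard) (i t) (Y : Set V)
    (hY : Y ⊆ blocksOf M i) (hP : P (blocksOf M i) Y t) :
    ∃ Y' ⊆ blocksOfReplace M W i, P' (blocksOfReplace M W i) Y' t ∧ Y.ncard ≤ Y'.ncard := by
  rcases i with v | i
  · rcases Set.subset_singleton_iff_eq.1 hY with rfl | rfl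
    · exact ⟨∅, Set.empty_subset _, h1 v t hP, by simp⟩
    · exact ⟨({Sum.inl v} : Set ((Mᶜ : Set V) ⊕ W)), subset_rfl, h2 v t hP, by simp⟩
  · have hY' : Y ⊆ M := hY
    obtain ⟨Y, rfl⟩ : ∃ Y' : Set M, Subtype.val '' Y' = Y :=
      ⟨Subtype.val ⁻¹' Y, by simpa using hY'⟩
    obtain ⟨Z, hZ, hle⟩ := h5 Y t (h3 Y t hP)
    refine ⟨Sum.inr '' Z, Set.image_subset_range _ _, h4 Z t hZ, ?_⟩
    rwa [Set.ncard_image_of_injective _ Subtype.val_injective,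
      Set.ncard_image_of_injective _ Sum.inr_injective]

variable [Finite V] [Finite W]

theorem exists_indep_transfer (hcard : Nat.card M = Nat.card W)
    (h : minVC (G.induce M) = minVC H) (Y : Set M) (hY : IndepOn (G.induce M) Y) :
    ∃ Z, IndepOn H Z ∧ Y.ncard ≤ Z.ncard := by
  have h' := h.ge
  unfold minVC at h'
  simp only [funext fun X => propext (isVertexCover_iff (G := G.induce M) (X := X)),
    funext fun X => propext (isVertexCover_iff (G := H) (X := X))] at h'
  exact (minSize_compl_le_iff hcard).1 h' Y hY

theorem card_replace (hcard : Nat.card M = Nat.card W) :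
    Nat.card ((Mᶜ : Set V) ⊕ W) = Nat.card V := by
  rw [Nat.card_sum, ← hcard, Nat.card_coe_set_eq, Nat.card_coe_set_eq, add_comm,
    Set.ncard_add_ncard_compl]

/-- Kept general in the type `j`: the case `1` yields the claim for vertex covers and the case `3`
the one for odd cycle transversals. -/
theorem minOCT_moduleReplace_le (hM : IsGraphModule G M) (hcard : Nat.card M = Nat.card W)
    (h : minVC (G.induce M) = minVC H) (h' : minOCT (G.induce M) = minOCT H) (j : Fin 5)
    (Y : Set V) (hY : octP G Set.univ Y j) :
    ∃ Y', octP (moduleReplace G M H) Set.univ Y' j ∧ Y.ncard ≤ Y'.ncard := by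
  have hbip : ∀ Y : Set M, BipOn (G.induce M) Y → ∃ Z, BipOn H Z ∧ Y.ncard ≤ Z.ncard := by
    have h' := h'.ge
    unfold minOCT at h'
    simp only [funext fun X => propext (isOddCycleTransversal_iff (G := G.induce M) (X := X)),
      funext fun X => propext (isOddCycleTransversal_iff (G := H) (X := X))] at h'
    exact (minSize_compl_le_iff hcard).1 h'
  have e1 := isSubstitution_blocksOf hM
  have e2 := isSubstitution_blocksOfReplace (G := G) (M := M) (H := H)
  rw [← iUnion_blocksOf (M := M)] at hY
  rw [← iUnion_blocksOfReplace (M := M)]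
  refine e1.exists_transfer e2 (P := octP G) (P' := octP (moduleReplace G M H))
    (R := fun τ => octR _ τ j) (p := fun Y => octP G _ Y j)
    (fun Y hY => (oct_decomp e1 hY j).1) (fun Y hY => (oct_decomp e2 hY j).2)
    (exists_transfer_block (P₁ := octP (G.induce M) Set.univ) (P₂ := octP H Set.univ)
      (fun v t => ?_) (fun v t => ?_) (fun Y t hP => ?_) (fun Y t hP => ?_) fun Y t hP => ?_)
    (by simp [iUnion_blocksOf]) hY
  · rw [octP_singleton_empty, octP_singleton_empty]; exact id
  · rw [octP_singleton, octP_singleton]; exact id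
  · refine (octP_image (SimpleGraph.Embedding.induce M) t).1 ?_
    rw [Set.image_univ]
    exact (Subtype.range_val (s := M)).symm ▸ hP
  · have := (octP_image (replaceEmbedding G M H) t).2 hP
    rwa [Set.image_univ] at this
  · match t with
    | 0 => exact ⟨∅, rfl, by simp [show Y = ∅ from hP]⟩
    | 1 => exact exists_indep_transfer hcard h Y hP
    | 2 => exact exists_indep_transfer hcard h Y hP
    | 3 => exact hbip Y hP
    | 4 => exact hP.elim

theorem minFVS_moduleReplace_le (hM : IsGraphModule G M) (hcard : Nat.card M = Nat.card W)
    (h : minVC (G.induce M) = minVC H) (h' : minFVS (G.induce M) = minFVS H)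
    (Y : Set V) (hY : ForestOn G Y) :
    ∃ Y', ForestOn (moduleReplace G M H) Y' ∧ Y.ncard ≤ Y'.ncard := by
  have hforest : ∀ Y : Set M, ForestOn (G.induce M) Y → ∃ Z, ForestOn H Z ∧ Y.ncard ≤ Z.ncard := by
    have h' := h'.ge
    unfold minFVS at h'
    simp only [funext fun X => propext (isFeedbackVertexSet_iff (G := G.induce M) (X := X)),
      funext fun X => propext (isFeedbackVertexSet_iff (G := H) (X := X))] at h'
    exact (minSize_compl_le_iff hcard).1 h'
  have e1 := isSubstitution_blocksOf hM
  have e2 := isSubstitution_blocksOfReplace (G := G) (M := M) (H := H)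
  refine e1.exists_transfer e2 (P := fvsP G) (P' := fvsP (moduleReplace G M H))
    (R := fun τ => fvsR _ τ 3) (p := fun Y => fvsP G (⋃ i, blocksOf M i) Y 3)
    (p' := fun Y => fvsP (moduleReplace G M H) (⋃ i, blocksOfReplace M W i) Y 3)
    (fun Y hY => (fvs_decomp e1 hY 3).1) (fun Y hY => (fvs_decomp e2 hY 3).2)
    (exists_transfer_block (P₁ := fvsP (G.induce M) Set.univ) (P₂ := fvsP H Set.univ)
      (fun v t => ?_) (fun v t => ?_) (fun Y t hP => ?_) (fun Y t hP => ?_) fun Y t hP => ?_)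
    (by simp [iUnion_blocksOf]) hY
  · rw [fvsP_singleton_empty, fvsP_singleton_empty]; exact id
  · rw [fvsP_singleton, fvsP_singleton]; exact id
  · refine (fvsP_image (SimpleGraph.Embedding.induce M) t).1 ?_
    rw [Set.image_univ]
    exact (Subtype.range_val (s := M)).symm ▸ hP
  · have := (fvsP_image (replaceEmbedding G M H) t).2 hP
    rwa [Set.image_univ] at this
  · match t with
    | 0 => exact ⟨∅, rfl, by simp [show Y = ∅ from hP]⟩
    | 1 =>
      rcases Set.Subsingleton.eq_empty_or_singleton hP with rfl | ⟨m, rfl⟩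
      · exact ⟨∅, Set.subsingleton_empty, by simp⟩
      -- A single vertex of `M` can be exchanged for any vertex of `W`, which is nonempty since it
      -- has as many elements as `M`.
      · have : Nonempty W := by
          have : 0 < Nat.card M := Nat.card_pos_iff.2 ⟨⟨m⟩, inferInstance⟩
          rw [hcard] at this
          exact (Nat.card_pos_iff.1 this).1
        exact ⟨{Classical.arbitrary W}, Set.subsingleton_singleton, by simp⟩
    | 2 => exact exists_indep_transfer hcard h Y hP
    | 3 => exact hforest Y hP
    | 4 => exact hP.elim

/-- Each type needs its own source: types `1` and `2` use the equality of vertex cover numbers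
together with `|M| = |W|`, type `3` the connectedness of `H`, and type `4` the equality of connected
vertex cover numbers, available because such a part exhibits a connected vertex cover of `G[M]`. -/
theorem minCVC_moduleReplace_le (hM : IsGraphModule G M) (hcard : Nat.card M = Nat.card W)
    (h : minVC (G.induce M) = minVC H) (hH : H.Connected)
    (h' : minCVC (G.induce M) ≠ ⊤ → minCVC (G.induce M) = minCVC H) :
    minCVC (moduleReplace G M H) ≤ minCVC G := by
  have hcvc : ∀ Y : Set M, cvcP (G.induce M) Set.univ Y 4 →
      ∃ Z, cvcP H Set.univ Z 4 ∧ Y.ncard ≤ Z.ncard := by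
    intro Y hY
    have h1 : minCVC (G.induce M) ≠ ⊤ := by
      refine ne_top_of_le_ne_top (Set.toFinite Yᶜ).encard_lt_top.ne (iInf₂_le Yᶜ ?_)
      rw [isConnectedVertexCover_iff, compl_compl]
      exact hY
    have h' := (h' h1).ge
    unfold minCVC at h'
    simp only [funext fun X => propext (isConnectedVertexCover_iff (G := G.induce M) (X := X)),
      funext fun X => propext (isConnectedVertexCover_iff (G := H) (X := X))] at h'
    exact (minSize_compl_le_iff hcard (P := fun Y => cvcP (G.induce M) Set.univ Y 4)
      (P' := fun Y => cvcP H Set.univ Y 4)).1 h' Y hY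
  have hW : Nonempty W := hH.nonempty
  have hMne : M.Nonempty := by
    have : 0 < Nat.card W := Nat.card_pos
    rw [← hcard] at this
    exact Set.nonempty_coe_sort.1 (Nat.card_pos_iff.1 this).1
  have e1 := isSubstitution_blocksOf hM
  have e2 := isSubstitution_blocksOfReplace (G := G) (M := M) (H := H)
  have n1 : ∀ i, (blocksOf M i).Nonempty := by
    rintro (i | i)
    exacts [⟨i.1, rfl⟩, hMne]
  have n2 : ∀ i, (blocksOfReplace M W i).Nonempty := by
    rintro (i | i)
    exacts [⟨.inl i, rfl⟩, Set.range_nonempty _]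
  unfold minCVC
  simp only [funext fun X => propext (isConnectedVertexCover_iff (G := G) (X := X)),
    funext fun X => propext (isConnectedVertexCover_iff (G := moduleReplace G M H) (X := X))]
  rw [minSize_compl_le_iff (card_replace hcard).symm (P := fun Y => cvcP G Set.univ Y 4)
    (P' := fun Y => cvcP (moduleReplace G M H) Set.univ Y 4)]
  intro Y hY
  rw [← iUnion_blocksOf (M := M)] at hY
  rw [← iUnion_blocksOfReplace (M := M)]
  refine e1.exists_transfer e2 (P := cvcP G) (P' := cvcP (moduleReplace G M H))
    (R := fun τ => cvcR _ τ 4) (p := fun Y => cvcP G _ Y 4)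
    (fun Y hY => (cvc_decomp_four e1 n1 hY).1) (fun Y hY => (cvc_decomp_four e2 n2 hY).2)
    (exists_transfer_block (P₁ := cvcP (G.induce M) Set.univ) (P₂ := cvcP H Set.univ)
      (fun v t => ?_) (fun v t => ?_) (fun Y t hP => ?_) (fun Y t hP => ?_) fun Y t hP => ?_)
    (by simp [iUnion_blocksOf]) hY
  · rw [cvcP_singleton_empty, cvcP_singleton_empty]; exact id
  · rw [cvcP_singleton, cvcP_singleton]; exact id
  · refine (cvcP_image (SimpleGraph.Embedding.induce M) t).1 ?_
    rw [Set.image_univ]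
    exact (Subtype.range_val (s := M)).symm ▸ hP
  · have := (cvcP_image (replaceEmbedding G M H) t).2 hP
    rwa [Set.image_univ] at this
  · match t with
    | 0 => exact ⟨∅, rfl, by simp [show Y = ∅ from hP]⟩
    | 1 =>
      obtain ⟨Z, hZ, hle⟩ := exists_indep_transfer hcard h Y hP.1
      -- Type `1` excludes the full block, but `Z` might be all of `W`. Shrinking it to the size of
      -- `Y`, a proper subset of `M`, keeps it proper.
      obtain ⟨Z', hZ', hcard'⟩ := Set.exists_subset_card_eq hle
      refine ⟨Z', ⟨hZ.mono hZ', ?_⟩, hcard'.ge⟩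
      rintro rfl
      rw [Set.ncard_univ, ← hcard, ← Set.ncard_univ] at hcard'
      exact hP.2 (Set.eq_of_subset_of_ncard_le (Set.subset_univ _) hcard'.le)
    | 2 =>
      obtain ⟨hI, rfl⟩ := hP
      obtain ⟨Z, hZ, hle⟩ := exists_indep_transfer hcard h _ hI
      refine ⟨Z, ⟨hZ, Set.eq_of_subset_of_ncard_le (Set.subset_univ _) ?_⟩, hle⟩
      rwa [Set.ncard_univ, ← hcard, ← Set.ncard_univ]
    | 3 =>
      refine ⟨∅, ⟨rfl, preconnected_induce_iff.1 ?_⟩, by simp [show Y = ∅ from hP.1]⟩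
      exact (SimpleGraph.induceUnivIso H).preconnected_iff.2 hH.preconnected
    | 4 => exact hcvc Y hP

theorem moduleReplace_le (hM : IsGraphModule G M) (hcard : Nat.card M = Nat.card W)
    (hvc : minVC (G.induce M) = minVC H) (hfvs : minFVS (G.induce M) = minFVS H)
    (hoct : minOCT (G.induce M) = minOCT H) :
    minVC (moduleReplace G M H) ≤ minVC G ∧ minFVS (moduleReplace G M H) ≤ minFVS G ∧
      minOCT (moduleReplace G M H) ≤ minOCT G := by
  have hc := (card_replace hcard).symm
  refine ⟨?_, ?_, ?_⟩
  · unfold minVC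
    simp only [funext fun X => propext (isVertexCover_iff (G := G) (X := X)),
      funext fun X => propext (isVertexCover_iff (G := moduleReplace G M H) (X := X))]
    exact (minSize_compl_le_iff hc).2 (minOCT_moduleReplace_le hM hcard hvc hoct 1)
  · unfold minFVS
    simp only [funext fun X => propext (isFeedbackVertexSet_iff (G := G) (X := X)),
      funext fun X => propext (isFeedbackVertexSet_iff (G := moduleReplace G M H) (X := X))]
    exact (minSize_compl_le_iff hc).2 (minFVS_moduleReplace_le hM hcard hvc hfvs)
  · unfold minOCT
    simp only [funext fun X => propext (isOddCycleTransversal_iff (G := G) (X := X)),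
      funext fun X => propext (isOddCycleTransversal_iff (G := moduleReplace G M H) (X := X))]
    exact (minSize_compl_le_iff hc).2 (minOCT_moduleReplace_le hM hcard hvc hoct 3)

end

end Replace


/-! ## Types of partial solutions -/

/-- A way to sort partial solutions into five types such that the type of a union of blocks is
determined by the types in the blocks. -/
structure TypeSystem where
  /-- the part `Y` of a solution inside `B` has the given type -/
  P {V : Type} : SimpleGraph V → Set V → Set V → Fin 5 → Prop
  /-- the type of a union in terms of the types of its parts -/
  R {ι : Type} : SimpleGraph ι → (ι → Fin 5) → Fin 5 → Prop
  /-- the type of the full solutions -/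
  target : Fin 5
  /-- the types of a solution that contains the only vertex of a block -/
  full : Fin 5 → Prop
  /-- the types of a solution that avoids the only vertex of a block -/
  void : Fin 5 → Prop
  decomp {V ι : Type} [Nontrivial ι] {G : SimpleGraph V} {Q : SimpleGraph ι} {B : ι → Set V}
    {Y : Set V} : IsSubstitution G Q B → (∀ i, (B i).Nonempty) → Y ⊆ ⋃ i, B i → ∀ j,
    (P G (⋃ i, B i) Y j ↔ ∃ τ, R Q τ j ∧ ∀ i, P G (B i) (Y ∩ B i) (τ i))
  singleton {V : Type} {G : SimpleGraph V} {v : V} (j : Fin 5) : P G {v} {v} j ↔ full j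
  singleton_empty {V : Type} {G : SimpleGraph V} {v : V} (j : Fin 5) : P G {v} ∅ j ↔ void j
  empty {V : Type} {G : SimpleGraph V} : P G ∅ ∅ target

/-- The types for bipartite subgraphs. -/
def octSystem : TypeSystem where
  P := octP
  R := octR
  target := 3
  full t := t ≠ 0 ∧ t ≠ 4
  void t := t ≠ 4
  decomp h _ := oct_decomp h
  singleton := octP_singleton _
  singleton_empty := octP_singleton_empty _
  empty := ⟨fun _ => true, fun _ h => h.elim⟩

/-- The types for independent sets. -/
def vcSystem : TypeSystem where
  __ := octSystem
  target := 1
  empty := by intro V G; exact indepOn_empty (G := G)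

/-- The types for forests. -/
def fvsSystem : TypeSystem where
  P := fvsP
  R := fvsR
  target := 3
  full t := t ≠ 0 ∧ t ≠ 4
  void t := t ≠ 4
  decomp h _ := fvs_decomp h
  singleton := fvsP_singleton _
  singleton_empty := fvsP_singleton_empty _
  empty := fun _ h hne => (hne.ne_empty (Set.subset_empty_iff.1 h)).elim

/-- The types for complements of connected vertex covers. -/
def cvcSystem : TypeSystem where
  P := cvcP
  R := cvcR
  target := 4
  full t := t = 2 ∨ t = 4
  void t := t ≠ 2
  decomp := cvc_decomp
  singleton := cvcP_singleton _
  singleton_empty := cvcP_singleton_empty _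
  empty := ⟨indepOn_empty, by rw [Set.empty_sdiff]; exact connOn_empty⟩

namespace TypeSystem

variable (S : TypeSystem) {V : Type} {G : SimpleGraph V}

/-- One more than the maximum size of a partial solution of type `j` in `B`, and `0` if there is
none. -/
noncomputable def best (G : SimpleGraph V) (B : Set V) (j : Fin 5) : ℕ :=
  sSup {m | ∃ Y ⊆ B, S.P G B Y j ∧ m = Y.ncard + 1}

/-- The shift by one in `best` lets `0` mean "no such solution", and turns the existence of a
solution of size at least `θ` into the strict inequality `θ < best`. -/
theorem lt_best_iff [Finite V] {B : Set V} {j : Fin 5} {θ : ℕ} :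
    θ < S.best G B j ↔ ∃ Y ⊆ B, S.P G B Y j ∧ θ ≤ Y.ncard := by
  have hbdd : BddAbove {m | ∃ Y ⊆ B, S.P G B Y j ∧ m = Y.ncard + 1} := by
    refine ⟨B.ncard + 1, ?_⟩
    rintro _ ⟨Y, hY, -, rfl⟩
    exact Nat.add_le_add_right (Set.ncard_le_ncard hY) 1
  constructor
  · intro h
    have hne : {m | ∃ Y ⊆ B, S.P G B Y j ∧ m = Y.ncard + 1}.Nonempty := by
      by_contra hne
      rw [Set.not_nonempty_iff_eq_empty] at hne
      simp [best, hne] at h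
    obtain ⟨Y, hY, hP, he⟩ := Nat.sSup_mem hne hbdd
    exact ⟨Y, hY, hP, by unfold best at h; omega⟩
  · rintro ⟨Y, hY, hP, hle⟩
    exact (Nat.lt_succ_of_le hle).trans_le (le_csSup hbdd ⟨Y, hY, hP, rfl⟩)

theorem best_le [Finite V] (B : Set V) (j : Fin 5) : S.best G B j ≤ B.ncard + 1 := by
  by_contra! h
  obtain ⟨Y, hY, -, hle⟩ := S.lt_best_iff.1 h
  have := Set.ncard_le_ncard hY
  omega

open Classical in
/-- The value of `best` for a single vertex. -/
noncomputable def base (j : Fin 5) : ℕ := if S.full j then 2 else if S.void j then 1 else 0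

theorem best_singleton [Finite V] (v : V) (j : Fin 5) : S.best G {v} j = S.base j := by
  have h : ∀ θ, θ < S.best G {v} j ↔ θ < S.base j := by
    intro θ
    rw [lt_best_iff]
    constructor
    · rintro ⟨Y, hY, hP, hle⟩
      rcases Set.subset_singleton_iff_eq.1 hY with rfl | rfl
      · rw [S.singleton_empty] at hP
        rw [Set.ncard_empty] at hle
        unfold base
        split_ifs <;> omega
      · rw [S.singleton] at hP
        rw [Set.ncard_singleton] at hle
        rw [base, if_pos hP]
        omega
    · unfold base
      split_ifs with h1 h2
      · exact fun h => ⟨{v}, subset_rfl, (S.singleton j).2 h1, by simp; omega⟩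
      · exact fun h => ⟨∅, Set.empty_subset _, (S.singleton_empty j).2 h2, by simp; omega⟩
      · omega
  have h1 := h (S.base j)
  have h2 := h (S.best G {v} j)
  omega

/-- The graph on `m` vertices with the given adjacencies. -/
def quotientGraph (m : ℕ) (A : ℕ → ℕ → Prop) : SimpleGraph (Fin m) :=
  SimpleGraph.fromRel fun a b => A a b

theorem quotientGraph_congr {m : ℕ} {A A' : ℕ → ℕ → Prop} (h : ∀ a < m, ∀ b < m, A a b ↔ A' a b) :
    quotientGraph m A = quotientGraph m A' := by
  ext a b
  simp only [quotientGraph, SimpleGraph.fromRel_adj, h a a.2 b b.2, h b b.2 a a.2]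

/-- There is a choice of types for the `m` vertices of the quotient that leads to a solution of
type `j` and size at least `θ`. -/
def Fits (m : ℕ) (A : ℕ → ℕ → Prop) (E : ℕ → ℕ → ℕ) (j θ : ℕ) : Prop :=
  ∃ (j' : Fin 5) (τ : Fin m → Fin 5), j' = j ∧ S.R (quotientGraph m A) τ j' ∧
    (∀ a : Fin m, 0 < E a (τ a)) ∧ θ ≤ ∑ a : Fin m, (E a (τ a) - 1)

theorem fits_congr {m : ℕ} {A A' : ℕ → ℕ → Prop} {E E' : ℕ → ℕ → ℕ}
    (h : ∀ a < m, ∀ b < m, A a b ↔ A' a b) (hE : ∀ a < m, ∀ c < 5, E a c = E' a c) {j θ : ℕ} :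
    S.Fits m A E j θ ↔ S.Fits m A' E' j θ := by
  unfold Fits
  rw [quotientGraph_congr h]
  refine exists_congr fun j' => exists_congr fun τ => and_congr_right' (and_congr_right' ?_)
  have : ∀ a : Fin m, E a (τ a) = E' a (τ a) := fun a => hE a a.2 _ (τ a).2
  simp only [this]

theorem fits_iff_exists {m N : ℕ} (hN : 5 ^ m ≤ N) {A : ℕ → ℕ → Prop} {E : ℕ → ℕ → ℕ} {j θ : ℕ} :
    S.Fits m A E j θ ↔ ∃ c < N, S.Fits m A (fun a t => ind (c / 5 ^ a % 5 = t)) j 0 ∧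
      (∀ a < m, E a (c / 5 ^ a % 5) ≠ 0) ∧
      θ ≤ ∑ a ∈ Finset.range m, (E a (c / 5 ^ a % 5) - 1) := by
  constructor
  · rintro ⟨j', τ, hj, hR, h1, h2⟩
    have hτ : ∀ a : Fin m, (finFunctionFinEquiv τ : ℕ) / 5 ^ (a : ℕ) % 5 = τ a := fun a => by
      rw [← finFunctionFinEquiv_symm_apply_val, Equiv.symm_apply_apply]
    refine ⟨finFunctionFinEquiv τ, (finFunctionFinEquiv τ).2.trans_le hN, ⟨j', τ, hj, hR, fun a => ?_, by simp⟩,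
      fun a ha => ?_, ?_⟩
    · beta_reduce; rw [hτ, ind_of rfl]; exact one_pos
    · rw [hτ ⟨a, ha⟩]; exact (h1 ⟨a, ha⟩).ne'
    · rw [← Fin.sum_univ_eq_sum_range (fun a => E a ((finFunctionFinEquiv τ : ℕ) / 5 ^ a % 5) - 1) m]
      simpa only [hτ] using h2
  · rintro ⟨c, -, ⟨j', τ, hj, hR, h1, -⟩, h2, h3⟩
    have hτ : ∀ a : Fin m, c / 5 ^ (a : ℕ) % 5 = τ a := fun a => by
      have := h1 a
      by_contra h
      beta_reduce at this
      rw [ind_of_not h] at this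
      exact this.false
    refine ⟨j', τ, hj, hR, fun a => ?_, ?_⟩
    · rw [← hτ]; exact Nat.pos_of_ne_zero (h2 a a.2)
    · rw [← Fin.sum_univ_eq_sum_range (fun a => E a (c / 5 ^ a % 5) - 1) m] at h3
      simpa only [hτ] using h3

/-- The optimum in a union of blocks is determined by the optima in the blocks. -/
theorem lt_best_iUnion_iff [Finite V] {m : ℕ} (hm : 2 ≤ m) {A : ℕ → ℕ → Prop} {B : Fin m → Set V}
    (h : IsSubstitution G (quotientGraph m A) B) (hne : ∀ i, (B i).Nonempty) {E : ℕ → ℕ → ℕ}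
    (hE : ∀ a : Fin m, ∀ c : Fin 5, E a c = S.best G (B a) c) (j : Fin 5) (θ : ℕ) :
    θ < S.best G (⋃ i, B i) j ↔ S.Fits m A E j θ := by
  have : Nontrivial (Fin m) := Fin.nontrivial_iff_two_le.2 hm
  rw [lt_best_iff]
  constructor
  · rintro ⟨Y, hY, hP, hθ⟩
    obtain ⟨τ, hR, hτ⟩ := (S.decomp h hne hY j).1 hP
    have hlt : ∀ a : Fin m, (Y ∩ B a).ncard < E a (τ a) := fun a => by
      rw [hE, lt_best_iff]
      exact ⟨_, Set.inter_subset_right, hτ a, le_rfl⟩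
    refine ⟨j, τ, rfl, hR, fun a => (Nat.zero_le _).trans_lt (hlt a), hθ.trans ?_⟩
    rw [h.ncard_eq_sum hY]
    exact Finset.sum_le_sum fun a _ => by have := hlt a; omega
  · rintro ⟨j', τ, hj, hR, h1, h2⟩
    obtain rfl : j' = j := Fin.ext hj
    have hex : ∀ a : Fin m, ∃ Z ⊆ B a, S.P G (B a) Z (τ a) ∧ E a (τ a) - 1 ≤ Z.ncard := fun a => by
      rw [← lt_best_iff, ← hE]
      have := h1 a
      omega
    choose Z hZ hZP hle using hex
    have hsub : (⋃ i, Z i) ⊆ ⋃ i, B i := Set.iUnion_mono hZ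
    have hint : ∀ i, (⋃ i, Z i) ∩ B i = Z i := fun i => by
      refine Set.Subset.antisymm ?_ fun v hv => ⟨Set.mem_iUnion.2 ⟨i, hv⟩, hZ i hv⟩
      rintro v ⟨hv, hvi⟩
      obtain ⟨j, hj⟩ := Set.mem_iUnion.1 hv
      rwa [h.disj hvi (hZ j hj)]
    refine ⟨⋃ i, Z i, hsub, (S.decomp h hne hsub _).2 ⟨τ, hR, fun i => ?_⟩, h2.trans ?_⟩
    · rw [hint]; exact hZP i
    · rw [h.ncard_eq_sum hsub]
      exact Finset.sum_le_sum fun a _ => by rw [hint]; exact hle a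

/-! ### The oracle problem -/

/-- The bits of a query: the entry `i` describes, depending on its leading digit, an adjacency, a
digit of a weight, a digit of the threshold, the number of vertices or the type. -/
def queryBit (K m : ℕ) (A : ℕ → ℕ → Prop) (E : ℕ → ℕ → ℕ) (j θ i : ℕ) : Prop :=
  (i / K / K / K = 0 ∧ A (i / K / K % K) (i / K % K)) ∨
  (i / K / K / K = 1 ∧ E (i / K / K % K) (i % K) / 2 ^ (i / K % K) % 2 = 1) ∨
  (i / K / K / K = 2 ∧ θ / 2 ^ (i / K / K % K) % 2 = 1) ∨
  (i / K / K / K = 3 ∧ i / K / K % K = m) ∨ (i / K / K / K = 4 ∧ i / K / K % K = j)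

open Classical in
/-- The word of length `K ^ 4` with the given bits. -/
noncomputable def word (K : ℕ) (p : ℕ → Prop) : List Bool :=
  (List.range (K ^ 4)).map fun i => decide (p i)

theorem word_inj {K K' : ℕ} {p p' : ℕ → Prop} (h : word K p = word K' p') :
    K = K' ∧ ∀ i < K ^ 4, p i ↔ p' i := by
  have hl := congrArg List.length h
  simp only [word, List.length_map, List.length_range] at hl
  obtain rfl := Nat.pow_left_injective (n := 4) (by norm_num) hl
  refine ⟨rfl, fun i hi => ?_⟩
  have := congrArg (fun l => l[i]?) h
  simpa [word, List.getElem?_range, hi] using this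

/-- The data of a query fit into `K ^ 4` bits. -/
structure Small (K m : ℕ) (E : ℕ → ℕ → ℕ) (j θ : ℕ) : Prop where
  five_le : 5 ≤ K
  m_lt : m < K
  j_lt : j < 5
  θ_lt : θ < 2 ^ K
  E_lt : ∀ a < m, ∀ c < 5, E a c < 2 ^ K

theorem digits {K p q r s : ℕ} (hq : q < K) (hr : r < K) (hs : s < K) :
    (((p * K + q) * K + r) * K + s) / K / K / K = p ∧
    (((p * K + q) * K + r) * K + s) / K / K % K = q ∧
    (((p * K + q) * K + r) * K + s) / K % K = r ∧ (((p * K + q) * K + r) * K + s) % K = s := by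
  have hK : 0 < K := by omega
  have h1 : ∀ x y, y < K → (x * K + y) / K = x := fun x y hy => by
    rw [add_comm, Nat.add_mul_div_right _ _ hK, Nat.div_eq_of_lt hy, zero_add]
  have h2 : ∀ x y, y < K → (x * K + y) % K = y := fun x y hy => by
    rw [add_comm, Nat.add_mul_mod_self_right, Nat.mod_eq_of_lt hy]
  rw [h1 _ _ hs, h1 _ _ hr, h1 _ _ hq, h2 _ _ hs, h2 _ _ hr, h2 _ _ hq]
  simp

theorem eq_of_bits {K x y : ℕ} (hx : x < 2 ^ K) (hy : y < 2 ^ K)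
    (h : ∀ i < K, x / 2 ^ i % 2 = 1 ↔ y / 2 ^ i % 2 = 1) : x = y := by
  refine Nat.eq_of_testBit_eq fun i => ?_
  by_cases hi : i < K
  · rw [Nat.testBit_eq_decide_div_mod_eq, Nat.testBit_eq_decide_div_mod_eq, decide_eq_decide]
    exact h i hi
  · have : 2 ^ K ≤ 2 ^ i := Nat.pow_le_pow_right (by norm_num) (by omega)
    rw [Nat.testBit_lt_two_pow (by omega), Nat.testBit_lt_two_pow (by omega)]

/-- The problem that the oracle solves. -/
def oracle : Set (List Bool) :=
  {w | ∃ K m A E j θ, Small K m E j θ ∧ w = word K (queryBit K m A E j θ) ∧ S.Fits m A E j θ}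

/-- A word does not determine `A` and `E` as functions, but its length gives `K` and its bits give
`m`, `j`, `θ` and the values of `A` and `E` that `Fits` looks at. Since the leading digit is below
`5 ≤ K`, four digits in base `K` address all the data. -/
theorem word_mem_oracle_iff {K m j θ : ℕ} {A : ℕ → ℕ → Prop} {E : ℕ → ℕ → ℕ}
    (hs : Small K m E j θ) :
    word K (queryBit K m A E j θ) ∈ S.oracle ↔ S.Fits m A E j θ := by
  refine ⟨?_, fun h => ⟨K, m, A, E, j, θ, hs, rfl, h⟩⟩
  rintro ⟨K', m', A', E', j', θ', hs', hw, h⟩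
  obtain ⟨rfl, hw⟩ := word_inj hw
  have h5 := hs.five_le
  have key : ∀ p < 5, ∀ q < K, ∀ r < K, ∀ s < K, ((((p * K + q) * K + r) * K + s) < K ^ 4) := by
    intro p hp q hq r hr s hs
    calc ((p * K + q) * K + r) * K + s < (((p * K + q) * K + r) + 1) * K := by linarith
      _ ≤ ((p * K + q + 1) * K) * K := Nat.mul_le_mul_right _ (by linarith)
      _ ≤ (((p + 1) * K) * K) * K :=
        Nat.mul_le_mul_right _ (Nat.mul_le_mul_right _ (by linarith))
      _ ≤ ((K * K) * K) * K := Nat.mul_le_mul_right _ (Nat.mul_le_mul_right _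
        (Nat.mul_le_mul_right _ (by omega)))
      _ = K ^ 4 := by ring
  have bit : ∀ p < 5, ∀ q < K, ∀ r < K, ∀ s < K,
      ((p = 0 ∧ A q r) ∨ (p = 1 ∧ E q s / 2 ^ r % 2 = 1) ∨ (p = 2 ∧ θ / 2 ^ q % 2 = 1) ∨
        (p = 3 ∧ q = m) ∨ (p = 4 ∧ q = j)) ↔
      ((p = 0 ∧ A' q r) ∨ (p = 1 ∧ E' q s / 2 ^ r % 2 = 1) ∨ (p = 2 ∧ θ' / 2 ^ q % 2 = 1) ∨
        (p = 3 ∧ q = m') ∨ (p = 4 ∧ q = j')) := by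
    intro p hp q hq r hr s hs
    have := hw _ (key p hp q hq r hr s hs)
    obtain ⟨e1, e2, e3, e4⟩ := digits (p := p) hq hr hs
    simpa only [queryBit, e1, e2, e3, e4] using this
  have hK : 0 < K := by omega
  obtain rfl : m = m' := by simpa using bit 3 (by norm_num) m hs.m_lt 0 hK 0 hK
  obtain rfl : j = j' := by
    simpa using bit 4 (by norm_num) j (hs.j_lt.trans_le h5) 0 hK 0 hK
  obtain rfl : θ = θ' := eq_of_bits hs.θ_lt hs'.θ_lt fun i hi => by
    simpa using bit 2 (by norm_num) i hi 0 hK 0 hK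
  refine (S.fits_congr (fun a ha b hb => ?_) fun a ha c hc => ?_).2 h
  · simpa using bit 0 (by norm_num) a (ha.trans hs.m_lt) b (hb.trans hs.m_lt) 0 hK
  · refine eq_of_bits (hs.E_lt a ha c hc) (hs'.E_lt a ha c hc) fun i hi => ?_
    simpa using bit 1 (by norm_num) a (ha.trans hs.m_lt) i hi c (hc.trans_le h5)

end TypeSystem

/-- A query whose bits can be computed. -/
theorem CompP.oracle {α : Type*} {L : Set (List Bool)} {Γ : Ctx α} {p : α → ℕ → Prop}
    (hpar : Comp L Γ Γ.par) (hp : ∀ o, CompP L (Γ.ext o) fun q => p q.1 q.2) :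
    CompP L Γ fun a => TypeSystem.word (Γ.par a + 8) (p a) ∈ L := by
  classical
  have hK : Comp L Γ fun a => (Γ.par a + 8) ^ 4 :=
    ((((hpar.add (.const 8)).mul (hpar.add (.const 8))).mul (hpar.add (.const 8))).mul
      (hpar.add (.const 8))).congr fun a => by ring
  -- An iteration with zero rounds: it only writes the bits of the query into a table, from which
  -- `Comp.ask` reads them.
  refine Comp.congr (Comp.letIter (init := fun q => _root_.ind (p q.1 q.2)) (φ := fun _ => 0)
    (h := fun q => if (List.range ((Γ.par q.1 + 8) ^ 4)).map (fun i => decide (q.2 i ≠ 0)) ∈ L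
      then 1 else 0) (.const 0) hK (.const 1) hp (fun _ _ => .const 0)
    (fun o => Comp.ask (HasTab.snd hK.1 (PolyBdd.const 1) o) fun a => le_rfl)) fun a => ?_
  have : (List.range ((Γ.par a + 8) ^ 4)).map (fun i => decide (iterTab ((Γ.par a + 8) ^ 4) 1
      (fun j => _root_.ind (p a j)) (fun _ _ => 0) 0 i ≠ 0)) = TypeSystem.word (Γ.par a + 8) (p a) := by
    refine List.map_congr_left fun i hi => ?_
    rw [List.mem_range] at hi
    rw [decide_eq_decide]
    simp [iterTab, clipTab, hi, ind_le_one]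
  beta_reduce
  rw [this]
  rfl


/-! ## Contracting modules -/

section Contract

variable {V : Type*} {G : SimpleGraph V} {A : Set V}

/-- Add to `S` the vertices of `A` that distinguish vertices of `S`. -/
def spread (G : SimpleGraph V) (A S : Set V) : Set V :=
  S ∪ {z | z ∈ A ∧ ∃ p ∈ S, ∃ q ∈ S, G.Adj z p ∧ ¬ G.Adj z q}

/-- The least module of `G[A]` that contains `u` and `w`. -/
noncomputable def moduleSpan (G : SimpleGraph V) (A : Set V) (u w : V) : Set V :=
  (spread G A)^[Nat.card V] {u, w}

theorem isModuleIn_of_spread_subset {S : Set V} (hS : S ⊆ A) (h : spread G A S ⊆ S) :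
    IsModuleIn G A S := by
  refine isModuleIn_iff.2 ⟨hS, fun v hv hvS u hu u' hu' huv => ?_⟩
  by_contra h'
  exact hvS (h (.inr ⟨hv, u, hu, u', hu', huv, h'⟩))

theorem spread_subset {S M : Set V} (hM : IsModuleIn G A M) (hS : S ⊆ M) : spread G A S ⊆ M := by
  rintro z (hz | ⟨hz, p, hp, q, hq, h1, h2⟩)
  · exact hS hz
  · by_contra hzM
    exact h2 ((hM.adj_iff hz hzM (hS hp) (hS hq)).1 h1)

theorem iterate_spread_subset {S M : Set V} (hM : IsModuleIn G A M) (hS : S ⊆ M) (t : ℕ) :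
    (spread G A)^[t] S ⊆ M := by
  induction t with
  | zero => exact hS
  | succ t ih => rw [Function.iterate_succ_apply']; exact spread_subset hM ih

theorem subset_iterate_spread (S : Set V) (t : ℕ) : S ⊆ (spread G A)^[t] S := by
  induction t with
  | zero => exact subset_rfl
  | succ t ih => rw [Function.iterate_succ_apply']; exact ih.trans Set.subset_union_left

/-- As long as the iteration has not become stationary each step adds a vertex, so `|V|` steps
suffice. -/
theorem spread_iterate_card [Finite V] (S : Set V) :
    spread G A ((spread G A)^[Nat.card V] S) ⊆ (spread G A)^[Nat.card V] S := by
  have key : ∀ t, spread G A ((spread G A)^[t] S) = (spread G A)^[t] S ∨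
      t ≤ ((spread G A)^[t] S).ncard := by
    intro t
    induction t with
    | zero => exact .inr (Nat.zero_le _)
    | succ t ih =>
      rw [Function.iterate_succ_apply']
      by_cases h : spread G A ((spread G A)^[t] S) = (spread G A)^[t] S
      · rw [h]; exact .inl h
      · have h1 : (spread G A)^[t] S ⊂ spread G A ((spread G A)^[t] S) :=
          Set.subset_union_left.ssubset_of_ne (Ne.symm h)
        exact .inr ((ih.resolve_left h).trans_lt (Set.ncard_lt_ncard h1))
  rcases key (Nat.card V) with h | h
  · exact h.subset
  · rw [Set.eq_of_subset_of_ncard_le (Set.subset_univ ((spread G A)^[Nat.card V] S))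
      (by rwa [Set.ncard_univ])]
    exact Set.subset_univ _

theorem left_mem_moduleSpan (u w : V) : u ∈ moduleSpan G A u w :=
  subset_iterate_spread _ _ (by simp)

theorem right_mem_moduleSpan (u w : V) : w ∈ moduleSpan G A u w :=
  subset_iterate_spread _ _ (by simp)

theorem isModuleIn_self : IsModuleIn G A A := ⟨subset_rfl, fun _ h h' => absurd h h'⟩

theorem isModuleIn_moduleSpan [Finite V] {u w : V} (hu : u ∈ A) (hw : w ∈ A) :
    IsModuleIn G A (moduleSpan G A u w) :=
  isModuleIn_of_spread_subset (iterate_spread_subset isModuleIn_self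
    (Set.insert_subset hu (Set.singleton_subset_iff.2 hw)) _) (spread_iterate_card _)

theorem moduleSpan_subset {M : Set V} (hM : IsModuleIn G A M) {u w : V} (hu : u ∈ M) (hw : w ∈ M) :
    moduleSpan G A u w ⊆ M :=
  iterate_spread_subset hM (Set.insert_subset hu (Set.singleton_subset_iff.2 hw)) _

/-- A module spanned by two vertices that is smallest among all of these contains no smaller
nontrivial module. -/
theorem eq_moduleSpan_of_subset [Finite V] {u w : V}
    (hmin : ∀ u' ∈ A, ∀ w' ∈ A, u' ≠ w' →
      (moduleSpan G A u w).ncard ≤ (moduleSpan G A u' w').ncard)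
    {M : Set V} (hM : IsModuleIn G A M) (hsub : M ⊆ moduleSpan G A u w) (hne : M.Nontrivial) :
    M = moduleSpan G A u w := by
  obtain ⟨u', hu', w', hw', hne⟩ := hne
  exact Set.eq_of_subset_of_ncard_le hsub ((hmin u' (hM.1 hu') w' (hM.1 hw') hne).trans
    (Set.ncard_le_ncard (moduleSpan_subset hM hu' hw')))

/-- The map `π` contracts the vertices of `G` to those of `G[A]`, in such a way that adjacencies
between different classes are kept. -/
structure IsContraction (G : SimpleGraph V) (A : Set V) (π : V → V) : Prop where
  mem : ∀ v, π v ∈ A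
  id : ∀ a ∈ A, π a = a
  adj : ∀ u v, π u ≠ π v → (G.Adj u v ↔ G.Adj (π u) (π v))

variable {π : V → V} {M : Set V} {r : V}

open Classical in
theorem IsContraction.merge (h : IsContraction G A π) (hM : IsModuleIn G A M) (hr : r ∈ M) :
    IsContraction G (A \ M ∪ {r}) fun v => if π v ∈ M then r else π v where
  mem v := by
    split_ifs with hv
    exacts [.inr rfl, .inl ⟨h.mem v, hv⟩]
  id a ha := by
    rcases ha with ⟨ha, haM⟩ | rfl
    · rw [h.id a ha, if_neg haM]
    · rw [h.id a (hM.1 hr), if_pos hr]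
  adj u v := by
    split_ifs with hu hv hv
    · exact fun h => absurd rfl h
    · intro _
      rw [h.adj u v (fun h => hv (h ▸ hu)), G.adj_comm, G.adj_comm r]
      exact hM.adj_iff (h.mem v) hv hu hr
    · intro _
      rw [h.adj u v (fun h => hu (h ▸ hv))]
      exact hM.adj_iff (h.mem u) hu hv hr
    · exact h.adj u v

theorem IsContraction.isSubstitution {ι : Type*} (h : IsContraction G A π) {Q : SimpleGraph ι}
    {e : ι → V} (he : Function.Injective e) (hQ : ∀ i j, Q.Adj i j ↔ G.Adj (e i) (e j)) :
    IsSubstitution G Q fun i => π ⁻¹' {e i} where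
  disj := fun {i j v} hi hj => he ((show π v = e i from hi).symm.trans hj)
  adj := fun {i j} hij {u v} hu hv => by
    have hu : π u = e i := hu
    have hv : π v = e j := hv
    rw [h.adj u v (by rw [hu, hv]; exact he.ne hij), hQ, hu, hv]

end Contract


/-! ## The algorithm -/

section Algorithm

/-- The `i`-th bit of `x` is set. -/
def bitAt (x : List Bool) (i : ℕ) : Prop := x.getD i false = true

/-- The number of vertices of the encoded graph. -/
noncomputable def vertexCount (x : List Bool) : ℕ := bfind x.length fun i => ¬ bitAt x i

/-- The adjacency relation of the encoded graph. -/
def adjAt (x : List Bool) (u v : ℕ) : Prop :=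
  bitAt x (vertexCount x + 1 + (u * vertexCount x + v))

/-- The indicator of the least module that contains `u` and `w` and consists of vertices alive in
the state `s`. -/
noncomputable def spanTab (x : List Bool) (s : ℕ → ℕ) (u w : ℕ) : ℕ → ℕ :=
  iterTab (vertexCount x) 1 (fun z => ind (z = u ∨ z = w)) (fun C z => ind (C z ≠ 0 ∨
    s (8 * z) ≠ 0 ∧ ∃ p < vertexCount x, C p ≠ 0 ∧ ∃ q < vertexCount x, C q ≠ 0 ∧
      adjAt x z p ∧ ¬ adjAt x z q)) (vertexCount x)

/-- The size of a spanned module. -/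
noncomputable def spanSize (x : List Bool) (s : ℕ → ℕ) (u w : ℕ) : ℕ :=
  ∑ z ∈ Finset.range (vertexCount x), spanTab x s u w z

/-- The number `c` codes a pair of distinct vertices that are alive. -/
def IsPair (x : List Bool) (s : ℕ → ℕ) (c : ℕ) : Prop :=
  s (8 * (c / vertexCount x)) ≠ 0 ∧ s (8 * (c % vertexCount x)) ≠ 0 ∧
    c / vertexCount x ≠ c % vertexCount x

/-- The size of the module spanned by the pair with code `c`. -/
noncomputable def pairSize (x : List Bool) (s : ℕ → ℕ) (c : ℕ) : ℕ :=
  spanSize x s (c / vertexCount x) (c % vertexCount x)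

/-- The code of a pair of vertices that spans a module of minimum size. -/
noncomputable def bestPair (x : List Bool) (s : ℕ → ℕ) : ℕ :=
  bfind (vertexCount x * vertexCount x) fun c => IsPair x s c ∧
    ∀ c' < vertexCount x * vertexCount x, IsPair x s c' → pairSize x s c ≤ pairSize x s c'

/-- The indicator of the module to be contracted. -/
noncomputable def contractTab (x : List Bool) (s : ℕ → ℕ) : ℕ → ℕ :=
  spanTab x s (bestPair x s / vertexCount x) (bestPair x s % vertexCount x)

/-- The size of the module to be contracted. -/
noncomputable def contractSize (x : List Bool) (s : ℕ → ℕ) : ℕ :=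
  pairSize x s (bestPair x s)

/-- The vertices of the module to be contracted, numbered. -/
noncomputable def contractElt (x : List Bool) (s : ℕ → ℕ) (a : ℕ) : ℕ :=
  bfind (vertexCount x) fun z => contractTab x s z ≠ 0 ∧
    ∑ i ∈ Finset.range z, contractTab x s i = a

/-- The adjacency relation on the module to be contracted. -/
def contractAdj (x : List Bool) (s : ℕ → ℕ) (a b : ℕ) : Prop :=
  adjAt x (contractElt x s a) (contractElt x s b)

/-- The data of the vertices of the module to be contracted. -/
noncomputable def contractData (x : List Bool) (s : ℕ → ℕ) (a t : ℕ) : ℕ :=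
  s (8 * contractElt x s a + 1 + t)

open TypeSystem in
/-- The new data of type `j` exceed `θ`: if there are many vertices in terms of the parameter, the
choices of types for the contracted vertices are tried one by one. -/
def NewDataGT (L : Set (List Bool)) (x : List Bool) (k : ℕ) (s : ℕ → ℕ) (j θ : ℕ) : Prop :=
  (vertexCount x < min (2 ^ k) (vertexCount x + 1) ∧
    word (k + 8) (queryBit (k + 8) (contractSize x s) (contractAdj x s) (contractData x s) j θ) ∈ L) ∨
  (¬ vertexCount x < min (2 ^ k) (vertexCount x + 1) ∧
    ∃ c < 25 * ((vertexCount x + 1) * (vertexCount x + 1) * (vertexCount x + 1)),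
      word (k + 8) (queryBit (k + 8) (contractSize x s) (contractAdj x s)
        (fun a t => ind (c / 5 ^ a % 5 = t)) j 0) ∈ L ∧
      (∀ a < contractSize x s, contractData x s a (c / 5 ^ a % 5) ≠ 0) ∧
      θ ≤ ∑ a ∈ Finset.range (contractSize x s), (contractData x s a (c / 5 ^ a % 5) - 1))

/-- The new data of type `j`. -/
noncomputable def newData (L : Set (List Bool)) (x : List Bool) (k : ℕ) (s : ℕ → ℕ) (j : ℕ) : ℕ :=
  ∑ θ ∈ Finset.range (vertexCount x + 1), ind (NewDataGT L x k s j θ)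

/-- One round of the algorithm. In the state `s`, the entry `8 * v` tells whether `v` is alive, the
entry `8 * v + 1 + j` is the optimum of type `j` in the class of `v`, and the entry `6` is the
largest size of a prime module so far. -/
noncomputable def roundTab (L : Set (List Bool)) (x : List Bool) (k : ℕ) (s : ℕ → ℕ) (i : ℕ) : ℕ :=
  if bestPair x s < vertexCount x * vertexCount x then
    if i % 8 = 0 then
      ind (s i ≠ 0 ∧ (contractTab x s (i / 8) = 0 ∨ i / 8 = bestPair x s / vertexCount x))
    else if i = 6 then
      if 2 < contractSize x s ∧ s 6 < contractSize x s then contractSize x s else s 6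
    else if i / 8 = bestPair x s / vertexCount x ∧ i % 8 < 6 then newData L x k s (i % 8 - 1)
    else s i
  else s i

/-! ### It can be computed -/

/-- The context has access to an input and a state. -/
structure Env {β : Type*} (L : Set (List Bool)) (Δ : Ctx β) (x : β → List Bool) (k : β → ℕ)
    (s : β → ℕ → ℕ) : Prop where
  tabx : HasTab Δ (fun b => (x b).length) fun b j => ((x b).getD j false).toNat
  len : Comp L Δ fun b => (x b).length
  tabs : ∃ ls, HasTab Δ ls s
  par_eq : ∀ b, Δ.par b = k b
  par : Comp L Δ k

namespace Env

variable {β : Type*} {L : Set (List Bool)} {Δ : Ctx β} {x : β → List Bool} {k : β → ℕ}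
  {s : β → ℕ → ℕ} {u w z : β → ℕ}

theorem ext (h : Env L Δ x k s) (o : ℕ) :
    Env L (Δ.ext o) (fun q => x q.1) (fun q => k q.1) (fun q => s q.1) where
  tabx := h.tabx.fst_ext o
  len := h.len.fst_ext
  tabs := let ⟨_, hs⟩ := h.tabs; ⟨_, hs.fst_ext o⟩
  par_eq q := h.par_eq q.1
  par := h.par.fst_ext

theorem tab (h : Env L Δ x k s) (o : ℕ) (len cap : β → ℕ) :
    Env L (Δ.tab o len cap) (fun q => x q.1) (fun q => k q.1) (fun q => s q.1) where
  tabx := h.tabx.fst_tab o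
  len := h.len.fst_tab
  tabs := let ⟨_, hs⟩ := h.tabs; ⟨_, hs.fst_tab o⟩
  par_eq q := h.par_eq q.1
  par := h.par.fst_tab

theorem state (h : Env L Δ x k s) (hz : Comp L Δ z) : Comp L Δ fun b => s b (z b) :=
  let ⟨_, hs⟩ := h.tabs
  Comp.lookup hs hz

theorem bitAt (h : Env L Δ x k s) (hz : Comp L Δ z) : CompP L Δ fun b => bitAt (x b) (z b) :=
  (Comp.lookup h.tabx hz).ne_zero.congr fun b => by simp [_root_.bitAt]

theorem vertexCount (h : Env L Δ x k s) : Comp L Δ fun b => vertexCount (x b) :=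
  Comp.bfind (p := fun b i => ¬ _root_.bitAt (x b) i) h.len fun o => ((h.ext o).bitAt .var).not

theorem vertexCount_sq (h : Env L Δ x k s) :
    Comp L Δ fun b => _root_.vertexCount (x b) * _root_.vertexCount (x b) :=
  h.vertexCount.mul h.vertexCount

theorem adjAt (h : Env L Δ x k s) (hu : Comp L Δ u) (hw : Comp L Δ w) :
    CompP L Δ fun b => adjAt (x b) (u b) (w b) :=
  h.bitAt ((h.vertexCount.add (.const 1)).add ((hu.mul h.vertexCount).add hw))

theorem spanTab (h : Env L Δ x k s) (hu : Comp L Δ u) (hw : Comp L Δ w) (hz : Comp L Δ z) :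
    Comp L Δ fun b => spanTab (x b) (s b) (u b) (w b) (z b) := by
  refine Comp.letIter (m := fun b => _root_.vertexCount (x b))
    (len := fun b => _root_.vertexCount (x b)) (cap := fun _ => 1)
    (init := fun q => ind (q.2 = u q.1 ∨ q.2 = w q.1))
    (φ := fun q => ind (q.1.2 q.2 ≠ 0 ∨ s q.1.1 (8 * q.2) ≠ 0 ∧
      ∃ p < _root_.vertexCount (x q.1.1), q.1.2 p ≠ 0 ∧ ∃ r < _root_.vertexCount (x q.1.1),
        q.1.2 r ≠ 0 ∧ _root_.adjAt (x q.1.1) q.2 p ∧ ¬ _root_.adjAt (x q.1.1) q.2 r))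
    (h := fun q => q.2 (z q.1)) h.vertexCount h.vertexCount (.const 1)
    (fun o => ((Comp.var.eq hu.fst_ext).or (Comp.var.eq hw.fst_ext)).ind) (fun o o' => ?_)
    (fun o => Comp.lookup (HasTab.snd h.vertexCount.1 (PolyBdd.const 1) o) hz.fst_tab)
  have e := (h.tab o (fun b => _root_.vertexCount (x b)) (fun _ => 1)).ext o'
  have t := (HasTab.snd (Γ := Δ) h.vertexCount.1 (PolyBdd.const 1) o).fst_ext o'
  refine CompP.ind (CompP.or (Comp.lookup t .var).ne_zero (CompP.and
    (e.state ((Comp.const 8).mul .var)).ne_zero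
    (CompP.exists_lt (p := fun q p => q.1.2 p ≠ 0 ∧ ∃ r < _root_.vertexCount (x q.1.1),
      q.1.2 r ≠ 0 ∧ _root_.adjAt (x q.1.1) q.2 p ∧ ¬ _root_.adjAt (x q.1.1) q.2 r)
      e.vertexCount fun o1 => CompP.and (Comp.lookup (t.fst_ext o1) .var).ne_zero
    (CompP.exists_lt (p := fun q r => q.1.1.2 r ≠ 0 ∧
      _root_.adjAt (x q.1.1.1) q.1.2 q.2 ∧ ¬ _root_.adjAt (x q.1.1.1) q.1.2 r)
      (e.ext o1).vertexCount fun o2 =>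
        CompP.and (Comp.lookup ((t.fst_ext o1).fst_ext o2) .var).ne_zero
        (CompP.and (((e.ext o1).ext o2).adjAt Comp.var.fst_ext.fst_ext Comp.var.fst_ext)
          (((e.ext o1).ext o2).adjAt Comp.var.fst_ext.fst_ext .var).not)))))

theorem spanSize (h : Env L Δ x k s) (hu : Comp L Δ u) (hw : Comp L Δ w) :
    Comp L Δ fun b => spanSize (x b) (s b) (u b) (w b) :=
  Comp.sum (g := fun q => _root_.spanTab (x q.1) (s q.1) (u q.1) (w q.1) q.2) h.vertexCount
    fun o => (h.ext o).spanTab hu.fst_ext hw.fst_ext .var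

theorem isPair (h : Env L Δ x k s) (hz : Comp L Δ z) :
    CompP L Δ fun b => IsPair (x b) (s b) (z b) :=
  CompP.and (h.state ((Comp.const 8).mul (hz.div h.vertexCount))).ne_zero (CompP.and
    (h.state ((Comp.const 8).mul (hz.mod h.vertexCount))).ne_zero
    ((hz.div h.vertexCount).ne (hz.mod h.vertexCount)))

theorem pairSize (h : Env L Δ x k s) (hz : Comp L Δ z) :
    Comp L Δ fun b => pairSize (x b) (s b) (z b) :=
  h.spanSize (hz.div h.vertexCount) (hz.mod h.vertexCount)

theorem bestPair (h : Env L Δ x k s) : Comp L Δ fun b => bestPair (x b) (s b) := by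
  refine Comp.bfind (p := fun b c => IsPair (x b) (s b) c ∧
    ∀ c' < _root_.vertexCount (x b) * _root_.vertexCount (x b), IsPair (x b) (s b) c' →
      _root_.pairSize (x b) (s b) c ≤ _root_.pairSize (x b) (s b) c')
    (h.vertexCount.mul h.vertexCount) fun o => CompP.and ((h.ext o).isPair .var) ?_
  refine CompP.forall_lt (p := fun q c' => IsPair (x q.1) (s q.1) c' →
      _root_.pairSize (x q.1) (s q.1) q.2 ≤ _root_.pairSize (x q.1) (s q.1) c')
    (h.ext o).vertexCount_sq fun o' => ?_
  have e := (h.ext o).ext o'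
  have h1 := e.isPair (z := fun q => q.2) .var
  have h2 := e.pairSize (z := fun q => q.1.2) Comp.var.fst_ext
  have h3 := e.pairSize (z := fun q => q.2) .var
  exact CompP.imp h1 (Comp.le h2 h3)

theorem contractTab (h : Env L Δ x k s) (hz : Comp L Δ z) :
    Comp L Δ fun b => contractTab (x b) (s b) (z b) :=
  h.spanTab (h.bestPair.div h.vertexCount) (h.bestPair.mod h.vertexCount) hz

theorem contractSize (h : Env L Δ x k s) : Comp L Δ fun b => contractSize (x b) (s b) :=
  h.pairSize h.bestPair

theorem contractRank (h : Env L Δ x k s) (o : ℕ) : Comp L (Δ.ext o) fun q =>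
    ∑ i ∈ Finset.range q.2, _root_.contractTab (x q.1) (s q.1) i := by
  have key : ∀ o', Comp L ((Δ.ext o).ext o') fun q =>
      _root_.contractTab (x q.1.1) (s q.1.1) q.2 := fun o' => by
    have := ((h.ext o).ext o').contractTab (z := fun q => q.2) .var
    exact this
  have := Comp.sum Comp.var key
  exact this

theorem contractElt (h : Env L Δ x k s) (hz : Comp L Δ z) :
    Comp L Δ fun b => contractElt (x b) (s b) (z b) := by
  have key : ∀ o, CompP L (Δ.ext o) fun q => _root_.contractTab (x q.1) (s q.1) q.2 ≠ 0 ∧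
      ∑ i ∈ Finset.range q.2, _root_.contractTab (x q.1) (s q.1) i = z q.1 := fun o => by
    have h1 := (h.ext o).contractTab (z := fun q => q.2) .var
    have h2 : Comp L (Δ.ext o) fun q => z q.1 := hz.fst_ext
    have h3 := (h.contractRank o).eq h2
    exact h1.ne_zero.and h3
  have := Comp.bfind (p := fun b v => _root_.contractTab (x b) (s b) v ≠ 0 ∧
    ∑ i ∈ Finset.range v, _root_.contractTab (x b) (s b) i = z b) h.vertexCount key
  exact this

theorem contractAdj (h : Env L Δ x k s) (hu : Comp L Δ u) (hw : Comp L Δ w) :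
    CompP L Δ fun b => contractAdj (x b) (s b) (u b) (w b) :=
  h.adjAt (h.contractElt hu) (h.contractElt hw)

theorem contractData (h : Env L Δ x k s) (hu : Comp L Δ u) (hw : Comp L Δ w) :
    Comp L Δ fun b => contractData (x b) (s b) (u b) (w b) :=
  h.state ((((Comp.const 8).mul (h.contractElt hu)).add (.const 1)).add hw)

/-- The bits of a query to the oracle can be computed. -/
theorem _root_.CompP.queryBit {K m j θ i : β → ℕ} {A : β → ℕ → ℕ → Prop}
    {E : β → ℕ → ℕ → ℕ} (hK : Comp L Δ K) (hm : Comp L Δ m) (hj : Comp L Δ j) (hθ : Comp L Δ θ)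
    (hi : Comp L Δ i)
    (hA : ∀ {u w}, Comp L Δ u → Comp L Δ w → CompP L Δ fun b => A b (u b) (w b))
    (hE : ∀ {u w}, Comp L Δ u → Comp L Δ w → Comp L Δ fun b => E b (u b) (w b)) :
    CompP L Δ fun b => TypeSystem.queryBit (K b) (m b) (A b) (E b) (j b) (θ b) (i b) := by
  have h1 := (hi.div hK)
  have h2 := (h1.div hK)
  have h3 := h2.div hK
  have p := fun c => h3.eq (.const c)
  exact ((p 0).and (hA (h2.mod hK) (h1.mod hK))).or
    (((p 1).and (((Comp.div_pow 2 (hE (h2.mod hK) (hi.mod hK)) (h1.mod hK)).mod (.const 2)).eq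
      (.const 1))).or
    (((p 2).and (((Comp.div_pow 2 hθ (h2.mod hK)).mod (.const 2)).eq (.const 1))).or
    (((p 3).and ((h2.mod hK).eq hm)).or ((p 4).and ((h2.mod hK).eq hj)))))

theorem oracle (h : Env L Δ x k s) {m j θ : β → ℕ} {A : β → ℕ → ℕ → Prop}
    {E : β → ℕ → ℕ → ℕ} (hm : Comp L Δ m) (hj : Comp L Δ j) (hθ : Comp L Δ θ)
    (hA : ∀ o {u w}, Comp L (Δ.ext o) u → Comp L (Δ.ext o) w →
      CompP L (Δ.ext o) fun b => A b.1 (u b) (w b))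
    (hE : ∀ o {u w}, Comp L (Δ.ext o) u → Comp L (Δ.ext o) w →
      Comp L (Δ.ext o) fun b => E b.1 (u b) (w b)) :
    CompP L Δ fun b => TypeSystem.word (k b + 8)
      (TypeSystem.queryBit (k b + 8) (m b) (A b) (E b) (j b) (θ b)) ∈ L := by
  have hk : Δ.par = k := funext h.par_eq
  have := CompP.oracle (L := L) (Γ := Δ)
    (p := fun b i => TypeSystem.queryBit (k b + 8) (m b) (A b) (E b) (j b) (θ b) i)
    (hk ▸ h.par) fun o => CompP.queryBit (A := fun q => A q.1) (E := fun q => E q.1)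
      ((h.ext o).par.add (.const 8)) hm.fst_ext hj.fst_ext hθ.fst_ext .var (hA o) (hE o)
  rwa [hk] at this

theorem newDataGT (h : Env L Δ x k s) {j θ : β → ℕ} (hj : Comp L Δ j) (hθ : Comp L Δ θ) :
    CompP L Δ fun b => NewDataGT L (x b) (k b) (s b) (j b) (θ b) := by
  have hn := h.vertexCount
  -- The minimum with `n + 1` does not affect the comparison of `n` with `2 ^ k`, but keeps the
  -- right-hand side computable.
  have hlt := hn.lt (Comp.min_two_pow (hn.add (.const 1)) h.par)
  refine (hlt.and ?_).or (hlt.not.and ?_)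
  · exact h.oracle h.contractSize hj hθ (fun o => (h.ext o).contractAdj)
      (fun o => (h.ext o).contractData)
  have hn1 := hn.add (.const 1)
  refine CompP.exists_lt (p := fun b c => TypeSystem.word (k b + 8) (TypeSystem.queryBit (k b + 8)
      (_root_.contractSize (x b) (s b)) (_root_.contractAdj (x b) (s b))
        (fun a t => ind (c / 5 ^ a % 5 = t)) (j b) 0) ∈ L ∧
      (∀ a < _root_.contractSize (x b) (s b),
        _root_.contractData (x b) (s b) a (c / 5 ^ a % 5) ≠ 0) ∧
      θ b ≤ ∑ a ∈ Finset.range (_root_.contractSize (x b) (s b)),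
        (_root_.contractData (x b) (s b) a (c / 5 ^ a % 5) - 1))
    ((Comp.const 25).mul ((hn1.mul hn1).mul hn1)) fun o => ?_
  have e := h.ext o
  have key : ∀ o', Comp L ((Δ.ext o).ext o') fun q => _root_.contractData (x q.1.1) (s q.1.1) q.2
      (q.1.2 / 5 ^ q.2 % 5) := fun o' =>
    (e.ext o').contractData .var ((Comp.div_pow 5 Comp.var.fst_ext .var).mod (.const 5))
  refine CompP.and ?_ (CompP.and ?_ ?_)
  · exact e.oracle (A := fun q => _root_.contractAdj (x q.1) (s q.1))
      (E := fun q a t => ind (q.2 / 5 ^ a % 5 = t)) e.contractSize hj.fst_ext (.const 0)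
      (fun o' => (e.ext o').contractAdj)
      (fun o' {u w} hu hw => (((Comp.div_pow 5 Comp.var.fst_ext hu).mod (.const 5)).eq hw).ind)
  · exact CompP.forall_lt (p := fun q a => _root_.contractData (x q.1) (s q.1) a
      (q.2 / 5 ^ a % 5) ≠ 0) e.contractSize fun o' => (key o').ne_zero
  · exact hθ.fst_ext.le (Comp.sum (g := fun q => _root_.contractData (x q.1.1) (s q.1.1) q.2
      (q.1.2 / 5 ^ q.2 % 5) - 1) e.contractSize fun o' => (key o').sub (.const 1))

theorem newData (h : Env L Δ x k s) {j : β → ℕ} (hj : Comp L Δ j) :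
    Comp L Δ fun b => newData L (x b) (k b) (s b) (j b) :=
  Comp.sum (g := fun q => ind (NewDataGT L (x q.1) (k q.1) (s q.1) (j q.1) q.2))
    (h.vertexCount.add (.const 1)) fun o => ((h.ext o).newDataGT hj.fst_ext .var).ind

theorem roundTab (h : Env L Δ x k s) (hz : Comp L Δ z) :
    Comp L Δ fun b => roundTab L (x b) (k b) (s b) (z b) := by
  have hn := h.vertexCount
  have hU := h.bestPair.div hn
  have hv := hz.div (.const 8)
  have hc := hz.mod (.const 8)
  exact Comp.ite (h.bestPair.lt (hn.mul hn))
    (Comp.ite (hc.eq (.const 0))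
      ((h.state hz).ne_zero.and (((h.contractTab hv).eq (.const 0)).or (hv.eq hU))).ind
      (Comp.ite (hz.eq (.const 6))
        (Comp.ite (((Comp.const 2).lt h.contractSize).and ((h.state (.const 6)).lt h.contractSize))
          h.contractSize (h.state (.const 6)))
        (Comp.ite ((hv.eq hU).and (hc.lt (.const 6))) (h.newData (hc.sub (.const 1)))
          (h.state hz))))
    (h.state hz)

end Env

end Algorithm


/-! ### The algorithm is correct -/

section Correct

variable {x : List Bool} {s : ℕ → ℕ} {G : SimpleGraph (Fin (vertexCount x))}

theorem sum_range_eq_ncard {n : ℕ} {t : ℕ → ℕ} (ht : ∀ i, t i ≤ 1) :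
    ∑ i ∈ Finset.range n, t i = {v : Fin n | t v ≠ 0}.ncard := by
  classical
  rw [Set.ncard_eq_toFinset_card', ← Fin.sum_univ_eq_sum_range, Set.toFinset_ofPred,
    Finset.card_filter]
  refine Finset.sum_congr rfl fun i _ => ?_
  have := ht i
  split_ifs <;> omega

/-- The vertices that are alive in the state `s`. -/
def aliveSet (x : List Bool) (s : ℕ → ℕ) : Set (Fin (vertexCount x)) := {v | s (8 * v) ≠ 0}

/-- The string `x` encodes the graph `G`. -/
def Encodes (x : List Bool) (G : SimpleGraph (Fin (vertexCount x))) : Prop :=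
  ∀ u v : Fin (vertexCount x), adjAt x u v ↔ G.Adj u v

theorem spanTab_ne_zero_iff (hG : Encodes x G) (u w v : Fin (vertexCount x)) :
    spanTab x s u w v ≠ 0 ↔ v ∈ moduleSpan G (aliveSet x s) u w := by
  have key : ∀ t, ∀ v : Fin (vertexCount x), iterTab (vertexCount x) 1
      (fun z => ind (z = (u : ℕ) ∨ z = w)) (fun C z => ind (C z ≠ 0 ∨
      s (8 * z) ≠ 0 ∧ ∃ p < vertexCount x, C p ≠ 0 ∧ ∃ q < vertexCount x, C q ≠ 0 ∧
        adjAt x z p ∧ ¬ adjAt x z q)) t v ≠ 0 ↔ v ∈ (spread G (aliveSet x s))^[t] {u, w} := by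
    intro t
    induction t with
    | zero =>
      intro v
      simp [iterTab, clipTab, ind_le_one, Fin.ext_iff, or_iff_not_imp_left]
    | succ t ih =>
      intro v
      rw [Function.iterate_succ_apply', iterTab, clipTab, if_pos v.2, min_eq_left (ind_le_one _),
        ne_eq, ind_eq_zero, not_not, ih v]
      refine or_congr_right (and_congr_right fun hv => ?_)
      constructor
      · rintro ⟨p, hp, hp', q, hq, hq', h1, h2⟩
        exact ⟨⟨p, hp⟩, (ih ⟨p, hp⟩).1 hp', ⟨q, hq⟩, (ih ⟨q, hq⟩).1 hq',
          (hG v ⟨p, hp⟩).1 h1, fun h => h2 ((hG v ⟨q, hq⟩).2 h)⟩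
      · rintro ⟨p, hp, q, hq, h1, h2⟩
        exact ⟨p, p.2, (ih p).2 hp, q, q.2, (ih q).2 hq, (hG v p).2 h1, fun h => h2 ((hG v q).1 h)⟩
  rw [spanTab, key, moduleSpan, Nat.card_fin]

theorem spanTab_le (u w v : ℕ) : spanTab x s u w v ≤ 1 := iterTab_le _ _ _ _ _ _

theorem spanSize_eq (hG : Encodes x G) (u w : Fin (vertexCount x)) :
    spanSize x s u w = (moduleSpan G (aliveSet x s) u w).ncard := by
  rw [spanSize, sum_range_eq_ncard fun _ => spanTab_le _ _ _]
  simp only [spanTab_ne_zero_iff hG, Set.ofPred_mem_eq]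

/-- The result of the search for a pair of vertices. -/
theorem bestPair_spec (hG : Encodes x G)
    (h : bestPair x s < vertexCount x * vertexCount x) :
    ∃ u ∈ aliveSet x s, ∃ w ∈ aliveSet x s, u ≠ w ∧ bestPair x s / vertexCount x = u ∧
      bestPair x s % vertexCount x = w ∧ ∀ u' ∈ aliveSet x s, ∀ w' ∈ aliveSet x s, u' ≠ w' →
        (moduleSpan G (aliveSet x s) u w).ncard ≤ (moduleSpan G (aliveSet x s) u' w').ncard := by
  obtain ⟨h1, ⟨⟨h2, h3, h4⟩, h5⟩, -⟩ := bfind_spec (bfind_lt_iff.1 h)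
  rw [← bestPair] at h2 h3 h4 h5
  have hn : 0 < vertexCount x := by
    by_contra h0
    rw [Nat.eq_zero_of_not_pos h0] at h
    simp at h
  refine ⟨⟨_, Nat.div_lt_of_lt_mul h⟩, h2, ⟨_, Nat.mod_lt _ hn⟩, h3,
    fun he => h4 (congrArg Fin.val he), rfl, rfl, fun u' hu' w' hw' hne => ?_⟩
  have hlt : (u' : ℕ) * vertexCount x + w' < vertexCount x * vertexCount x := by
    calc (u' : ℕ) * vertexCount x + w' < (u' + 1) * vertexCount x := by linarith [w'.2]
      _ ≤ _ := Nat.mul_le_mul_right _ u'.2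
  have e1 : ((u' : ℕ) * vertexCount x + w') / vertexCount x = u' := by
    rw [add_comm, Nat.add_mul_div_right _ _ hn, Nat.div_eq_of_lt w'.2, zero_add]
  have e2 : ((u' : ℕ) * vertexCount x + w') % vertexCount x = w' := by
    rw [add_comm, Nat.add_mul_mod_self_right, Nat.mod_eq_of_lt w'.2]
  have := h5 _ hlt ⟨by rw [e1]; exact hu', by rw [e2]; exact hw', by
    rw [e1, e2]; exact fun h => hne (Fin.ext h)⟩
  rw [pairSize, pairSize, e1, e2, spanSize_eq hG] at this
  rwa [← spanSize_eq hG]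

/-- If two vertices are alive, the finite set of codes of pairs is nonempty and has an element that
spans a module of minimum size. So the search fails only when the contraction is complete. -/
theorem bestPair_of_not (h : ¬ bestPair x s < vertexCount x * vertexCount x) :
    (aliveSet x s).Subsingleton := by
  intro u hu w hw
  by_contra hne
  refine h (bfind_lt_iff.2 ?_)
  have hn : 0 < vertexCount x := u.pos
  have hlt : (u : ℕ) * vertexCount x + w < vertexCount x * vertexCount x := by
    calc (u : ℕ) * vertexCount x + w < (u + 1) * vertexCount x := by linarith [w.2]
      _ ≤ _ := Nat.mul_le_mul_right _ u.2
  have e1 : ((u : ℕ) * vertexCount x + w) / vertexCount x = u := by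
    rw [add_comm, Nat.add_mul_div_right _ _ hn, Nat.div_eq_of_lt w.2, zero_add]
  have e2 : ((u : ℕ) * vertexCount x + w) % vertexCount x = w := by
    rw [add_comm, Nat.add_mul_mod_self_right, Nat.mod_eq_of_lt w.2]
  have hp : {c | c < vertexCount x * vertexCount x ∧ IsPair x s c}.Nonempty :=
    ⟨_, hlt, by rw [e1]; exact hu, by rw [e2]; exact hw, by
      rw [e1, e2]; exact fun h => hne (Fin.ext h)⟩
  obtain ⟨c, ⟨hc, hc'⟩, hmin⟩ := Set.exists_min_image _ (pairSize x s)
    ((Set.finite_lt_nat _).subset fun c hc => hc.1) hp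
  exact ⟨c, hc, hc', fun c' h1 h2 => hmin c' ⟨h1, h2⟩⟩

/-- The partial sums of a `0`/`1` sequence grow by at most one, so each value below the total is
reached, and left, at a nonzero term. This numbers the elements of a set given by its indicator. -/
theorem exists_rank {n m : ℕ} {t : ℕ → ℕ} (ht : ∀ i, t i ≤ 1) (hm : m < ∑ i ∈ Finset.range n, t i) :
    ∃ z < n, t z ≠ 0 ∧ ∑ i ∈ Finset.range z, t i = m := by
  induction n with
  | zero => simp at hm
  | succ n ih =>
    rw [Finset.sum_range_succ] at hm
    by_cases h : m < ∑ i ∈ Finset.range n, t i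
    · obtain ⟨z, hz, h1⟩ := ih h
      exact ⟨z, by omega, h1⟩
    · have := ht n
      exact ⟨n, by omega, by omega, by omega⟩

theorem rank_lt {t : ℕ → ℕ} {z z' : ℕ} (hz : t z ≠ 0) (h : z < z') :
    ∑ i ∈ Finset.range z, t i < ∑ i ∈ Finset.range z', t i := by
  have h1 : ∑ i ∈ Finset.range (z + 1), t i ≤ ∑ i ∈ Finset.range z', t i :=
    Finset.sum_le_sum_of_subset (Finset.range_subset_range.2 h)
  rw [Finset.sum_range_succ] at h1
  omega

/-- The numbering of the module to be contracted. -/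
theorem exists_numbering : ∃ e : Fin (contractSize x s) → Fin (vertexCount x),
    (∀ a : Fin (contractSize x s), contractElt x s a = e a) ∧ Function.Injective e ∧
      ∀ v : Fin (vertexCount x), contractTab x s v ≠ 0 ↔ v ∈ Set.range e := by
  have ht : ∀ i, contractTab x s i ≤ 1 := fun _ => spanTab_le _ _ _
  have hspec : ∀ a : Fin (contractSize x s), _ := fun a => bfind_spec (exists_rank ht a.2)
  refine ⟨fun a => ⟨contractElt x s a, (hspec a).1⟩, fun a => rfl, fun a b hab => ?_, fun v =>
    ⟨fun hv => ?_, ?_⟩⟩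
  · have h1 := (hspec a).2.1.2
    have h2 := (hspec b).2.1.2
    have h3 : contractElt x s a = contractElt x s b := congrArg Fin.val hab
    rw [contractElt, contractElt] at h3
    rw [h3, h2] at h1
    exact Fin.ext h1.symm
  · have hlt : ∑ i ∈ Finset.range v, contractTab x s i < contractSize x s := rank_lt hv v.2
    refine ⟨⟨_, hlt⟩, Fin.ext ?_⟩
    obtain ⟨-, ⟨h1, h2⟩, -⟩ := hspec ⟨_, hlt⟩
    rw [← contractElt] at h1 h2
    show contractElt x s (∑ i ∈ Finset.range v, contractTab x s i) = v
    generalize contractElt x s (∑ i ∈ Finset.range v, contractTab x s i) = y at h1 h2 ⊢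
    have h2 : ∑ i ∈ Finset.range y, contractTab x s i = ∑ i ∈ Finset.range v, contractTab x s i := h2
    rcases lt_trichotomy y v with h | h | h
    · have := rank_lt h1 h; omega
    · exact h
    · have := rank_lt hv h; omega
  · rintro ⟨a, rfl⟩
    exact (hspec a).2.1.1

/-- For `n < 2 ^ k` the weights and the threshold have fewer than `k + 8` bits and the question is
asked directly. Otherwise `2 ^ k ≤ n`, and the enumeration of all choices of types has polynomial
length. -/
theorem newDataGT_iff (S : TypeSystem) {k j θ : ℕ} (hm : contractSize x s ≤ max k 2)
    (hE : ∀ a < contractSize x s, ∀ c < 5, contractData x s a c ≤ vertexCount x + 1)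
    (hj : j < 5) (hθ : θ ≤ vertexCount x) :
    NewDataGT S.oracle x k s j θ ↔
      S.Fits (contractSize x s) (contractAdj x s) (contractData x s) j θ := by
  have hmK : contractSize x s < k + 8 := by omega
  have hpow : 2 ^ k < 2 ^ (k + 8) := Nat.pow_lt_pow_right (by norm_num) (by omega)
  have hpos : 0 < 2 ^ k := by positivity
  rw [NewDataGT]
  by_cases h : vertexCount x < min (2 ^ k) (vertexCount x + 1)
  · have hlt : vertexCount x < 2 ^ k := by omega
    rw [or_iff_left (fun h' => h'.1 h), and_iff_right h]
    exact S.word_mem_oracle_iff ⟨by omega, hmK, hj, by omega, fun a ha c hc => by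
      have := hE a ha c hc; omega⟩
  · have hle : 2 ^ k ≤ vertexCount x := by omega
    rw [or_iff_right (fun h' => h h'.1), and_iff_right h, S.fits_iff_exists (N := 25 *
      ((vertexCount x + 1) * (vertexCount x + 1) * (vertexCount x + 1)))]
    · refine exists_congr fun c => and_congr_right fun _ => and_congr_left' ?_
      exact S.word_mem_oracle_iff ⟨by omega, hmK, hj, by positivity, fun a _ c' _ =>
        (ind_le_one _).trans_lt (by omega)⟩
    -- From `max k 2 ≤ k + 2` comes the factor `25`, and `5 ≤ 2 ^ 3` gives the cube of `2 ^ k ≤ n +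
    -- 1`.
    · calc 5 ^ contractSize x s ≤ 5 ^ (k + 2) := Nat.pow_le_pow_right (by norm_num) (by omega)
        _ = 25 * 5 ^ k := by ring
        _ ≤ 25 * 8 ^ k := Nat.mul_le_mul_left _ (Nat.pow_le_pow_left (by norm_num) _)
        _ = 25 * (2 ^ k * 2 ^ k * 2 ^ k) := by
          rw [← mul_pow, ← mul_pow]; norm_num
        _ ≤ _ := by gcongr <;> omega

/-- An optimum is recovered by counting the thresholds below it; as it is at most `n + 1`, the
thresholds up to `n` suffice. -/
theorem newData_eq (S : TypeSystem) {k j m : ℕ} (hm : m ≤ vertexCount x + 1)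
    (h : ∀ θ ≤ vertexCount x, NewDataGT S.oracle x k s j θ ↔ θ < m) :
    newData S.oracle x k s j = m := by
  rw [← sum_ind_lt hm, newData]
  refine Finset.sum_congr rfl fun θ hθ => ?_
  rw [Finset.mem_range] at hθ
  exact congrArg ind (propext (h θ (by omega)))

/-- The state `s` is correct: it describes a contraction of `G`. -/
def IsCorrect (S : TypeSystem) (G : SimpleGraph (Fin (vertexCount x))) (k : ℕ) (s : ℕ → ℕ) : Prop :=
  (∀ i, s i ≤ vertexCount x + 1) ∧
  (∀ k', PrimeWidthLE G Set.univ k' ↔ s 6 ≤ k' ∧ PrimeWidthLE G (aliveSet x s) k') ∧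
  ∃ π, IsContraction G (aliveSet x s) π ∧ (s 6 ≤ k →
    ∀ a ∈ aliveSet x s, ∀ c : Fin 5, s (8 * a + 1 + c) = S.best G (π ⁻¹' {a}) c)

theorem contractSize_le : contractSize x s ≤ vertexCount x := by
  unfold contractSize pairSize spanSize
  exact (Finset.sum_le_card_nsmul _ _ 1 fun z _ => spanTab_le _ _ _).trans (by simp)

theorem roundTab_le {L : Set (List Bool)} {k : ℕ} (h : ∀ i, s i ≤ vertexCount x + 1) (i : ℕ) :
    roundTab L x k s i ≤ vertexCount x + 1 := by
  have h1 := contractSize_le (x := x) (s := s)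
  have h2 : ∀ p, ind p ≤ vertexCount x + 1 := fun p => (ind_le_one p).trans (by omega)
  have h3 : ∀ j, newData L x k s j ≤ vertexCount x + 1 := fun j =>
    (Finset.sum_le_card_nsmul _ _ 1 fun z _ => ind_le_one _).trans (by simp)
  unfold roundTab
  split_ifs
  exacts [h2 _, by omega, h 6, h3 _, h i, h i]

/-- The round contracts a module `M` without smaller nontrivial submodules. The clause on prime
width is maintained for every `k'` and does not depend on the oracle. The optima are guaranteed only
while the recorded prime modules have size at most `k`; beyond that a query may be too short for its
data, but then `k` is not the modular-width and the input is rejected anyway. -/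
theorem roundTab_correct (S : TypeSystem) {k : ℕ} (hG : Encodes x G) {s' : ℕ → ℕ}
    (hs' : ∀ i < 8 * vertexCount x, s' i = roundTab S.oracle x k s i)
    (hb : ∀ i, s' i ≤ vertexCount x + 1) (hn : 0 < vertexCount x) (h : IsCorrect S G k s) :
    IsCorrect S G k s' ∧ ((aliveSet x s).Subsingleton ∧ aliveSet x s' = aliveSet x s ∨
      (aliveSet x s').ncard < (aliveSet x s).ncard) := by
  classical
  obtain ⟨hbs, hw, π, hπ, hdata⟩ := h
  have hs6 := hs' 6 (by omega)
  have hsa : ∀ v : Fin (vertexCount x), s' (8 * v) = roundTab S.oracle x k s (8 * v) := fun v =>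
    hs' _ (by omega)
  have hsd : ∀ (v : Fin (vertexCount x)) (c : Fin 5),
      s' (8 * v + 1 + c) = roundTab S.oracle x k s (8 * v + 1 + c) := fun v c => hs' _ (by omega)
  have m1 : ∀ v, 8 * v % 8 = 0 := fun v => by omega
  have m2 : ∀ v, 8 * v / 8 = v := fun v => by omega
  have m3 : ∀ (v : ℕ) (c : Fin 5), (8 * v + 1 + c) % 8 = 1 + c := fun v c => by omega
  have m4 : ∀ (v : ℕ) (c : Fin 5), (8 * v + 1 + c) / 8 = v := fun v c => by omega
  by_cases hp : bestPair x s < vertexCount x * vertexCount x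
  swap
  · have hsub := bestPair_of_not hp
    simp only [roundTab, if_neg hp] at hs6 hsa hsd
    have hA : aliveSet x s' = aliveSet x s := by
      ext v
      simp only [aliveSet, Set.mem_ofPred_eq, hsa]
    refine ⟨⟨hb, ?_, π, ?_⟩, .inl ⟨hsub, hA⟩⟩
    · rw [hA, hs6]; exact hw
    · rw [hA, hs6]
      exact ⟨hπ, fun h6 a ha c => by rw [hsd]; exact hdata h6 a ha c⟩
  obtain ⟨u, hu, w, hw', huw, hqu, hqw, hmin⟩ := bestPair_spec hG hp
  obtain ⟨e, he, hinj, hrange⟩ := exists_numbering (x := x) (s := s)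
  set A := aliveSet x s with hA
  set M := moduleSpan G A u w with hM
  have hMmod : IsModuleIn G A M := isModuleIn_moduleSpan hu hw'
  have huM : u ∈ M := left_mem_moduleSpan u w
  have hwM : w ∈ M := right_mem_moduleSpan u w
  have htab : ∀ v : Fin (vertexCount x), contractTab x s v ≠ 0 ↔ v ∈ M := fun v => by
    rw [contractTab, hqu, hqw, spanTab_ne_zero_iff hG]
  have hsize : contractSize x s = M.ncard := by
    rw [contractSize, pairSize, hqu, hqw, spanSize_eq hG]
  have heM : Set.range e = M := Set.ext fun v => (hrange v).symm.trans (htab v)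
  have hM2 : 2 ≤ M.ncard := (Set.one_lt_ncard).2 ⟨u, huM, w, hwM, huw⟩
  have h6 : (8 * (u : ℕ) + 1) ≠ 0 := by omega
  simp only [roundTab, if_pos hp, hqu] at hs6 hsa hsd
  simp only [m1, m2, if_true] at hsa
  have m5 : ∀ (v : ℕ) (c : Fin 5), 8 * v + 1 + c ≠ 6 := fun v c => by omega
  simp only [m3, m4, if_neg (m5 _ _), show ∀ c : Fin 5, 1 + (c : ℕ) ≠ 0 from fun c => by omega,
    show ∀ c : Fin 5, 1 + (c : ℕ) < 6 from fun c => by omega, and_true, if_false,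
    Nat.add_sub_cancel_left] at hsd
  have hA' : aliveSet x s' = A \ M ∪ {u} := by
    ext v
    simp only [aliveSet, Set.mem_ofPred_eq, hsa, ne_eq, ind_eq_zero, not_not, Set.mem_union,
      Set.mem_sdiff, Set.mem_singleton_iff]
    rw [← htab, not_not, Fin.ext_iff]
    constructor
    · rintro ⟨h1, h2 | h2⟩
      exacts [.inl ⟨h1, h2⟩, .inr h2]
    · rintro (⟨h1, h2⟩ | h2)
      · exact ⟨h1, .inl h2⟩
      · refine ⟨?_, .inr h2⟩
        rw [h2]
        exact hu
  -- Entry `6` becomes the maximum of its old value and `|M|`, modules of size two being ignored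
  -- since they are not prime.
  have hflag : ∀ k', s' 6 ≤ k' ↔ s 6 ≤ k' ∧ (3 ≤ M.ncard → M.ncard ≤ k') := fun k' => by
    rw [hs6, hsize]
    norm_num
    split_ifs <;> omega
  refine ⟨⟨hb, fun k' => ?_, _, hA' ▸ hπ.merge hMmod huM, fun hk a ha c => ?_⟩, .inr ?_⟩
  · rw [hw, hflag, hA', primeWidthLE_contract hMmod (fun M' h1 h2 h3 =>
      eq_moduleSpan_of_subset hmin h1 h2 h3) huM]
    tauto
  · obtain ⟨hk1, hk2⟩ := (hflag k).1 hk
    rw [hsd]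
    by_cases hau : a = u
    · subst hau
      rw [if_pos rfl]
      -- The new class of the representative is the disjoint union of the old classes of the
      -- vertices of `M`, to which `lt_best_iUnion_iff` applies.
      have hpre : (fun v => if π v ∈ M then a else π v) ⁻¹' {a} = ⋃ i, π ⁻¹' {e i} := by
        ext v
        simp only [Set.mem_preimage, Set.mem_singleton_iff, Set.mem_iUnion]
        rw [show (∃ i, π v = e i) ↔ π v ∈ Set.range e from exists_congr fun i => eq_comm, heM]
        split_ifs with h1
        · simp [h1]
        · exact ⟨fun h2 => absurd (h2 ▸ huM) h1, fun h2 => absurd h2 h1⟩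
      have hcd : ∀ (i : Fin (contractSize x s)) (c : Fin 5),
          contractData x s i c = S.best G (π ⁻¹' {e i}) c := fun i c => by
        rw [contractData, he]
        exact hdata hk1 _ (hMmod.1 (heM ▸ Set.mem_range_self i)) c
      have hsubst : IsSubstitution G (TypeSystem.quotientGraph (contractSize x s) (contractAdj x s))
          fun i => π ⁻¹' {e i} := hπ.isSubstitution hinj fun i j => by
        rw [TypeSystem.quotientGraph, SimpleGraph.fromRel_adj, contractAdj, contractAdj, he, he,
          hG, hG, G.adj_comm (e j), or_self, and_iff_right_iff_imp]
        rintro hij rfl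
        exact hij.ne rfl
      rw [hpre]
      refine newData_eq S ((S.best_le _ _).trans ?_) fun θ hθ => ?_
      · exact Nat.add_le_add_right ((Set.ncard_le_card _).trans_eq (Nat.card_fin _)) 1
      · rw [newDataGT_iff S (by omega) (fun i _ c _ => hbs _) c.2 hθ,
          S.lt_best_iUnion_iff (by omega) hsubst (fun i => ⟨e i, ?_⟩) hcd]
        exact hπ.id _ (hMmod.1 (heM ▸ Set.mem_range_self i))
    · rw [hA'] at ha
      have haAM := ha.resolve_right hau
      rw [if_neg fun h => hau (Fin.ext h), hdata hk1 a haAM.1]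
      congr 1
      ext v
      simp only [Set.mem_preimage, Set.mem_singleton_iff]
      split_ifs with h1
      · exact ⟨fun h => absurd (h ▸ h1) haAM.2, fun h => absurd h.symm hau⟩
      · rfl
  · rw [hA']
    refine Set.ncard_lt_ncard ⟨Set.union_subset Set.sdiff_subset (Set.singleton_subset_iff.2 hu),
      fun h => ?_⟩
    rcases h hw' with h | h
    exacts [h.2 hwM, huw h.symm]

end Correct


/-! ### Iterating the rounds down to a single class -/

section Rounds

variable {x : List Bool} {G : SimpleGraph (Fin (vertexCount x))} (S : TypeSystem) {k : ℕ}

/-- The data of a single vertex. -/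
noncomputable def TypeSystem.baseAt (c : ℕ) : ℕ := if h : c < 5 then S.base ⟨c, h⟩ else 0

/-- The initial state: all vertices are alive. -/
noncomputable def initTab (i : ℕ) : ℕ :=
  if i % 8 = 0 then 1 else if i % 8 < 6 then S.baseAt (i % 8 - 1) else 0

/-- The state after all rounds. -/
noncomputable def finalTab (x : List Bool) (k : ℕ) : ℕ → ℕ :=
  iterTab (8 * vertexCount x) (vertexCount x + 1) (initTab S) (roundTab S.oracle x k)
    (vertexCount x)

/-- One more than the maximum size of a solution. -/
noncomputable def finalValue (x : List Bool) (k : ℕ) : ℕ :=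
  if vertexCount x = 0 then 1 else
    finalTab S x k (8 * bfind (vertexCount x) (fun v => finalTab S x k (8 * v) ≠ 0) + 1 + S.target)

theorem TypeSystem.base_le (c : Fin 5) : S.base c ≤ 2 := by
  unfold base
  split_ifs <;> omega

theorem TypeSystem.baseAt_fin (c : Fin 5) : S.baseAt c = S.base c := by simp [baseAt]

theorem initTab_le (i : ℕ) : initTab S i ≤ 2 := by
  unfold initTab TypeSystem.baseAt
  split_ifs
  exacts [by omega, S.base_le _, by omega, by omega]

/-- Each round loses at least one living vertex until only one is left, so as many rounds as there
are vertices suffice. Initially every class is a single vertex and the contraction is the identity.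
-/
theorem isCorrect_iterTab (hG : Encodes x G) (hn : 0 < vertexCount x) (t : ℕ) :
    IsCorrect S G k (iterTab (8 * vertexCount x) (vertexCount x + 1) (initTab S)
      (roundTab S.oracle x k) t) ∧
    (aliveSet x (iterTab (8 * vertexCount x) (vertexCount x + 1) (initTab S)
      (roundTab S.oracle x k) t)).ncard ≤ max 1 (vertexCount x - t) := by
  induction t with
  | zero =>
    have hinit : ∀ i < 8 * vertexCount x, iterTab (8 * vertexCount x) (vertexCount x + 1)
        (initTab S) (roundTab S.oracle x k) 0 i = initTab S i := fun i hi => by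
      have := initTab_le S i
      rw [iterTab, clipTab, if_pos hi, min_eq_left (by omega)]
    -- Entry `6` lies in the block of vertex `0` beyond its five optima, so it starts at `0`: no
    -- prime module has been seen.
    have h6 := hinit 6 (by omega)
    have hA : aliveSet x (iterTab (8 * vertexCount x) (vertexCount x + 1)
        (initTab S) (roundTab S.oracle x k) 0) = Set.univ := by
      refine Set.eq_univ_of_forall fun v => ?_
      show iterTab _ _ _ _ 0 (8 * (v : ℕ)) ≠ 0
      rw [hinit _ (by omega)]
      simp [initTab]
    refine ⟨⟨iterTab_le _ _ _ _ _, fun k' => ?_, id, ⟨fun v => ?_, fun _ _ => rfl,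
      fun _ _ _ => Iff.rfl⟩, fun _ a _ c => ?_⟩, ?_⟩
    · rw [hA, h6]
      simp [initTab]
    · rw [hA]; trivial
    · rw [hinit _ (by omega)]
      have h1 : (8 * (a : ℕ) + 1 + c) % 8 = 1 + c := by omega
      have h2 : 1 + (c : ℕ) ≠ 0 := by omega
      have h3 : 1 + (c : ℕ) < 6 := by omega
      rw [initTab, h1, if_neg h2, if_pos h3, Nat.add_sub_cancel_left, S.baseAt_fin,
        Set.preimage_id, S.best_singleton]
    · refine (Set.ncard_le_card _).trans ?_
      rw [Nat.card_fin]
      omega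
  | succ t ih =>
    obtain ⟨h1, h2⟩ := roundTab_correct S hG (s' := iterTab (8 * vertexCount x) (vertexCount x + 1)
      (initTab S) (roundTab S.oracle x k) (t + 1)) (fun i hi => by
        rw [iterTab, clipTab, if_pos hi, min_eq_left (roundTab_le ih.1.1 i)])
      (iterTab_le _ _ _ _ _) hn ih.1
    refine ⟨h1, ?_⟩
    rcases h2 with ⟨h2, h3⟩ | h2
    · rw [h3]
      exact (Set.ncard_le_one_iff_subsingleton.2 h2).trans (le_max_left _ _)
    · have := ih.2
      omega

/-- At the end at most one vertex is alive, so no prime set remains and entry `6` alone decides the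
width. This holds for every `k`, which is why the algorithm can check its parameter. -/
theorem modularWidth_eq (hG : Encodes x G) : modularWidth G = finalTab S x k 6 := by
  rcases Nat.eq_zero_or_pos (vertexCount x) with hn | hn
  · rw [finalTab, iterTab_eq_zero _ _ _ _ _ _ (by omega), ← Nat.le_zero, modularWidth_le_iff]
    intro T _ hT
    have := (Set.ncard_le_card T).trans_eq (Nat.card_fin _)
    omega
  · obtain ⟨⟨-, h1, -⟩, h2⟩ := isCorrect_iterTab (k := k) S hG hn (vertexCount x)
    have key : ∀ k', modularWidth G ≤ k' ↔ finalTab S x k 6 ≤ k' := fun k' => by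
      rw [modularWidth_le_iff, h1]
      refine and_iff_left fun T hT hT' => ?_
      have h3 := Set.ncard_le_ncard hT
      have := hT'.1
      omega
    exact le_antisymm ((key _).2 le_rfl) ((key _).1 le_rfl)

/-- The class of the last living vertex is the whole vertex set. Without vertices there is no such
class; the empty solution then gives the value `1`. -/
theorem finalValue_eq (hG : Encodes x G) (hk : modularWidth G = k) :
    finalValue S x k = S.best G Set.univ S.target := by
  rcases Nat.eq_zero_or_pos (vertexCount x) with hn | hn
  · have : IsEmpty (Fin (vertexCount x)) := by rw [hn]; infer_instance
    rw [finalValue, if_pos hn, Set.univ_eq_empty_iff.2 this]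
    refine le_antisymm (S.lt_best_iff.2 ⟨∅, subset_rfl, S.empty, Nat.zero_le _⟩) ?_
    refine (S.best_le _ _).trans (by simp)
  · obtain ⟨⟨-, h1, π, hπ, hd⟩, h2⟩ := isCorrect_iterTab (k := k) S hG hn (vertexCount x)
    rw [← finalTab] at hπ hd h2
    have hr := hπ.mem ⟨0, hn⟩
    obtain ⟨h3, h4, -⟩ := bfind_spec (n := vertexCount x) (p := fun v => finalTab S x k (8 * v) ≠ 0)
      ⟨_, (π ⟨0, hn⟩).2, hr⟩
    have h5 : (aliveSet x (finalTab S x k)).Subsingleton :=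
      Set.ncard_le_one_iff_subsingleton.1 (by omega)
    rw [finalValue, if_neg hn.ne']
    have hk' : finalTab S x k 6 = k := (modularWidth_eq S hG).symm.trans hk
    generalize bfind (vertexCount x) (fun v => finalTab S x k (8 * v) ≠ 0) = r at h3 h4 ⊢
    rw [hd hk'.le ⟨r, h3⟩ h4 S.target]
    congr 1
    exact Set.eq_univ_of_forall fun v => h5 (hπ.mem v) h4

end Rounds


/-! ### Reading the input -/

section Decode

/-- The integer of the encoded instance is negative. -/
def signAt (x : List Bool) : Prop :=
  bitAt x (vertexCount x + 1 + vertexCount x * vertexCount x)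

/-- The absolute value of the integer of the encoded instance, with all powers of `2` cut off above
the number of vertices. -/
noncomputable def magnitude (x : List Bool) : ℕ :=
  ∑ i ∈ Finset.range (x.length - (vertexCount x + 1 + vertexCount x * vertexCount x + 1)),
    ind (bitAt x (vertexCount x + 1 + vertexCount x * vertexCount x + 1 + i)) *
      min (2 ^ i) (vertexCount x)

/-- The string `x` is the code of an instance. -/
def WellFormed (x : List Bool) : Prop :=
  vertexCount x + 1 + vertexCount x * vertexCount x < x.length ∧
  (∀ u < vertexCount x, ∀ v < vertexCount x, adjAt x u v → adjAt x v u) ∧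
  (∀ u < vertexCount x, ¬ adjAt x u u) ∧
  (x.length = vertexCount x + 1 + vertexCount x * vertexCount x + 1 → ¬ signAt x) ∧
  (vertexCount x + 1 + vertexCount x * vertexCount x + 1 < x.length → bitAt x (x.length - 1))

theorem List.ext_bitAt {x y : List Bool} (hl : x.length = y.length)
    (h : ∀ i < x.length, bitAt x i ↔ bitAt y i) : x = y := by
  refine List.ext_getElem hl fun i h1 h2 => ?_
  have := h i h1
  rw [bitAt, bitAt, List.getD_eq_getElem _ _ h1, List.getD_eq_getElem _ _ h2] at this
  exact Bool.eq_iff_iff.2 this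

variable {n : ℕ}

theorem length_encodeInstance (G : SimpleGraph (Fin n)) (z : ℤ) :
    (encodeInstance G z).length = n + 1 + n * n + 1 + z.natAbs.bits.length := by
  simp [encodeInstance, encodeInt, Function.comp_def]
  ring

theorem bitAt_append (x y : List Bool) (i : ℕ) :
    bitAt (x ++ y) i ↔ (i < x.length ∧ bitAt x i) ∨ (x.length ≤ i ∧ bitAt y (i - x.length)) := by
  rcases lt_or_ge i x.length with h | h
  · simp [bitAt, h, h.not_ge, List.getElem?_append_left]
  · simp [bitAt, h, h.not_gt, List.getElem?_append_right]

theorem pairCode_lt (u v : Fin n) : (u : ℕ) * n + v < n * n := by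
  calc (u : ℕ) * n + v < (u + 1) * n := by linarith [v.2]
    _ ≤ _ := Nat.mul_le_mul_right _ u.2

open Classical in
theorem bitAt_adjacency (G : SimpleGraph (Fin n)) (u v : Fin n) :
    bitAt (List.ofFn fun i : Fin n => List.ofFn fun j : Fin n => decide (G.Adj i j)).flatten
      (u * n + v) ↔ G.Adj u v := by
  have h0 : 0 < n := u.pos
  have e1 : ((u : ℕ) * n + v) / n = u := by
    rw [add_comm, Nat.add_mul_div_right _ _ h0, Nat.div_eq_of_lt v.2, zero_add]
  have e2 : ((u : ℕ) * n + v) % n = v := by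
    rw [add_comm, Nat.add_mul_mod_self_right, Nat.mod_eq_of_lt v.2]
  have hmul := List.ofFn_mul (m := n) (n := n) fun i : Fin (n * n) =>
    decide (G.Adj ⟨i / n, Nat.div_lt_of_lt_mul i.2⟩ ⟨i % n, Nat.mod_lt _ (by
      by_contra h; have := i.2; simp [Nat.eq_zero_of_not_pos h] at this)⟩)
  have hrow : ∀ i j : Fin n, ((i : ℕ) * n + j) / n = i ∧ ((i : ℕ) * n + j) % n = j := fun i j => by
    rw [add_comm, Nat.add_mul_div_right _ _ h0, Nat.div_eq_of_lt j.2, zero_add,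
      Nat.add_mul_mod_self_right, Nat.mod_eq_of_lt j.2]
    exact ⟨rfl, rfl⟩
  simp only [hrow, Fin.eta] at hmul
  rw [← hmul, bitAt, List.getD_eq_getElem _ _ (by simpa using pairCode_lt u v)]
  simp [e1, e2]

theorem bitAt_encodeInstance (G : SimpleGraph (Fin n)) (z : ℤ) :
    (∀ i < n, bitAt (encodeInstance G z) i) ∧ ¬ bitAt (encodeInstance G z) n ∧
    (∀ u v : Fin n, bitAt (encodeInstance G z) (n + 1 + (u * n + v)) ↔ G.Adj u v) ∧
    (bitAt (encodeInstance G z) (n + 1 + n * n) ↔ z < 0) ∧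
    ∀ i, bitAt (encodeInstance G z) (n + 1 + n * n + 1 + i) ↔ bitAt z.natAbs.bits i := by
  have hl1 : (List.replicate n true ++ [false]).length = n + 1 := by simp
  have hl2 := fun M : List Bool => fun hM : M.length = n * n => show
    (List.replicate n true ++ [false] ++ M).length = n + 1 + n * n by simp [hM]; ring
  classical
  have hM : (List.ofFn fun i : Fin n => List.ofFn fun j : Fin n =>
      decide (G.Adj i j)).flatten.length = n * n := by
    simp [Function.comp_def]
  refine ⟨fun i hi => ?_, ?_, fun u v => ?_, ?_, fun i => ?_⟩
  · rw [encodeInstance, List.append_assoc, List.append_assoc, bitAt_append]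
    exact .inl ⟨by simpa using hi, by simp [bitAt, hi]⟩
  · rw [encodeInstance, List.append_assoc, List.append_assoc, bitAt_append]
    simp [bitAt]
  · have := pairCode_lt u v
    rw [encodeInstance, bitAt_append, bitAt_append, hl2 _ hM, hl1,
      Nat.add_sub_cancel_left, bitAt_adjacency]
    constructor
    · rintro (⟨-, ⟨h, -⟩ | ⟨-, h⟩⟩ | ⟨h, -⟩)
      · omega
      · exact h
      · omega
    · exact fun h => .inl ⟨by omega, .inr ⟨by omega, h⟩⟩
  · rw [encodeInstance, bitAt_append, hl2 _ hM, Nat.sub_self]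
    simp [bitAt, encodeInt]
  · rw [encodeInstance, bitAt_append, hl2 _ hM]
    have e : n + 1 + n * n + 1 + i - (n + 1 + n * n) = i + 1 := by omega
    have e' : ¬ n + 1 + n * n + 1 + i < n + 1 + n * n := by omega
    have e'' : n + 1 + n * n ≤ n + 1 + n * n + 1 + i := by omega
    simp only [e, e', e'', false_and, true_and, false_or]
    simp [bitAt, encodeInt]

theorem vertexCount_encodeInstance (G : SimpleGraph (Fin n)) (z : ℤ) :
    vertexCount (encodeInstance G z) = n := by
  obtain ⟨h1, h2, -⟩ := bitAt_encodeInstance G z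
  exact bfind_eq (by rw [length_encodeInstance]; omega) (fun i hi h => h (h1 i hi)) fun _ => h2

theorem bitAt_bits (m i : ℕ) : bitAt m.bits i ↔ m / 2 ^ i % 2 = 1 := by
  have := Nat.testBit_eq_inth m i
  rw [← List.getD_default_eq_getI, Nat.testBit_eq_decide_div_mod_eq] at this
  rw [bitAt, show false = default from rfl, ← this, decide_eq_true_iff]

theorem sum_bits (m N : ℕ) : ∑ i ∈ Finset.range N, ind (bitAt m.bits i) * 2 ^ i = m % 2 ^ N := by
  induction N with
  | zero => simp [Nat.mod_one]
  | succ N ih =>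
    rw [Finset.sum_range_succ, ih, Nat.mod_pow_succ, mul_comm]
    congr 2
    by_cases h : m / 2 ^ N % 2 = 1
    · rw [ind_of ((bitAt_bits _ _).2 h), h]
    · rw [ind_of_not fun h' => h ((bitAt_bits _ _).1 h')]
      omega

/-- Cutting the powers off at `C` changes nothing, or a cut-off power occurs with a positive
coefficient and both sums reach `C`. -/
theorem sum_min_eq_or (b : ℕ → ℕ) (C N : ℕ) :
    ∑ i ∈ Finset.range N, b i * min (2 ^ i) C = ∑ i ∈ Finset.range N, b i * 2 ^ i ∨
      (C ≤ ∑ i ∈ Finset.range N, b i * min (2 ^ i) C ∧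
        C ≤ ∑ i ∈ Finset.range N, b i * 2 ^ i) := by
  induction N with
  | zero => simp
  | succ N ih =>
    rw [Finset.sum_range_succ, Finset.sum_range_succ]
    rcases ih with ih | ih
    · rcases le_total (2 ^ N) C with h | h
      · rw [ih, min_eq_left h]; exact .inl rfl
      · rcases Nat.eq_zero_or_pos (b N) with hb | hb
        · rw [ih, hb]; simp
        · rw [min_eq_right h]
          have h1 : C ≤ b N * C := Nat.le_mul_of_pos_left _ hb
          have h2 : C ≤ b N * 2 ^ N := h1.trans (Nat.mul_le_mul_left _ h)
          exact .inr ⟨by omega, by omega⟩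
    · exact .inr ⟨by omega, by omega⟩

/-- The integer of an instance may be exponentially large in the input length. Only its truncated
difference from the number of vertices matters, and there the cut-off is invisible. -/
theorem sub_magnitude {x : List Bool} {m : ℕ}
    (hl : x.length = vertexCount x + 1 + vertexCount x * vertexCount x + 1 + m.bits.length)
    (h : ∀ i, bitAt x (vertexCount x + 1 + vertexCount x * vertexCount x + 1 + i) ↔
      bitAt m.bits i) : vertexCount x - magnitude x = vertexCount x - m := by
  have h1 : magnitude x = ∑ i ∈ Finset.range m.bits.length,
      ind (bitAt m.bits i) * min (2 ^ i) (vertexCount x) := by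
    rw [magnitude, hl, Nat.add_sub_cancel_left]
    simp only [h]
  have h2 := sum_bits m m.bits.length
  rw [Nat.size_eq_bits_len, Nat.mod_eq_of_lt (Nat.lt_size_self m), ← Nat.size_eq_bits_len] at h2
  have h3 := sum_min_eq_or (fun i => ind (bitAt m.bits i)) (vertexCount x) m.bits.length
  rw [← h1, h2] at h3
  omega

theorem bits_last {m : ℕ} (h : m ≠ 0) : 0 < m.bits.length ∧ bitAt m.bits (m.bits.length - 1) := by
  have h0 : 0 < m.size := Nat.size_pos.2 (Nat.pos_of_ne_zero h)
  rw [bitAt_bits, Nat.size_eq_bits_len]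
  refine ⟨h0, ?_⟩
  have h1 : 2 ^ (m.size - 1) ≤ m := Nat.lt_size.1 (by omega)
  have h2 := Nat.lt_size_self m
  obtain ⟨l, hl⟩ : ∃ l, m.size = l + 1 := ⟨m.size - 1, by omega⟩
  rw [hl] at h1 h2 ⊢
  rw [Nat.add_sub_cancel] at h1 ⊢
  rw [pow_succ] at h2
  have h3 : m / 2 ^ l = 1 := Nat.div_eq_of_lt_le (by omega) (by omega)
  rw [h3]

/-- The least significant digit comes first, so a nonempty string is a binary expansion as soon as
its last digit is `1`. -/
theorem exists_bits_eq (t : List Bool) (h : t ≠ [] → bitAt t (t.length - 1)) :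
    ∃ m : ℕ, m.bits = t := by
  induction t with
  | nil => exact ⟨0, by simp⟩
  | cons b t ih =>
    rcases eq_or_ne t [] with rfl | ht
    · have : b = true := by simpa [bitAt] using h
      exact ⟨1, by simp [this]⟩
    · have hlen : 0 < t.length := List.length_pos_iff.2 ht
      obtain ⟨m, rfl⟩ := ih fun _ => by
        have := h (by simp)
        obtain ⟨l, hl⟩ : ∃ l, t.length = l + 1 := ⟨t.length - 1, by omega⟩
        simpa [bitAt, hl] using this
      refine ⟨Nat.bit b m, Nat.bits_append_bit m b ?_⟩
      rintro rfl
      simp at ht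

/-- The codes of instances are well-formed. -/
theorem wellFormed_encodeInstance (G : SimpleGraph (Fin n)) (z : ℤ) :
    WellFormed (encodeInstance G z) := by
  obtain ⟨-, -, h3, h4, h5⟩ := bitAt_encodeInstance G z
  have hn := vertexCount_encodeInstance G z
  have hl := length_encodeInstance G z
  simp only [WellFormed, adjAt, signAt, hn, hl, h4]
  refine ⟨by omega, fun u hu v hv h => ?_, fun u hu h => ?_, fun h hz => ?_, fun h => ?_⟩
  · exact (h3 ⟨v, hv⟩ ⟨u, hu⟩).2 ((h3 ⟨u, hu⟩ ⟨v, hv⟩).1 h).symm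
  · exact ((h3 ⟨u, hu⟩ ⟨u, hu⟩).1 h).ne rfl
  · have := (bits_last (m := z.natAbs) (by omega)).1
    omega
  · have h0 : z.natAbs ≠ 0 := fun h0 => by simp [h0] at h
    obtain ⟨h6, h7⟩ := bits_last h0
    rw [show n + 1 + n * n + 1 + z.natAbs.bits.length - 1 =
      n + 1 + n * n + 1 + (z.natAbs.bits.length - 1) by omega, h5]
    exact h7

/-- Every well-formed string is the code of an instance. -/
theorem WellFormed.exists_eq {x : List Bool} (h : WellFormed x) :
    ∃ (n : ℕ) (G : SimpleGraph (Fin n)) (z : ℤ), x = encodeInstance G z := by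
  obtain ⟨hlen, hsymm, hirr, hsign, hlast⟩ := h
  have hlt : vertexCount x < x.length := by omega
  obtain ⟨-, hb1, hb2⟩ := bfind_spec (bfind_lt_iff.1 hlt)
  rw [← vertexCount] at hb1 hb2
  generalize hn : vertexCount x = n at *
  simp only [adjAt, signAt, hn] at *
  set t := x.drop (n + 1 + n * n + 1) with ht
  have htl : t.length = x.length - (n + 1 + n * n + 1) := by simp [ht]
  have htb : ∀ i, bitAt t i ↔ bitAt x (n + 1 + n * n + 1 + i) := fun i => by
    simp [bitAt, ht]
  obtain ⟨m, hm⟩ := exists_bits_eq t fun hne => by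
    have := List.length_pos_iff.2 hne
    rw [htb]
    convert hlast (by omega) using 1
    omega
  -- The string must not code a negative zero, which `encodeInt` never produces.
  have hm0 : bitAt x (n + 1 + n * n) → m ≠ 0 := by
    rintro hs rfl
    have : t.length = 0 := by rw [← hm]; simp
    exact hsign (by omega) hs
  classical
  let G : SimpleGraph (Fin n) :=
    { Adj := fun u v => bitAt x (n + 1 + (u * n + v))
      symm := ⟨fun u v h => hsymm u u.2 v v.2 h⟩
      loopless := ⟨fun u h => hirr u u.2 h⟩ }
  let z : ℤ := if bitAt x (n + 1 + n * n) then -m else m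
  have hz : z.natAbs = m := by
    simp only [z]; split_ifs <;> simp
  have hz0 : z < 0 ↔ bitAt x (n + 1 + n * n) := by
    simp only [z]
    split_ifs with h
    · have := hm0 h
      simp only [h, iff_true]
      omega
    · simp only [h, iff_false]
      omega
  obtain ⟨h1, h2, h3, h4, h5⟩ := bitAt_encodeInstance G z
  have hl := length_encodeInstance G z
  rw [hz, hm, htl] at hl
  refine ⟨n, G, z, List.ext_bitAt (by omega) fun i hi => ?_⟩
  rcases lt_trichotomy i n with hin | rfl | hin
  · have := hb2 i hin
    rw [not_not] at this
    exact iff_of_true this (h1 i hin)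
  · exact iff_of_false hb1 h2
  rcases lt_trichotomy i (n + 1 + n * n) with hi2 | rfl | hi2
  · have hpos : 0 < n := by
      by_contra h0
      rw [Nat.eq_zero_of_not_pos h0] at hi2 hin
      omega
    have h6 : i - (n + 1) < n * n := by omega
    have h7 := h3 ⟨(i - (n + 1)) / n, Nat.div_lt_of_lt_mul h6⟩
      ⟨(i - (n + 1)) % n, Nat.mod_lt _ hpos⟩
    have h8 : n + 1 + ((i - (n + 1)) / n * n + (i - (n + 1)) % n) = i := by
      rw [Nat.div_add_mod']
      omega
    simp only [h8] at h7
    rw [h7]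
    show _ ↔ bitAt x _
    simp only [h8]
  · rw [h4, hz0]
  · obtain ⟨j, rfl⟩ : ∃ j, i = n + 1 + n * n + 1 + j := ⟨i - (n + 1 + n * n + 1), by omega⟩
    rw [h5, hz, hm, htb]

end Decode


/-! ### The compressions -/

section Compression

namespace Env

variable {β : Type*} {L : Set (List Bool)} {Δ : Ctx β} {x : β → List Bool} {k : β → ℕ}
  {s : β → ℕ → ℕ}

theorem signPos (h : Env L Δ x k s) : Comp L Δ fun b =>
    _root_.vertexCount (x b) + 1 + _root_.vertexCount (x b) * _root_.vertexCount (x b) :=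
  (h.vertexCount.add (.const 1)).add h.vertexCount_sq

theorem signAt (h : Env L Δ x k s) : CompP L Δ fun b => signAt (x b) := h.bitAt h.signPos

theorem magnitude (h : Env L Δ x k s) : Comp L Δ fun b => magnitude (x b) := by
  have key : ∀ o, Comp L (Δ.ext o) fun q => ind (_root_.bitAt (x q.1) (_root_.vertexCount (x q.1) +
      1 + _root_.vertexCount (x q.1) * _root_.vertexCount (x q.1) + 1 + q.2)) *
        min (2 ^ q.2) (_root_.vertexCount (x q.1)) := fun o => by
    have e := h.ext o
    exact (e.bitAt ((e.signPos.add (.const 1)).add .var)).ind.mul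
      (Comp.min_two_pow e.vertexCount .var)
  have := Comp.sum (h.len.sub (h.signPos.add (.const 1))) key
  exact this

theorem wellFormed (h : Env L Δ x k s) : CompP L Δ fun b => WellFormed (x b) := by
  have h1 : CompP L Δ fun b => ∀ u < _root_.vertexCount (x b), ∀ v < _root_.vertexCount (x b),
      _root_.adjAt (x b) u v → _root_.adjAt (x b) v u := by
    refine CompP.forall_lt (p := fun b u => ∀ v < _root_.vertexCount (x b),
      _root_.adjAt (x b) u v → _root_.adjAt (x b) v u) h.vertexCount fun o => ?_
    refine CompP.forall_lt (p := fun q v => _root_.adjAt (x q.1) q.2 v → _root_.adjAt (x q.1) v q.2)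
      (h.ext o).vertexCount fun o' => ?_
    have e := (h.ext o).ext o'
    exact (e.adjAt Comp.var.fst_ext .var).imp (e.adjAt .var Comp.var.fst_ext)
  have h2 : CompP L Δ fun b => ∀ u < _root_.vertexCount (x b), ¬ _root_.adjAt (x b) u u :=
    CompP.forall_lt (p := fun b u => ¬ _root_.adjAt (x b) u u) h.vertexCount fun o =>
      ((h.ext o).adjAt .var .var).not
  have hp := h.signPos.add (.const 1)
  exact (h.signPos.lt h.len).and (h1.and (h2.and (((h.len.eq hp).imp h.signAt.not).and
    ((hp.lt h.len).imp (h.bitAt (h.len.sub (.const 1)))))))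

end Env

variable (S : TypeSystem)

theorem TypeSystem.comp_baseAt {α : Type*} {L : Set (List Bool)} {Γ : Ctx α} {f : α → ℕ}
    (hf : Comp L Γ f) : Comp L Γ fun a => S.baseAt (f a) := by
  refine (Comp.ite (hf.eq (.const 0)) (.const (S.base 0)) (Comp.ite (hf.eq (.const 1))
    (.const (S.base 1)) (Comp.ite (hf.eq (.const 2)) (.const (S.base 2)) (Comp.ite (hf.eq (.const 3))
    (.const (S.base 3)) (Comp.ite (hf.eq (.const 4)) (.const (S.base 4)) (.const 0)))))).congr
    fun a => ?_
  unfold TypeSystem.baseAt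
  generalize f a = c
  rcases c with _ | _ | _ | _ | _ | c <;> simp

/-- The predicate by which the algorithm decides, in terms of the final state. -/
def Accepts (x : List Bool) (k : ℕ) (s : ℕ → ℕ) : Prop :=
  WellFormed x ∧ s 6 = k ∧ ¬ signAt x ∧ vertexCount x - magnitude x <
    if vertexCount x = 0 then 1 else
      s (8 * bfind (vertexCount x) (fun v => s (8 * v) ≠ 0) + 1 + S.target)

theorem Env.accepts {β : Type*} {L : Set (List Bool)} {Δ : Ctx β} {x : β → List Bool} {k : β → ℕ}
    {s : β → ℕ → ℕ} (h : Env L Δ x k s) : CompP L Δ fun b => Accepts S (x b) (k b) (s b) := by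
  have h1 : Comp L Δ fun b => _root_.bfind (_root_.vertexCount (x b)) fun v => s b (8 * v) ≠ 0 :=
    Comp.bfind (p := fun b v => s b (8 * v) ≠ 0) h.vertexCount fun o =>
      ((h.ext o).state ((Comp.const 8).mul .var)).ne_zero
  have h2 := Comp.ite (h.vertexCount.eq (.const 0)) (.const 1)
    (h.state ((((Comp.const 8).mul h1).add (.const 1)).add (.const S.target)))
  have h3 := (h.vertexCount.sub h.magnitude).lt h2
  exact h.wellFormed.and (((h.state (.const 6)).eq h.par).and (h.signAt.not.and h3))

/-- The whole algorithm is one table iteration: `n` rounds on a table with eight entries per vertex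
and values at most `n + 1`, followed by the test for acceptance. -/
theorem compP_accepts : CompP S.oracle inputCtx fun y => Accepts S y.1 y.2 (finalTab S y.1 y.2) := by
  have hbit : ∀ o, CompP S.oracle (inputCtx.ext o) fun q => bitAt q.1.1 q.2 := fun o =>
    (Comp.lookup (hasTab_input.fst_ext o) .var).ne_zero.congr fun q => by simp [bitAt]
  have hn : Comp S.oracle inputCtx fun y => vertexCount y.1 :=
    Comp.bfind (p := fun y i => ¬ bitAt y.1 i) comp_length fun o => (hbit o).not
  have hlen := (Comp.const 8).mul hn
  have hcap := hn.add (.const 1)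
  have henv : ∀ o, Env S.oracle (inputCtx.tab o (fun y => 8 * vertexCount y.1)
      fun y => vertexCount y.1 + 1) (fun q => q.1.1) (fun q => q.1.2) (fun q => q.2) := fun o =>
    { tabx := hasTab_input.fst_tab o
      len := comp_length.fst_tab
      tabs := ⟨_, HasTab.snd hlen.1 hcap.1 o⟩
      par_eq := fun _ => rfl
      par := comp_param.fst_tab }
  have hmod : ∀ o, Comp S.oracle (inputCtx.ext o) fun q => q.2 % 8 := fun o => Comp.var.mod (.const 8)
  have hinit : ∀ o, Comp S.oracle (inputCtx.ext o) fun q => initTab S q.2 := fun o =>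
    Comp.ite ((hmod o).eq (.const 0)) (.const 1) (Comp.ite ((hmod o).lt (.const 6))
      (S.comp_baseAt ((hmod o).sub (.const 1))) (.const 0))
  have hround : ∀ o o', Comp S.oracle ((inputCtx.tab o (fun y => 8 * vertexCount y.1)
      fun y => vertexCount y.1 + 1).ext o')
      fun q => roundTab S.oracle q.1.1.1 q.1.1.2 q.1.2 q.2 := fun o o' => by
    have := ((henv o).ext o').roundTab (z := fun q => q.2) .var
    exact this
  have hfin : ∀ o, Comp S.oracle (inputCtx.tab o (fun y => 8 * vertexCount y.1)
      fun y => vertexCount y.1 + 1) fun q => ind (Accepts S q.1.1 q.1.2 q.2) := fun o =>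
    (henv o).accepts S
  have := Comp.letIter hn hlen hcap hinit hround hfin
  exact this

/-- On codes of instances, acceptance means that the computed width equals the parameter and that
some complement `Y` of a solution has at least `n - z` vertices. All other strings are excluded by
`WellFormed`. -/
theorem mem_paramByModularWidth_iff
    {P : ∀ {n : ℕ}, SimpleGraph (Fin n) → Set (Fin n) → Prop}
    (hP : ∀ {n : ℕ} (G : SimpleGraph (Fin n)) (X : Set (Fin n)),
      P G X ↔ S.P G Set.univ Xᶜ S.target) (y : List Bool × ℕ) :
    y ∈ paramByModularWidth P ↔ Accepts S y.1 y.2 (finalTab S y.1 y.2) := by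
  have key : ∀ {n : ℕ} (G : SimpleGraph (Fin n)) (z : ℤ) (x : List Bool) (k : ℕ),
      x = encodeInstance G z → (Accepts S x k (finalTab S x k) ↔
        modularWidth G = k ∧ ∃ X, P G X ∧ (X.ncard : ℤ) ≤ z) := by
    intro n G z x k hx
    have hw := wellFormed_encodeInstance G z
    have hn := vertexCount_encodeInstance G z
    have hl := length_encodeInstance G z
    obtain ⟨-, -, h3, h4, h5⟩ := bitAt_encodeInstance G z
    rw [← hx] at hw hn hl h3 h4 h5
    subst hn
    have hG : Encodes x G := h3
    have hsub := sub_magnitude hl h5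
    unfold Accepts
    rw [← modularWidth_eq S hG, and_iff_right hw]
    refine and_congr_right fun hk => ?_
    have hval := finalValue_eq S hG hk
    rw [finalValue] at hval
    rw [hval, hsub, signAt, h4, S.lt_best_iff]
    have hcard : ∀ Y : Set (Fin (vertexCount x)), Y.ncard + Yᶜ.ncard = vertexCount x := fun Y => by
      rw [Set.ncard_add_ncard_compl, Nat.card_fin]
    constructor
    · rintro ⟨hz, Y, -, hY, hle⟩
      refine ⟨Yᶜ, by rwa [hP, compl_compl], ?_⟩
      have := hcard Y
      omega
    · rintro ⟨X, hX, hle⟩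
      have := hcard X
      exact ⟨by omega, Xᶜ, Set.subset_univ _, (hP G X).1 hX, by omega⟩
  obtain ⟨x, k⟩ := y
  constructor
  · rintro ⟨n, G, z, he, hX⟩
    obtain ⟨hx, hk⟩ := Prod.mk.inj he
    exact (key G z x k hx).2 ⟨hk.symm, hX⟩
  · intro h
    obtain ⟨n, G, z, hx⟩ := h.1.exists_eq
    obtain ⟨hk, hX⟩ := (key G z x k hx).1 h
    exact ⟨n, G, z, Prod.ext hx hk.symm, hX⟩

theorem hasPTC_paramByModularWidth
    {P : ∀ {n : ℕ}, SimpleGraph (Fin n) → Set (Fin n) → Prop}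
    (hP : ∀ {n : ℕ} (G : SimpleGraph (Fin n)) (X : Set (Fin n)),
      P G X ↔ S.P G Set.univ Xᶜ S.target) : HasPTC (paramByModularWidth P) :=
  .of_compP S.oracle ((compP_accepts S).congr (mem_paramByModularWidth_iff S hP))

end Compression


/-! ### The four problems and the final statement -/

theorem hasPTC_vertexCoverMW : HasPTC VertexCoverMW :=
  hasPTC_paramByModularWidth vcSystem fun _ _ => isVertexCover_iff

theorem hasPTC_connectedVertexCoverMW : HasPTC ConnectedVertexCoverMW :=
  hasPTC_paramByModularWidth cvcSystem fun _ _ => isConnectedVertexCover_iff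

theorem hasPTC_feedbackVertexSetMW : HasPTC FeedbackVertexSetMW :=
  hasPTC_paramByModularWidth fvsSystem fun _ _ => isFeedbackVertexSet_iff

theorem hasPTC_oddCycleTransversalMW : HasPTC OddCycleTransversalMW :=
  hasPTC_paramByModularWidth octSystem fun _ _ => isOddCycleTransversal_iff

theorem mainTheorem6 :
    (HasPTC VertexCoverMW ∧ HasPTC ConnectedVertexCoverMW ∧
      HasPTC FeedbackVertexSetMW ∧ HasPTC OddCycleTransversalMW) ∧
    (∀ {V : Type*} {W : Type*} [Finite V] [Finite W] (G : SimpleGraph V) (H : SimpleGraph W)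
      (M : Set V), IsGraphModule G M →
      Nat.card M = Nat.card W →
      minVC (G.induce M) = minVC H →
      minFVS (G.induce M) = minFVS H →
      minOCT (G.induce M) = minOCT H →
      Nat.card ((Mᶜ : Set V) ⊕ W) ≤ Nat.card V ∧
      minVC (moduleReplace G M H) ≤ minVC G ∧
      minFVS (moduleReplace G M H) ≤ minFVS G ∧
      minOCT (moduleReplace G M H) ≤ minOCT G ∧
      (G.Connected → H.Connected →
        (minCVC (G.induce M) ≠ ⊤ → minCVC (G.induce M) = minCVC H) →
        minCVC (moduleReplace G M H) ≤ minCVC G)) := by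
  refine ⟨⟨hasPTC_vertexCoverMW, hasPTC_connectedVertexCoverMW, hasPTC_feedbackVertexSetMW,
    hasPTC_oddCycleTransversalMW⟩, fun {V W} _ _ G H M hM hcard hvc hfvs hoct => ?_⟩
  obtain ⟨h1, h2, h3⟩ := moduleReplace_le hM hcard hvc hfvs hoct
  exact ⟨(card_replace hcard).le, h1, h2, h3, fun _ hH hcvc =>
    minCVC_moduleReplace_le hM hcard hvc hH hcvc⟩
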